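/- Let $n,m\ge 0$ be integers, let $E$ be a smooth (Hausdorff) manifold of dimension $n+m$ and $M$ a nonempty smooth (Hausdorff) manifold of dimension $n$, and let $\Gamma$, $\Theta$ be smooth torsion-free linear connections on $TE\to E$ and $TM\to M$. Notation. $J^r(E,n)$ is the space of $r$-jets $[L]^r_p$ of $n$-dimensional embedded submanifolds $L\ni p$ of $E$ (classes for the contact of order $r$ at $p$); $J^1(E,n)$, with $[L]^1_p=T_pL$, is the Grassmann bundle of $n$-planes of $TE$. $\operatorname{Imm}J^r\mathrm{pr}_M$ is the space of $r$-jets $[s]^r_x$, $x\in M$, of local immersions $s:M\to E$; $[s]^1_x$ is the triple $(x,s(x),T_xs)$. The $R$-plane of $\theta=[L]^2_p$ is $R_\theta=T_{[L]^1_p}L^{(1)}\subset T_{[L]^1_p}J^1(E,n)$, where $L^{(1)}=\{[L]^1_q: q\in L\}$; similarly, the $R$-plane of $[s]^2_x$ is the tangent space at $[s]^1_x$ of $\{[s]^1_y\}$. The maps $\mathrm{pr}_E^{(r)}:\operatorname{Imm}J^r\mathrm{pr}_M\to J^r(E,n)$ send $[s]^r_x$ to $[\operatorname{im}s]^r_{s(x)}$;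 in particular $\mathrm{pr}_E^{(1)}(x,p,\ell)=(p,\operatorname{im}\ell)$. Equations. $\mathcal S\subset J^2(E,n)$ is the set of jets $[L]^2_p$ such that the second fundamental form $(X,Y)\mapsto\nabla^\Gamma_XY \bmod T_pL$ of $L$ vanishes at $p$. $\mathcal S_{\mathrm{pr}_M}\subset\operatorname{Imm}J^2\mathrm{pr}_M$ is the set of jets $[s]^2_x$ such that $\nabla^\Gamma_{X}(Ts(Y))-Ts(\nabla^\Theta_XY)$ vanishes at $x$; in coordinates, $\partial_\xi\partial_\lambda s^C+\Gamma_A{}^C{}_B\,\partial_\xi s^A\,\partial_\lambda s^B-\Theta_\xi{}^\eta{}_\lambda\,\partial_\eta s^C=0$. Structures. $\Gamma$ induces on $J^1(E,n)\to E$ the connection $\dot\Gamma$ with coefficients $\dot\Gamma_A{}^k{}_\xi=\Gamma_A{}^k{}_\xi+\Gamma_A{}^k{}_iu^i_\xi-u^k_\beta(\Gamma_A{}^\beta{}_\xi+\Gamma_A{}^\beta{}_iu^i_\xi)$ in divided charts (vertical projection $(du^k_\xi+\dot\Gamma_A{}^k{}_\xi du^A)\otimes du^\xi\otimes\partial_{u^k}$),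 and $(\Gamma,\Theta)$ induces on $J^1\mathrm{pr}_M\to M\times E$ the connection $\dot\Gamma_{\mathrm{pr}_M}=\mathrm{pr}_E^*\Gamma\otimes\mathrm{pr}_M^*\Theta^*$. Theorem. There is exactly one section $\ddot\Gamma:J^1(E,n)\to J^2(E,n)$ of the jet projection such that, for every $\theta_1\in J^1(E,n)$, $R_{\ddot\Gamma(\theta_1)}$ is the $\dot\Gamma$-horizontal lift of the plane $\theta_1$; and exactly one section $\ddot\Gamma_{\mathrm{pr}_M}:\operatorname{Imm}J^1\mathrm{pr}_M\to\operatorname{Imm}J^2\mathrm{pr}_M$ such that, for every $\tilde\theta_1=(x,p,\ell)$, $R_{\ddot\Gamma_{\mathrm{pr}_M}(\tilde\theta_1)}$ is the $\dot\Gamma_{\mathrm{pr}_M}$-horizontal lift of $\{(\xi,\ell\xi)\}\subset T_xM\times T_pE$. Their images are $\mathcal S$ and $\mathcal S_{\mathrm{pr}_M}$ respectively, so that $\mathcal S\simeq J^1(E,n)$ and $\mathcal S_{\mathrm{pr}_M}\simeq\operatorname{Imm}J^1\mathrm{pr}_M$, and $\mathrm{pr}_E^{(2)}\circ\ddot\Gamma_{\mathrm{pr}_M}=\ddot\Gamma\circ\mathrm{pr}_E^{(1)}$.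 Under these identifications $\mathcal S_{\mathrm{pr}_M}$ covers $\mathcal S$ with covering map $\mathrm{pr}_E^{(1)}$: the fields of planes $R\circ\ddot\Gamma_{\mathrm{pr}_M}:\tilde\theta_1\mapsto R_{\ddot\Gamma_{\mathrm{pr}_M}(\tilde\theta_1)}$ and $R\circ\ddot\Gamma:\theta_1\mapsto R_{\ddot\Gamma(\theta_1)}$ are smooth $n$-dimensional distributions, $\mathrm{pr}_E^{(1)}$ is a smooth surjection, and for every $\tilde\theta_1\in\operatorname{Imm}J^1\mathrm{pr}_M$ the tangent map of $\mathrm{pr}_E^{(1)}$ at $\tilde\theta_1$ sends $R_{\ddot\Gamma_{\mathrm{pr}_M}(\tilde\theta_1)}$ isomorphically onto $R_{\ddot\Gamma(\mathrm{pr}_E^{(1)}(\tilde\theta_1))}$. -/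

import Mathlib

open Set Filter Topology
open scoped Manifold ContDiff

noncomputable section

namespace TotGeod

/-- Euclidean model space of dimension `k`. -/
abbrev Rn (k : ℕ) : Type := EuclideanSpace ℝ (Fin k)

/-! ### Coordinates on tangent spaces -/

section TangentCoord

variable {k : ℕ} {P : Type*} [TopologicalSpace P] [ChartedSpace (Rn k) P]

/-- The tangent space of `P` at `p`. -/
abbrev Tan (k : ℕ) {P : Type*} [TopologicalSpace P] [ChartedSpace (Rn k) P] (p : P) : Type :=
  TangentSpace 𝓘(ℝ, Rn k) p

variable [IsManifold 𝓘(ℝ, Rn k) ∞ P]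

/-- Derivative at `p` of the change of coordinates from the chart `i` to the chart `j`. -/
def coordJac (i j : atlas (Rn k) P) (p : P) : Rn k →L[ℝ] Rn k :=
  (tangentBundleCore 𝓘(ℝ, Rn k) P).coordChange i j p

theorem coordJac_comp {i j l : atlas (Rn k) P} {p : P} (hi : p ∈ i.1.source)
    (hj : p ∈ j.1.source) (hl : p ∈ l.1.source) (v : Rn k) :
    coordJac j l p (coordJac i j p v) = coordJac i l p v :=
  (tangentBundleCore 𝓘(ℝ, Rn k) P).coordChange_comp i j l p ⟨⟨hi, hj⟩, hl⟩ v

theorem coordJac_self {i : atlas (Rn k) P} {p : P} (hi : p ∈ i.1.source) (v : Rn k) :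
    coordJac i i p v = v :=
  (tangentBundleCore 𝓘(ℝ, Rn k) P).coordChange_self i p hi v

/-- The expression in the chart `i` of tangent vectors at a point `p` of its domain, i.e. the
derivative of `i` at `p`. -/
def tangentCoordOn (i : atlas (Rn k) P) (p : P) (h : p ∈ i.1.source) : Tan k p ≃L[ℝ] Rn k :=
  ContinuousLinearEquiv.equivOfInverse
    (show Tan k p →L[ℝ] Rn k from coordJac (achart (Rn k) p) i p)
    (show Rn k →L[ℝ] Tan k p from coordJac i (achart (Rn k) p) p)
    (fun v => (coordJac_comp (mem_chart_source _ p) h (mem_chart_source _ p) v).trans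
      (coordJac_self (mem_chart_source _ p) v))
    (fun v => (coordJac_comp h (mem_chart_source _ p) h v).trans (coordJac_self h v))

open Classical in
/-- Total version of `tangentCoordOn`; the value for `p` outside the domain of `i` is
irrelevant. -/
def tangentCoord (i : atlas (Rn k) P) (p : P) : Tan k p ≃L[ℝ] Rn k :=
  if h : p ∈ i.1.source then tangentCoordOn i p h
  else tangentCoordOn (achart (Rn k) p) p (mem_chart_source _ p)

theorem tangentCoord_apply {i : atlas (Rn k) P} {p : P} (h : p ∈ i.1.source) (v : Tan k p) :
    tangentCoord i p v = coordJac (achart (Rn k) p) i p v := by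
  rw [tangentCoord, dif_pos h]
  rfl

theorem tangentCoord_symm_apply {i : atlas (Rn k) P} {p : P} (h : p ∈ i.1.source) (v : Rn k) :
    (tangentCoord i p).symm v = coordJac i (achart (Rn k) p) p v := by
  rw [tangentCoord, dif_pos h]
  rfl

theorem tangentCoord_tangentCoord_symm {i j : atlas (Rn k) P} {p : P} (hi : p ∈ i.1.source)
    (hj : p ∈ j.1.source) (v : Rn k) :
    tangentCoord j p ((tangentCoord i p).symm v) = coordJac i j p v := by
  rw [tangentCoord_apply hj, tangentCoord_symm_apply hi]
  exact coordJac_comp hi (mem_chart_source _ p) hj v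

theorem contDiffOn_transition (i j : atlas (Rn k) P) :
    ContDiffOn ℝ ∞ (j.1 ∘ i.1.symm) (i.1.symm ≫ₕ j.1).source := by
  have := (contDiffGroupoid ∞ 𝓘(ℝ, Rn k)).compatible i.2 j.2
  rw [contDiffGroupoid, mem_groupoid_of_pregroupoid] at this
  simpa [contDiffPregroupoid] using this.1

theorem contDiffOn_coordJac (i j : atlas (Rn k) P) :
    ContDiffOn ℝ ∞ (fun u => coordJac i j (i.1.symm u)) (i.1.symm ≫ₕ j.1).source := by
  have h := (contDiffOn_transition i j).fderiv_of_isOpen (m := ∞)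
    (i.1.symm ≫ₕ j.1).open_source (by simp)
  refine h.congr fun u hu => ?_
  have hu' : u ∈ i.1.target := by
    have := hu.1
    simpa using this
  simp [coordJac, i.1.right_inv hu', Function.comp_def]

end TangentCoord

/-! ### Linear algebra of graphs -/

section Graphs

variable {n m : ℕ}

theorem finrank_graph (l : Rn n →L[ℝ] Rn m) :
    Module.finrank ℝ (LinearMap.graph (l : Rn n →ₗ[ℝ] Rn m)) = n := by
  rw [LinearMap.graph_eq_range_prod, LinearMap.finrank_range_of_inj]
  · simp
  · intro x y h
    exact (Prod.ext_iff.1 h).1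

/-- First block `x ↦ fst (T (x, l x))`. -/
def blockA (T : (Rn n × Rn m) →L[ℝ] (Rn n × Rn m)) (l : Rn n →L[ℝ] Rn m) : Rn n →L[ℝ] Rn n :=
  (ContinuousLinearMap.fst ℝ (Rn n) (Rn m)).comp
    (T.comp ((ContinuousLinearMap.id ℝ (Rn n)).prod l))

/-- Second block `x ↦ snd (T (x, l x))`. -/
def blockC (T : (Rn n × Rn m) →L[ℝ] (Rn n × Rn m)) (l : Rn n →L[ℝ] Rn m) : Rn n →L[ℝ] Rn m :=
  (ContinuousLinearMap.snd ℝ (Rn n) (Rn m)).comp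
    (T.comp ((ContinuousLinearMap.id ℝ (Rn n)).prod l))

theorem map_graph_eq_iff (T : (Rn n × Rn m) →L[ℝ] (Rn n × Rn m)) (hT : Function.Injective T)
    (l l' : Rn n →L[ℝ] Rn m) :
    (LinearMap.graph (l : Rn n →ₗ[ℝ] Rn m)).map (T : (Rn n × Rn m) →ₗ[ℝ] (Rn n × Rn m)) =
        LinearMap.graph (l' : Rn n →ₗ[ℝ] Rn m) ↔
      IsUnit (blockA T l) ∧ l' = (blockC T l).comp (Ring.inverse (blockA T l)) := by
  constructor
  · intro h
    have key : ∀ x, blockC T l x = l' (blockA T l x) := by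
      intro x
      have : T (x, l x) ∈ LinearMap.graph (l' : Rn n →ₗ[ℝ] Rn m) := by
        rw [← h]
        exact ⟨(x, l x), rfl, rfl⟩
      exact this
    have hinj : Function.Injective (blockA T l) := by
      rw [injective_iff_map_eq_zero]
      intro x hx
      have h2 : T (x, l x) = 0 := by
        apply Prod.ext
        · exact hx
        · have := key x
          rw [hx, map_zero] at this
          exact this
      have := hT (h2.trans (map_zero T).symm)
      exact (Prod.ext_iff.1 this).1
    have hu : IsUnit (blockA T l) := by
      let e := LinearEquiv.ofInjectiveEndo (blockA T l : Rn n →ₗ[ℝ] Rn n) hinj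
      exact ⟨ContinuousLinearEquiv.toUnit e.toContinuousLinearEquiv, by ext x; rfl⟩
    refine ⟨hu, ?_⟩
    have h1 : blockC T l = l'.comp (blockA T l) := by
      ext1 x
      exact key x
    rw [h1, ContinuousLinearMap.comp_assoc]
    have h3 : (blockA T l).comp (Ring.inverse (blockA T l)) = 1 :=
      Ring.mul_inverse_cancel _ hu
    rw [h3]
    rfl
  · rintro ⟨hu, rfl⟩
    have h3 : ∀ x, blockA T l (Ring.inverse (blockA T l) x) = x := fun x =>
      congrArg (fun f : Rn n →L[ℝ] Rn n => f x) (Ring.mul_inverse_cancel _ hu)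
    have h4 : ∀ x, Ring.inverse (blockA T l) (blockA T l x) = x := fun x =>
      congrArg (fun f : Rn n →L[ℝ] Rn n => f x) (Ring.inverse_mul_cancel _ hu)
    ext ⟨x, y⟩
    constructor
    · rintro ⟨⟨a, b⟩, hab, hxy⟩
      have hb : b = l a := hab
      subst hb
      have hx : x = blockA T l a := (congrArg Prod.fst hxy).symm
      have hy : y = blockC T l a := (congrArg Prod.snd hxy).symm
      subst hx hy
      change blockC T l a = blockC T l (Ring.inverse (blockA T l) (blockA T l a))
      rw [h4]
    · intro h
      have hy : y = blockC T l (Ring.inverse (blockA T l) x) := h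
      refine ⟨(Ring.inverse (blockA T l) x, l (Ring.inverse (blockA T l) x)), rfl, ?_⟩
      apply Prod.ext
      · exact h3 x
      · exact hy.symm

theorem graph_injective : Function.Injective
    fun l : Rn n →L[ℝ] Rn m => LinearMap.graph (l : Rn n →ₗ[ℝ] Rn m) := by
  intro l l' h
  ext1 x
  have : (x, l x) ∈ LinearMap.graph (l' : Rn n →ₗ[ℝ] Rn m) := by
    have h' : LinearMap.graph (l : Rn n →ₗ[ℝ] Rn m) = LinearMap.graph (l' : Rn n →ₗ[ℝ] Rn m) := h
    rw [← h']
    rfl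
  exact this

/-- An `n`-plane in `ℝⁿ⁺ᵐ` can be made horizontal by a linear splitting `ℝⁿ⁺ᵐ ≃ ℝⁿ × ℝᵐ`. -/
theorem exists_splitting (W : Submodule ℝ (Rn (n + m))) (hW : Module.finrank ℝ W = n) :
    ∃ A : Rn (n + m) ≃L[ℝ] (Rn n × Rn m), ∃ l : Rn n →L[ℝ] Rn m,
      W.map (A : Rn (n + m) →ₗ[ℝ] (Rn n × Rn m)) = LinearMap.graph (l : Rn n →ₗ[ℝ] Rn m) := by
  obtain ⟨W', hc⟩ := W.exists_isCompl
  have hW' : Module.finrank ℝ W' = m := by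
    have := Submodule.finrank_add_eq_of_isCompl hc
    rw [hW, finrank_euclideanSpace_fin] at this
    omega
  let e1 : W ≃ₗ[ℝ] Rn n := LinearEquiv.ofFinrankEq _ _ (by rw [hW]; simp)
  let e2 : W' ≃ₗ[ℝ] Rn m := LinearEquiv.ofFinrankEq _ _ (by rw [hW']; simp)
  let A : Rn (n + m) ≃ₗ[ℝ] (Rn n × Rn m) :=
    (Submodule.prodEquivOfIsCompl W W' hc).symm.trans (e1.prodCongr e2)
  refine ⟨A.toContinuousLinearEquiv, 0, ?_⟩
  ext ⟨x, y⟩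
  constructor
  · rintro ⟨w, hw, hwx⟩
    have h1 : (Submodule.prodEquivOfIsCompl W W' hc).symm w = ((⟨w, hw⟩ : W), (0 : W')) :=
      Submodule.prodEquivOfIsCompl_symm_apply_left W W' hc ⟨w, hw⟩
    have h2 : A w = (e1 ⟨w, hw⟩, 0) := by
      simp only [A, LinearEquiv.trans_apply, h1]
      simp
    have h3 : A w = (x, y) := hwx
    have : y = 0 := by
      rw [h2] at h3
      exact (congrArg Prod.snd h3).symm
    simpa using this
  · intro h
    have hy : y = 0 := by simpa using h
    subst hy
    refine ⟨(e1.symm x : W), (e1.symm x).2, ?_⟩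
    have h1 : (Submodule.prodEquivOfIsCompl W W' hc).symm (e1.symm x : W) = (e1.symm x, (0 : W')) :=
      Submodule.prodEquivOfIsCompl_symm_apply_left W W' hc (e1.symm x)
    change A (e1.symm x : W) = (x, 0)
    simp only [A, LinearEquiv.trans_apply, h1]
    simp

end Graphs

/-! ### The Grassmann bundle `J¹(E,n)` -/

section GrassmannBundle

/-- `J¹(E,n)`: the Grassmann bundle of `n`-dimensional subspaces of the tangent spaces of the
`(n+m)`-dimensional manifold `E`. The class `[L]¹_p` is the tangent plane `T_p L`. -/
@[ext]
structure J1 (n m : ℕ) (E : Type*) [TopologicalSpace E] [ChartedSpace (Rn (n + m)) E] where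
  pt : E
  plane : Submodule ℝ (Tan (n + m) pt)
  finrank_eq : Module.finrank ℝ plane = n

/-- Model space `(u^A, u^i_λ)` of `J¹(E,n)`. -/
abbrev J1Model (n m : ℕ) : Type := Rn (n + m) × (Rn n →L[ℝ] Rn m)

variable {n m : ℕ} {E : Type*} [TopologicalSpace E] [ChartedSpace (Rn (n + m)) E]
  [IsManifold 𝓘(ℝ, Rn (n + m)) ∞ E]

/-- A divided chart of `E`: a chart `i` with a splitting `A : ℝⁿ⁺ᵐ ≃ ℝⁿ × ℝᵐ` of its coordinates
into `(u^λ)` and `(u^i)`. -/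
abbrev DividedChart (n m : ℕ) (E : Type*) [TopologicalSpace E] [ChartedSpace (Rn (n + m)) E] :=
  atlas (Rn (n + m)) E × (Rn (n + m) ≃L[ℝ] (Rn n × Rn m))

/-- Divided coordinates of tangent vectors at `p`. -/
def dividedCoord (c : DividedChart n m E) (p : E) : Tan (n + m) p ≃L[ℝ] (Rn n × Rn m) :=
  (tangentCoord c.1 p).trans c.2

/-- The plane `θ`, read in the divided chart `c`, is the graph of `l`: in coordinates
`l = (u^i_λ)`. -/
def IsGraphOf (c : DividedChart n m E) (θ : J1 n m E) (l : Rn n →L[ℝ] Rn m) : Prop :=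
  θ.plane.map (dividedCoord c θ.pt : Tan (n + m) θ.pt →ₗ[ℝ] (Rn n × Rn m)) =
    LinearMap.graph (l : Rn n →ₗ[ℝ] Rn m)

theorem IsGraphOf.unique {c : DividedChart n m E} {θ : J1 n m E} {l l' : Rn n →L[ℝ] Rn m}
    (h : IsGraphOf c θ l) (h' : IsGraphOf c θ l') : l = l' :=
  graph_injective (h.symm.trans h')

/-- The plane at `p` whose expression in the divided chart `c` is the graph of `l`. -/
def ofGraph (c : DividedChart n m E) (p : E) (l : Rn n →L[ℝ] Rn m) : J1 n m E where
  pt := p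
  plane := (LinearMap.graph (l : Rn n →ₗ[ℝ] Rn m)).map
    ((dividedCoord c p).symm : (Rn n × Rn m) →ₗ[ℝ] Tan (n + m) p)
  finrank_eq :=
    (LinearEquiv.finrank_map_eq (dividedCoord c p).symm.toLinearEquiv _).trans (finrank_graph l)

theorem isGraphOf_ofGraph (c : DividedChart n m E) (p : E) (l : Rn n →L[ℝ] Rn m) :
    IsGraphOf c (ofGraph c p l) l := by
  unfold IsGraphOf ofGraph
  ext y
  constructor
  · rintro ⟨_, ⟨x, hx, rfl⟩, rfl⟩
    have : (dividedCoord c p) ((dividedCoord c p).symm x) = x :=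
      (dividedCoord c p).apply_symm_apply x
    rw [← this] at hx
    exact hx
  · intro hy
    exact ⟨_, ⟨y, hy, rfl⟩, (dividedCoord c p).apply_symm_apply y⟩

theorem IsGraphOf.eq_ofGraph {c : DividedChart n m E} {θ : J1 n m E} {l : Rn n →L[ℝ] Rn m}
    (h : IsGraphOf c θ l) : ofGraph c θ.pt l = θ := by
  obtain ⟨p, W, hW⟩ := θ
  unfold ofGraph
  congr 1
  rw [← show _ = _ from h]
  ext y
  constructor
  · rintro ⟨_, ⟨x, hx, rfl⟩, rfl⟩
    have : (dividedCoord c p).symm ((dividedCoord c p) x) = x :=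
      (dividedCoord c p).symm_apply_apply x
    rw [← this] at hx
    exact hx
  · intro hy
    exact ⟨_, ⟨y, hy, rfl⟩, (dividedCoord c p).symm_apply_apply y⟩

open Classical in
/-- The coordinates `(u^i_λ)` of a plane in the divided chart `c`. -/
def J1.slope (c : DividedChart n m E) (θ : J1 n m E) : Rn n →L[ℝ] Rn m :=
  if h : ∃ l, IsGraphOf c θ l then h.choose else 0

theorem J1.slope_eq {c : DividedChart n m E} {θ : J1 n m E} {l : Rn n →L[ℝ] Rn m}
    (h : IsGraphOf c θ l) : J1.slope c θ = l := by
  have hex : ∃ l, IsGraphOf c θ l := ⟨_, h⟩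
  rw [J1.slope, dif_pos hex]
  exact hex.choose_spec.unique h

/-- The chart `(u^A, u^i_λ)` of `J¹(E,n)` induced by a divided chart of `E`, defined on the planes
that are graphs over the coordinates `u^λ`. -/
def J1.chart (c : DividedChart n m E) : PartialEquiv (J1 n m E) (J1Model n m) where
  toFun θ := (c.1.1 θ.pt, J1.slope c θ)
  invFun z := ofGraph c (c.1.1.symm z.1) z.2
  source := {θ | θ.pt ∈ c.1.1.source ∧ ∃ l, IsGraphOf c θ l}
  target := c.1.1.target ×ˢ univ
  map_source' θ h := ⟨c.1.1.map_source h.1, mem_univ _⟩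
  map_target' z h := ⟨c.1.1.map_target h.1, z.2, isGraphOf_ofGraph _ _ _⟩
  left_inv' θ h := by
    obtain ⟨h1, l, hl⟩ := h
    dsimp only
    rw [J1.slope_eq hl, c.1.1.left_inv h1]
    exact hl.eq_ofGraph
  right_inv' z h :=
    Prod.ext (c.1.1.right_inv h.1) (J1.slope_eq (isGraphOf_ofGraph c (c.1.1.symm z.1) z.2))

/-- The change of divided coordinates of tangent vectors. -/
def dividedJac (c d : DividedChart n m E) (p : E) : (Rn n × Rn m) →L[ℝ] (Rn n × Rn m) :=
  (d.2 : Rn (n + m) →L[ℝ] (Rn n × Rn m)).comp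
    ((coordJac c.1 d.1 p).comp (c.2.symm : (Rn n × Rn m) →L[ℝ] Rn (n + m)))

theorem dividedJac_apply {c d : DividedChart n m E} {p : E} (hc : p ∈ c.1.1.source)
    (hd : p ∈ d.1.1.source) (x : Rn n × Rn m) :
    dividedJac c d p x = dividedCoord d p ((dividedCoord c p).symm x) := by
  change d.2 (coordJac c.1 d.1 p (c.2.symm x)) = d.2 (tangentCoord d.1 p _)
  rw [← tangentCoord_tangentCoord_symm hc hd]
  rfl

theorem isGraphOf_ofGraph_iff {c d : DividedChart n m E} {p : E} (hc : p ∈ c.1.1.source)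
    (hd : p ∈ d.1.1.source) (l l' : Rn n →L[ℝ] Rn m) :
    IsGraphOf d (ofGraph c p l) l' ↔ IsUnit (blockA (dividedJac c d p) l) ∧
      l' = (blockC (dividedJac c d p) l).comp (Ring.inverse (blockA (dividedJac c d p) l)) := by
  rw [← map_graph_eq_iff]
  · unfold IsGraphOf
    have : ((ofGraph c p l).plane.map
        (dividedCoord d p : Tan (n + m) p →ₗ[ℝ] (Rn n × Rn m))) =
        (LinearMap.graph (l : Rn n →ₗ[ℝ] Rn m)).map
          (dividedJac c d p : (Rn n × Rn m) →ₗ[ℝ] (Rn n × Rn m)) := by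
      ext y
      constructor
      · rintro ⟨_, ⟨x, hx, rfl⟩, rfl⟩
        exact ⟨x, hx, dividedJac_apply hc hd x⟩
      · rintro ⟨x, hx, rfl⟩
        exact ⟨_, ⟨x, hx, rfl⟩, (dividedJac_apply hc hd x).symm⟩
    constructor
    · intro h
      exact this.symm.trans h
    · intro h
      exact this.trans h
  · intro x y hxy
    rw [dividedJac_apply hc hd, dividedJac_apply hc hd] at hxy
    exact (dividedCoord c p).symm.injective ((dividedCoord d p).injective hxy)

theorem J1.chart_trans_source (c d : DividedChart n m E) :
    ((J1.chart c).symm.trans (J1.chart d)).source =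
      ((c.1.1.symm ≫ₕ d.1.1).source ×ˢ univ) ∩
        {z | IsUnit (blockA (dividedJac c d (c.1.1.symm z.1)) z.2)} := by
  ext ⟨u, l⟩
  constructor
  · rintro ⟨h1, h2⟩
    have hu : u ∈ c.1.1.target := h1.1
    have hc : c.1.1.symm u ∈ c.1.1.source := c.1.1.map_target hu
    have hd : c.1.1.symm u ∈ d.1.1.source := h2.1
    obtain ⟨l', hl'⟩ := h2.2
    refine ⟨⟨?_, mem_univ _⟩, ((isGraphOf_ofGraph_iff hc hd l l').1 hl').1⟩
    rw [OpenPartialHomeomorph.trans_source]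
    exact ⟨hu, hd⟩
  · rintro ⟨⟨h1, -⟩, h2⟩
    rw [OpenPartialHomeomorph.trans_source] at h1
    have hc : c.1.1.symm u ∈ c.1.1.source := c.1.1.map_target h1.1
    exact ⟨⟨h1.1, mem_univ _⟩, h1.2, _, (isGraphOf_ofGraph_iff hc h1.2 l _).2 ⟨h2, rfl⟩⟩

theorem J1.chart_trans_apply (c d : DividedChart n m E) {z : J1Model n m}
    (hz : z ∈ ((J1.chart c).symm.trans (J1.chart d)).source) :
    (J1.chart c).symm.trans (J1.chart d) z = ((d.1.1 ∘ c.1.1.symm) z.1,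
      (blockC (dividedJac c d (c.1.1.symm z.1)) z.2).comp
        (Ring.inverse (blockA (dividedJac c d (c.1.1.symm z.1)) z.2))) := by
  rw [J1.chart_trans_source] at hz
  obtain ⟨⟨h1, -⟩, h2⟩ := hz
  rw [OpenPartialHomeomorph.trans_source] at h1
  have hc : c.1.1.symm z.1 ∈ c.1.1.source := c.1.1.map_target h1.1
  apply Prod.ext
  · rfl
  · exact J1.slope_eq ((isGraphOf_ofGraph_iff hc h1.2 z.2 _).2 ⟨h2, rfl⟩)

theorem contDiffOn_dividedJac (c d : DividedChart n m E) :
    ContDiffOn ℝ ∞ (fun z : J1Model n m => dividedJac c d (c.1.1.symm z.1))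
      ((c.1.1.symm ≫ₕ d.1.1).source ×ˢ univ) := by
  have h := (contDiffOn_coordJac c.1 d.1).comp
    (contDiff_fst (𝕜 := ℝ) (E := Rn (n + m)) (F := Rn n →L[ℝ] Rn m)).contDiffOn
    (s := (c.1.1.symm ≫ₕ d.1.1).source ×ˢ univ) (fun z hz => hz.1)
  exact contDiffOn_const.clm_comp (h.clm_comp contDiffOn_const)

theorem contDiffOn_block (c d : DividedChart n m E) :
    ContDiffOn ℝ ∞ (fun z : J1Model n m => blockA (dividedJac c d (c.1.1.symm z.1)) z.2)
      ((c.1.1.symm ≫ₕ d.1.1).source ×ˢ univ) ∧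
    ContDiffOn ℝ ∞ (fun z : J1Model n m => blockC (dividedJac c d (c.1.1.symm z.1)) z.2)
      ((c.1.1.symm ≫ₕ d.1.1).source ×ˢ univ) := by
  have h2 : ContDiffOn ℝ ∞
      (fun z : J1Model n m => (ContinuousLinearMap.id ℝ (Rn n)).prod z.2)
      ((c.1.1.symm ≫ₕ d.1.1).source ×ˢ univ) := by
    have h3 : (fun z : J1Model n m => (ContinuousLinearMap.id ℝ (Rn n)).prod z.2) =
        fun z : J1Model n m => ContinuousLinearMap.inl ℝ (Rn n) (Rn m) +
          (ContinuousLinearMap.inr ℝ (Rn n) (Rn m)).comp z.2 := by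
      funext z
      ext x <;> simp
    rw [h3]
    exact (contDiff_const.add (contDiff_const.clm_comp contDiff_snd)).contDiffOn
  have h4 := (contDiffOn_dividedJac c d).clm_comp h2
  exact ⟨contDiffOn_const.clm_comp h4, contDiffOn_const.clm_comp h4⟩

theorem J1.isOpen_chart_trans_source (c d : DividedChart n m E) :
    IsOpen ((J1.chart c).symm.trans (J1.chart d)).source := by
  rw [J1.chart_trans_source]
  exact (contDiffOn_block c d).1.continuousOn.isOpen_inter_preimage
    ((c.1.1.symm ≫ₕ d.1.1).open_source.prod isOpen_univ) Units.isOpen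

theorem J1.contDiffOn_chart_trans (c d : DividedChart n m E) :
    ContDiffOn ℝ ∞ ((J1.chart c).symm.trans (J1.chart d))
      ((J1.chart c).symm.trans (J1.chart d)).source := by
  have hsub : ((J1.chart c).symm.trans (J1.chart d)).source ⊆
      (c.1.1.symm ≫ₕ d.1.1).source ×ˢ univ := by
    rw [J1.chart_trans_source]
    exact inter_subset_left
  refine ContDiffOn.congr ?_ fun z hz => J1.chart_trans_apply c d hz
  refine ContDiffOn.prodMk ?_ ?_
  · exact (contDiffOn_transition c.1 d.1).comp contDiff_fst.contDiffOn fun z hz => (hsub hz).1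
  · refine ((contDiffOn_block c d).2.mono hsub).clm_comp ?_
    intro z hz
    have hA := ((contDiffOn_block c d).1.mono hsub) z hz
    rw [J1.chart_trans_source] at hz
    obtain ⟨a, ha⟩ := hz.2
    have hinv : ContDiffAt ℝ ∞ (Ring.inverse : (Rn n →L[ℝ] Rn n) → _)
        (blockA (dividedJac c d (c.1.1.symm z.1)) z.2) := by
      rw [← ha]
      exact contDiffAt_ringInverse ℝ a
    exact hinv.comp_contDiffWithinAt z hA

theorem exists_dividedChart (θ : J1 n m E) :
    ∃ A : Rn (n + m) ≃L[ℝ] (Rn n × Rn m), ∃ l, IsGraphOf (achart _ θ.pt, A) θ l := by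
  let W : Submodule ℝ (Rn (n + m)) := θ.plane.map
    (tangentCoord (achart (Rn (n + m)) θ.pt) θ.pt).toLinearEquiv.toLinearMap
  have hW : Module.finrank ℝ W = n := (LinearEquiv.finrank_map_eq
    (tangentCoord (achart (Rn (n + m)) θ.pt) θ.pt).toLinearEquiv θ.plane).trans θ.finrank_eq
  obtain ⟨A, l, h⟩ := exists_splitting W hW
  refine ⟨A, l, ?_⟩
  unfold IsGraphOf
  rw [← h]
  ext y
  constructor
  · rintro ⟨x, hx, rfl⟩
    exact ⟨_, ⟨x, hx, rfl⟩, rfl⟩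
  · rintro ⟨_, ⟨x, hx, rfl⟩, rfl⟩
    exact ⟨x, hx, rfl⟩

/-- A splitting of the preferred coordinates at the base point of `θ` for which `θ` is a graph. -/
def J1.splitting (θ : J1 n m E) : Rn (n + m) ≃L[ℝ] (Rn n × Rn m) := (exists_dividedChart θ).choose

/-- The preferred divided chart at `θ`. -/
def J1.dividedChartAt (θ : J1 n m E) : DividedChart n m E := (achart _ θ.pt, θ.splitting)

variable (n m E) in
/-- The smooth atlas of `J¹(E,n)` given by the divided charts of `E`. -/
def J1.core : ChartedSpaceCore (J1Model n m) (J1 n m E) where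
  atlas := range J1.chart
  chartAt θ := J1.chart θ.dividedChartAt
  mem_chart_source θ := ⟨mem_chart_source _ θ.pt, (exists_dividedChart θ).choose_spec⟩
  chart_mem_atlas θ := mem_range_self _
  open_source := by
    rintro _ _ ⟨c, rfl⟩ ⟨d, rfl⟩
    exact J1.isOpen_chart_trans_source c d
  continuousOn_toFun := by
    rintro _ _ ⟨c, rfl⟩ ⟨d, rfl⟩
    exact (J1.contDiffOn_chart_trans c d).continuousOn

instance : TopologicalSpace (J1 n m E) := (J1.core n m E).toTopologicalSpace

instance : ChartedSpace (J1Model n m) (J1 n m E) := (J1.core n m E).toChartedSpace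

instance : IsManifold 𝓘(ℝ, J1Model n m) ∞ (J1 n m E) := by
  apply isManifold_of_contDiffOn
  intro e e' he he'
  obtain ⟨_, ⟨_, rfl⟩, _, ⟨⟨c, rfl⟩, rfl⟩, rfl⟩ := he
  obtain ⟨_, ⟨_, rfl⟩, _, ⟨⟨d, rfl⟩, rfl⟩, rfl⟩ := he'
  refine (J1.contDiffOn_chart_trans c d).mono ?_
  intro z hz
  exact hz.1

end GrassmannBundle

/-! ### The jets `Imm J¹ pr_M` of immersions -/

section ImmersionJets

/-- `Imm J¹ pr_M`: first-order jets at points `x ∈ M` of immersions `M → E`. The jet `[s]¹_x` is the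
triple `(x, s x, T_x s)`. -/
structure ImmJ1 (n m : ℕ) (M E : Type*) [TopologicalSpace M] [ChartedSpace (Rn n) M]
    [TopologicalSpace E] [ChartedSpace (Rn (n + m)) E] where
  pt : M
  val : E
  lin : Tan n pt →L[ℝ] Tan (n + m) val
  inj : Function.Injective lin

/-- Model space `(x^λ, u^A, u^A_{x^λ})` of `Imm J¹ pr_M`. -/
abbrev ImmJ1Model (n m : ℕ) : Type := (Rn n × Rn (n + m)) × (Rn n →L[ℝ] Rn (n + m))

variable {n m : ℕ} {M E : Type*} [TopologicalSpace M] [ChartedSpace (Rn n) M]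
  [TopologicalSpace E] [ChartedSpace (Rn (n + m)) E]
  [IsManifold 𝓘(ℝ, Rn n) ∞ M] [IsManifold 𝓘(ℝ, Rn (n + m)) ∞ E]

variable (n m) in
theorem exists_injective_clm : ∃ B : Rn n →L[ℝ] Rn (n + m), Function.Injective B := by
  let A : Rn (n + m) ≃ₗ[ℝ] (Rn n × Rn m) := LinearEquiv.ofFinrankEq _ _ (by simp)
  refine ⟨(A.toContinuousLinearEquiv.symm : (Rn n × Rn m) →L[ℝ] Rn (n + m)).comp
    (ContinuousLinearMap.inl ℝ (Rn n) (Rn m)), ?_⟩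
  intro x y h
  have := A.toContinuousLinearEquiv.symm.injective h
  exact (Prod.ext_iff.1 this).1

/-- The jet with base points `x`, `p` and expression `B` in the charts `i` of `M` and `j` of `E`. -/
def ImmJ1.ofCoord (i : atlas (Rn n) M) (j : atlas (Rn (n + m)) E) (x : M) (p : E)
    (B : Rn n →L[ℝ] Rn (n + m)) (hB : Function.Injective B) : ImmJ1 n m M E where
  pt := x
  val := p
  lin := ((tangentCoord j p).symm : Rn (n + m) →L[ℝ] Tan (n + m) p).comp
    (B.comp (tangentCoord i x : Tan n x →L[ℝ] Rn n))
  inj := (tangentCoord j p).symm.injective.comp (hB.comp (tangentCoord i x).injective)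

/-- The coordinates `(u^A_{x^λ})` of a jet in the charts `i` of `M` and `j` of `E`. -/
def ImmJ1.coord (i : atlas (Rn n) M) (j : atlas (Rn (n + m)) E) (θ : ImmJ1 n m M E) :
    Rn n →L[ℝ] Rn (n + m) :=
  (tangentCoord j θ.val : Tan (n + m) θ.val →L[ℝ] Rn (n + m)).comp
    (θ.lin.comp ((tangentCoord i θ.pt).symm : Rn n →L[ℝ] Tan n θ.pt))

theorem ImmJ1.coord_injective (i : atlas (Rn n) M) (j : atlas (Rn (n + m)) E)
    (θ : ImmJ1 n m M E) : Function.Injective (θ.coord i j) :=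
  (tangentCoord j θ.val).injective.comp (θ.inj.comp (tangentCoord i θ.pt).symm.injective)

theorem ImmJ1.ofCoord_coord (i : atlas (Rn n) M) (j : atlas (Rn (n + m)) E)
    (θ : ImmJ1 n m M E) :
    ImmJ1.ofCoord i j θ.pt θ.val (θ.coord i j) (θ.coord_injective i j) = θ := by
  obtain ⟨x, p, l, hl⟩ := θ
  unfold ImmJ1.ofCoord
  congr 1
  refine ContinuousLinearMap.ext fun v => ?_
  change (tangentCoord j p).symm (tangentCoord j p (l ((tangentCoord i x).symm
    (tangentCoord i x v)))) = l v
  rw [ContinuousLinearEquiv.symm_apply_apply, ContinuousLinearEquiv.symm_apply_apply]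

theorem ImmJ1.coord_ofCoord {i i' : atlas (Rn n) M} {j j' : atlas (Rn (n + m)) E} {x : M} {p : E}
    (hi : x ∈ i.1.source) (hi' : x ∈ i'.1.source) (hj : p ∈ j.1.source) (hj' : p ∈ j'.1.source)
    (B : Rn n →L[ℝ] Rn (n + m)) (hB : Function.Injective B) :
    (ImmJ1.ofCoord i j x p B hB).coord i' j' =
      (coordJac j j' p).comp (B.comp (coordJac i' i x)) := by
  ext1 v
  change tangentCoord j' p ((tangentCoord j p).symm (B (tangentCoord i x
    ((tangentCoord i' x).symm v)))) = coordJac j j' p (B (coordJac i' i x v))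
  rw [tangentCoord_tangentCoord_symm hj hj', tangentCoord_tangentCoord_symm hi' hi]

open Classical in
/-- An injective linear map, equal to `B` when `B` is injective. -/
def injPart (B : Rn n →L[ℝ] Rn (n + m)) : Rn n →L[ℝ] Rn (n + m) :=
  if Function.Injective B then B else (exists_injective_clm n m).choose

theorem injPart_injective (B : Rn n →L[ℝ] Rn (n + m)) : Function.Injective (injPart B) := by
  unfold injPart
  split_ifs with h
  · exact h
  · exact (exists_injective_clm n m).choose_spec

theorem injPart_eq {B : Rn n →L[ℝ] Rn (n + m)} (h : Function.Injective B) : injPart B = B :=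
  if_pos h

/-- The chart `(x^λ, u^A, u^A_{x^λ})` of `Imm J¹ pr_M` induced by charts of `M` and `E`. -/
def ImmJ1.chart (i : atlas (Rn n) M) (j : atlas (Rn (n + m)) E) :
    PartialEquiv (ImmJ1 n m M E) (ImmJ1Model n m) where
  toFun θ := ((i.1 θ.pt, j.1 θ.val), θ.coord i j)
  invFun z := ImmJ1.ofCoord i j (i.1.symm z.1.1) (j.1.symm z.1.2) (injPart z.2)
    (injPart_injective z.2)
  source := {θ | θ.pt ∈ i.1.source ∧ θ.val ∈ j.1.source}
  target := (i.1.target ×ˢ j.1.target) ×ˢ {B : Rn n →L[ℝ] Rn (n + m) | Function.Injective B}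
  map_source' θ h := ⟨⟨i.1.map_source h.1, j.1.map_source h.2⟩, θ.coord_injective i j⟩
  map_target' z h := ⟨i.1.map_target h.1.1, j.1.map_target h.1.2⟩
  left_inv' θ h := by
    dsimp only
    conv_rhs => rw [← θ.ofCoord_coord i j]
    congr 1
    · exact i.1.left_inv h.1
    · exact j.1.left_inv h.2
    · exact injPart_eq (θ.coord_injective i j)
  right_inv' z h := by
    obtain ⟨⟨u, v⟩, B⟩ := z
    obtain ⟨⟨hu, hv⟩, hB⟩ := h
    have hx := i.1.map_target hu
    have hp := j.1.map_target hv
    refine Prod.ext (Prod.ext (i.1.right_inv hu) (j.1.right_inv hv)) ?_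
    refine (ImmJ1.coord_ofCoord hx hx hp hp _ _).trans ?_
    ext1 w
    change coordJac j j _ (injPart B (coordJac i i _ w)) = B w
    rw [coordJac_self hp, coordJac_self hx, injPart_eq hB]

theorem ImmJ1.chart_trans_source (i i' : atlas (Rn n) M) (j j' : atlas (Rn (n + m)) E) :
    ((ImmJ1.chart i j).symm.trans (ImmJ1.chart i' j')).source =
      ((i.1.symm ≫ₕ i'.1).source ×ˢ (j.1.symm ≫ₕ j'.1).source) ×ˢ
        {B : Rn n →L[ℝ] Rn (n + m) | Function.Injective B} := by
  ext ⟨⟨u, v⟩, B⟩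
  simp only [OpenPartialHomeomorph.trans_source]
  constructor
  · rintro ⟨⟨⟨h1, h2⟩, h3⟩, h4, h5⟩
    exact ⟨⟨⟨h1, h4⟩, ⟨h2, h5⟩⟩, h3⟩
  · rintro ⟨⟨⟨h1, h4⟩, ⟨h2, h5⟩⟩, h3⟩
    exact ⟨⟨⟨h1, h2⟩, h3⟩, h4, h5⟩

theorem ImmJ1.isOpen_chart_trans_source (i i' : atlas (Rn n) M) (j j' : atlas (Rn (n + m)) E) :
    IsOpen ((ImmJ1.chart i j).symm.trans (ImmJ1.chart i' j')).source := by
  rw [ImmJ1.chart_trans_source]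
  exact ((i.1.symm ≫ₕ i'.1).open_source.prod (j.1.symm ≫ₕ j'.1).open_source).prod
    ContinuousLinearMap.isOpen_injective

theorem ImmJ1.contDiffOn_chart_trans (i i' : atlas (Rn n) M) (j j' : atlas (Rn (n + m)) E) :
    ContDiffOn ℝ ∞ ((ImmJ1.chart i j).symm.trans (ImmJ1.chart i' j'))
      ((ImmJ1.chart i j).symm.trans (ImmJ1.chart i' j')).source := by
  rw [ImmJ1.chart_trans_source]
  set S := ((i.1.symm ≫ₕ i'.1).source ×ˢ (j.1.symm ≫ₕ j'.1).source) ×ˢ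
        {B : Rn n →L[ℝ] Rn (n + m) | Function.Injective B} with hS
  have hS1 : ∀ z ∈ S, z.1.1 ∈ (i.1.symm ≫ₕ i'.1).source := fun z hz => hz.1.1
  have hS2 : ∀ z ∈ S, z.1.2 ∈ (j.1.symm ≫ₕ j'.1).source := fun z hz => hz.1.2
  have c1 : ContDiffOn ℝ ∞ (fun z : ImmJ1Model n m => z.1.1) S :=
    (contDiff_fst.comp contDiff_fst).contDiffOn
  have c2 : ContDiffOn ℝ ∞ (fun z : ImmJ1Model n m => z.1.2) S :=
    (contDiff_snd.comp contDiff_fst).contDiffOn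
  have t1 := (contDiffOn_transition i i').comp c1 hS1
  have t2 := (contDiffOn_transition j j').comp c2 hS2
  have k2 := (contDiffOn_coordJac j j').comp c2 hS2
  have k1 : ContDiffOn ℝ ∞ (fun z : ImmJ1Model n m => coordJac i' i (i.1.symm z.1.1)) S := by
    have h1 : ∀ z ∈ S, (i'.1 ∘ i.1.symm) z.1.1 ∈ (i'.1.symm ≫ₕ i.1).source := by
      intro z hz
      have hz1 := hS1 z hz
      rw [OpenPartialHomeomorph.trans_source] at hz1 ⊢
      refine ⟨i'.1.map_source hz1.2, ?_⟩
      change i'.1.symm (i'.1 (i.1.symm z.1.1)) ∈ i.1.source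
      rw [i'.1.left_inv hz1.2]
      exact i.1.map_target hz1.1
    refine ((contDiffOn_coordJac i' i).comp t1 h1).congr ?_
    intro z hz
    have hz1 := hS1 z hz
    rw [OpenPartialHomeomorph.trans_source] at hz1
    change _ = coordJac i' i (i'.1.symm (i'.1 (i.1.symm z.1.1)))
    rw [i'.1.left_inv hz1.2]
  have c3 : ContDiffOn ℝ ∞ (fun z : ImmJ1Model n m => z.2) S := contDiff_snd.contDiffOn
  refine ((t1.prodMk t2).prodMk (k2.clm_comp (c3.clm_comp k1))).congr ?_
  rintro z ⟨⟨hu, hv⟩, hB⟩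
  rw [OpenPartialHomeomorph.trans_source] at hu hv
  refine Prod.ext rfl ?_
  refine (ImmJ1.coord_ofCoord (i.1.map_target hu.1) hu.2 (j.1.map_target hv.1) hv.2
    _ (injPart_injective _)).trans ?_
  rw [injPart_eq hB]
  rfl

variable (n m M E) in
/-- The smooth atlas of `Imm J¹ pr_M` given by the charts of `M` and `E`. -/
def ImmJ1.core : ChartedSpaceCore (ImmJ1Model n m) (ImmJ1 n m M E) where
  atlas := range fun c : atlas (Rn n) M × atlas (Rn (n + m)) E => ImmJ1.chart c.1 c.2
  chartAt θ := ImmJ1.chart (achart _ θ.pt) (achart _ θ.val)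
  mem_chart_source θ := ⟨mem_chart_source _ θ.pt, mem_chart_source _ θ.val⟩
  chart_mem_atlas θ := mem_range_self (achart _ θ.pt, achart _ θ.val)
  open_source := by
    rintro _ _ ⟨c, rfl⟩ ⟨d, rfl⟩
    exact ImmJ1.isOpen_chart_trans_source c.1 d.1 c.2 d.2
  continuousOn_toFun := by
    rintro _ _ ⟨c, rfl⟩ ⟨d, rfl⟩
    exact (ImmJ1.contDiffOn_chart_trans c.1 d.1 c.2 d.2).continuousOn

instance : TopologicalSpace (ImmJ1 n m M E) := (ImmJ1.core n m M E).toTopologicalSpace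

instance : ChartedSpace (ImmJ1Model n m) (ImmJ1 n m M E) := (ImmJ1.core n m M E).toChartedSpace

instance : IsManifold 𝓘(ℝ, ImmJ1Model n m) ∞ (ImmJ1 n m M E) := by
  apply isManifold_of_contDiffOn
  intro e e' he he'
  obtain ⟨_, ⟨_, rfl⟩, _, ⟨⟨c, rfl⟩, rfl⟩, rfl⟩ := he
  obtain ⟨_, ⟨_, rfl⟩, _, ⟨⟨d, rfl⟩, rfl⟩, rfl⟩ := he'
  refine (ImmJ1.contDiffOn_chart_trans c.1 d.1 c.2 d.2).mono ?_
  intro z hz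
  exact hz.1

end ImmersionJets

/-! ### Tangent spaces of subsets, embedded submanifolds and their contact -/

section Submanifolds

/-- The tangent space at `x` of a submanifold `N` of `P`: the span of the velocities at `x` of the
curves of `P` that lie in `N`. -/
def tangentSpaceOf {V : Type*} [NormedAddCommGroup V] [NormedSpace ℝ V] {P : Type*}
    [TopologicalSpace P] [ChartedSpace V P] (N : Set P) (x : P) :
    Submodule ℝ (TangentSpace 𝓘(ℝ, V) x) :=
  Submodule.span ℝ {v | ∃ γ : ℝ → P, γ 0 = x ∧ (∀ᶠ t in 𝓝 (0 : ℝ), γ t ∈ N) ∧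
    MDifferentiableAt 𝓘(ℝ, ℝ) 𝓘(ℝ, V) γ 0 ∧
    (mfderiv 𝓘(ℝ, ℝ) 𝓘(ℝ, V) γ 0 (1 : ℝ) : V) = (v : V)}

theorem exists_antilipschitz_nhds {V W : Type*} [NormedAddCommGroup V] [NormedSpace ℝ V]
    [FiniteDimensional ℝ V] [NormedAddCommGroup W] [NormedSpace ℝ W] {g : V → W} {g' : V →L[ℝ] W}
    {a : V} (h : HasStrictFDerivAt g g' a) (hg : Function.Injective g') :
    ∃ C : ℝ, 0 < C ∧ ∃ U ∈ 𝓝 a, ∀ x ∈ U, ∀ y ∈ U, ‖x - y‖ ≤ C * ‖g x - g y‖ := by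
  obtain ⟨K, hK0, hK⟩ := LinearMap.exists_antilipschitzWith (g' : V →ₗ[ℝ] W)
    (LinearMap.ker_eq_bot.2 hg)
  have hK0' : (0 : ℝ) < K := hK0
  have hbound : ∀ v, ‖v‖ ≤ K * ‖g' v‖ := fun v => by
    have := hK.le_mul_dist v 0
    simpa [dist_eq_norm] using this
  have hlo := h.isLittleO.def (c := 1 / (2 * K)) (by positivity)
  rw [nhds_prod_eq] at hlo
  obtain ⟨U, hU, hU'⟩ := Filter.eventually_prod_self_iff
    (r := fun x y => ‖g x - g y - g' (x - y)‖ ≤ 1 / (2 * K) * ‖x - y‖) |>.1 hlo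
  refine ⟨2 * K, by positivity, U, hU, fun x hx y hy => ?_⟩
  have h1 := hU' x hx y hy
  have h2 := hbound (x - y)
  have h3 : ‖g' (x - y)‖ ≤ ‖g x - g y‖ + 1 / (2 * K) * ‖x - y‖ := by
    have : g' (x - y) = (g x - g y) - (g x - g y - g' (x - y)) := by abel
    rw [this]
    exact (norm_sub_le _ _).trans (by gcongr)
  have h4 : (K : ℝ) * ‖g' (x - y)‖ ≤ K * ‖g x - g y‖ + 1 / 2 * ‖x - y‖ := by
    calc (K : ℝ) * ‖g' (x - y)‖ ≤ K * (‖g x - g y‖ + 1 / (2 * K) * ‖x - y‖) := by gcongr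
      _ = _ := by field_simp
  linarith

/-- A curve in the image of `g` has its velocity in the range of the derivative of `g`. -/
theorem velocity_mem_range {V W : Type*} [NormedAddCommGroup V] [NormedSpace ℝ V]
    [FiniteDimensional ℝ V] [NormedAddCommGroup W] [NormedSpace ℝ W] {g : V → W} {g' : V →L[ℝ] W}
    {a : V} (h : HasStrictFDerivAt g g' a) (hg : Function.Injective g') {c : ℝ → W} {w : W}
    (hc : HasDerivAt c w 0) (hc0 : c 0 = g a)
    (himg : ∀ U ∈ 𝓝 a, ∀ᶠ t in 𝓝 (0 : ℝ), c t ∈ g '' U) :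
    w ∈ LinearMap.range (g' : V →ₗ[ℝ] W) := by
  obtain ⟨C, hC, U, hU, hanti⟩ := exists_antilipschitz_nhds h hg
  have ha : a ∈ U := mem_of_mem_nhds hU
  have hx : ∀ t : ℝ, ∃ x, c t ∈ g '' U → x ∈ U ∧ g x = c t := by
    intro t
    by_cases ht : c t ∈ g '' U
    · obtain ⟨x, hx⟩ := ht
      exact ⟨x, fun _ => hx⟩
    · exact ⟨a, fun h => absurd h ht⟩
  choose x hx using hx
  have hcl : w ∈ closure (LinearMap.range (g' : V →ₗ[ℝ] W) : Set W) := by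
    have hslope : Tendsto (fun t : ℝ => t⁻¹ • (c t - c 0)) (𝓝[≠] 0) (𝓝 w) := by
      have := hasDerivAt_iff_tendsto_slope_zero.1 hc
      simpa using this
    have hxa : ∀ᶠ t in 𝓝 (0 : ℝ), ‖x t - a‖ ≤ C * ‖c t - c 0‖ := by
      filter_upwards [himg U hU] with t ht
      obtain ⟨h1, h2⟩ := hx t ht
      have := hanti _ h1 _ ha
      rwa [h2, ← hc0] at this
    have hcc : Tendsto (fun t => C * ‖c t - c 0‖) (𝓝 0) (𝓝 0) := by
      have h1 : Tendsto c (𝓝 0) (𝓝 (c 0)) := hc.continuousAt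
      have h2 : Tendsto (fun t => c t - c 0) (𝓝 0) (𝓝 0) := by
        simpa using h1.sub_const (c 0)
      simpa using (h2.norm).const_mul C
    have hxt : Tendsto x (𝓝 0) (𝓝 a) := by
      rw [tendsto_iff_norm_sub_tendsto_zero]
      exact squeeze_zero' (Eventually.of_forall fun t => norm_nonneg _) hxa hcc
    have hlo : (fun t => g (x t) - g a - g' (x t - a)) =o[𝓝 (0 : ℝ)] fun t => t := by
      have h1 : (fun t => g (x t) - g a - g' (x t - a)) =o[𝓝 (0 : ℝ)] fun t => x t - a :=
        h.hasFDerivAt.isLittleO.comp_tendsto hxt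
      have h2 : (fun t => x t - a) =O[𝓝 (0 : ℝ)] fun t => c t - c 0 :=
        Asymptotics.IsBigO.of_bound C hxa
      have h3 : (fun t => c t - c 0) =O[𝓝 (0 : ℝ)] fun t => t := by
        simpa using hc.hasFDerivAt.isBigO_sub
      exact h1.trans_isBigO (h2.trans h3)
    have hlim : Tendsto (fun t : ℝ => t⁻¹ • g' (x t - a)) (𝓝[≠] 0) (𝓝 w) := by
      have h1 : Tendsto (fun t : ℝ => t⁻¹ • (g (x t) - g a - g' (x t - a))) (𝓝[≠] 0) (𝓝 0) := by
        have := (hlo.mono nhdsWithin_le_nhds).tendsto_inv_smul_nhds_zero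
          (l := 𝓝[≠] (0 : ℝ))
        exact this
      have h2 := hslope.sub h1
      rw [sub_zero] at h2
      refine h2.congr' ?_
      filter_upwards [nhdsWithin_le_nhds (himg U hU)] with t ht
      obtain ⟨-, h4⟩ := hx t ht
      rw [h4, hc0, ← smul_sub]
      congr 1
      abel
    refine mem_closure_of_tendsto hlim (Eventually.of_forall fun t => ?_)
    exact Submodule.smul_mem _ _ ⟨x t - a, rfl⟩
  rwa [IsClosed.closure_eq (Submodule.closed_of_finiteDimensional _)] at hcl

variable {n m : ℕ} {E : Type*} [TopologicalSpace E] [ChartedSpace (Rn (n + m)) E]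

/-- `s`, defined near `a ∈ ℝⁿ`, is a smooth local parametrization of the subset `L` of `E` near
`s a`: it is an immersion at `a` and a homeomorphism from neighbourhoods of `a` to neighbourhoods
of `s a` in `L`. -/
structure IsLocalParam (L : Set E) (s : Rn n → E) (a : Rn n) : Prop where
  smooth : ∀ᶠ x in 𝓝 a, ContMDiffAt 𝓘(ℝ, Rn n) 𝓘(ℝ, Rn (n + m)) ∞ s x
  injective : Function.Injective (mfderiv 𝓘(ℝ, Rn n) 𝓘(ℝ, Rn (n + m)) s a)
  map_nhds : map s (𝓝 a) = 𝓝[L] (s a)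

variable (n m) in
/-- `L` is an `n`-dimensional embedded submanifold of the `(n+m)`-dimensional manifold `E`. -/
def IsEmbeddedSubmanifold (L : Set E) : Prop :=
  ∀ q ∈ L, ∃ (s : Rn n → E) (a : Rn n), s a = q ∧ IsLocalParam (n := n) (m := m) L s a

theorem contDiffAt_extChartAt_comp {k : ℕ} {s : Rn k → E} {a : Rn k}
    (h : ContMDiffAt 𝓘(ℝ, Rn k) 𝓘(ℝ, Rn (n + m)) ∞ s a) :
    ContDiffAt ℝ ∞ (extChartAt 𝓘(ℝ, Rn (n + m)) (s a) ∘ s) a :=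
  contMDiffAt_iff_contDiffAt.1 (contMDiffAt_iff_target.1 h).2

theorem mfderiv_eq_fderiv_extChartAt {V : Type*} [NormedAddCommGroup V] [NormedSpace ℝ V]
    {s : V → E} {a : V}
    (h : MDifferentiableAt 𝓘(ℝ, V) 𝓘(ℝ, Rn (n + m)) s a) :
    mfderiv 𝓘(ℝ, V) 𝓘(ℝ, Rn (n + m)) s a =
      fderiv ℝ (extChartAt 𝓘(ℝ, Rn (n + m)) (s a) ∘ s) a := by
  rw [h.mfderiv]
  simp [writtenInExtChartAt, chartAt_self_eq, Function.comp_def]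
  rfl

theorem tangentSpaceOf_eq_range {L : Set E} {s : Rn n → E} {a : Rn n}
    (h : IsLocalParam (m := m) L s a) :
    tangentSpaceOf (V := Rn (n + m)) L (s a) =
      LinearMap.range (mfderiv 𝓘(ℝ, Rn n) 𝓘(ℝ, Rn (n + m)) s a).toLinearMap := by
  have hs : ContMDiffAt 𝓘(ℝ, Rn n) 𝓘(ℝ, Rn (n + m)) ∞ s a := h.smooth.self_of_nhds
  have hsd : MDifferentiableAt 𝓘(ℝ, Rn n) 𝓘(ℝ, Rn (n + m)) s a :=
    hs.mdifferentiableAt (by simp)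
  have hmem : ∀ᶠ x in 𝓝 a, s x ∈ L := by
    have : ∀ᶠ y in map s (𝓝 a), y ∈ L := by
      rw [h.map_nhds]
      exact self_mem_nhdsWithin
    exact this
  apply le_antisymm
  · refine Submodule.span_le.2 ?_
    rintro v ⟨γ, hγ0, hγL, hγd, hγv⟩
    have hg := contDiffAt_extChartAt_comp hs
    have hstrict := hg.hasStrictFDerivAt (by simp)
    have hinj : Function.Injective (fderiv ℝ (extChartAt 𝓘(ℝ, Rn (n + m)) (s a) ∘ s) a) := by
      have := h.injective
      rw [mfderiv_eq_fderiv_extChartAt hsd] at this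
      exact this
    have hγd' : HasDerivAt (extChartAt 𝓘(ℝ, Rn (n + m)) (s a) ∘ γ)
        (fderiv ℝ (extChartAt 𝓘(ℝ, Rn (n + m)) (γ 0) ∘ γ) 0 1) 0 := by
      rw [← hγ0]
      have h1 := hγd.2
      have h2 : DifferentiableAt ℝ (extChartAt 𝓘(ℝ, Rn (n + m)) (γ 0) ∘ γ) 0 := by
        simpa [DifferentiableWithinAtProp, writtenInExtChartAt, differentiableWithinAt_univ,
          chartAt_self_eq, Function.comp_def]
          using h1
      exact h2.hasFDerivAt.hasDerivAt
    have hmain := velocity_mem_range hstrict hinj hγd' (by simp [hγ0]) (by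
      intro U hU
      have h1 : s '' U ∈ 𝓝[L] (s a) := by
        rw [← h.map_nhds]
        exact image_mem_map hU
      have h2 : Tendsto γ (𝓝 0) (𝓝[L] (s a)) := by
        rw [← hγ0]
        exact tendsto_nhdsWithin_iff.2 ⟨hγd.continuousAt, hγL⟩
      filter_upwards [h2 h1] with t ht
      obtain ⟨x, hx, hxt⟩ := ht
      exact ⟨x, hx, congrArg (extChartAt 𝓘(ℝ, Rn (n + m)) (s a)) hxt⟩)
    rw [mfderiv_eq_fderiv_extChartAt hγd] at hγv
    obtain ⟨u, hu⟩ := hmain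
    refine ⟨u, ?_⟩
    rw [mfderiv_eq_fderiv_extChartAt hsd]
    exact hu.trans hγv
  · rintro _ ⟨v, rfl⟩
    let w : Rn n := v
    refine Submodule.subset_span ⟨fun t => s (a + t • w), by simp, ?_, ?_, ?_⟩
    · have : Tendsto (fun t : ℝ => a + t • w) (𝓝 0) (𝓝 a) := by
        have h1 : Continuous fun t : ℝ => a + t • w := by fun_prop
        simpa using h1.tendsto 0
      exact this.eventually hmem
    · have h1 : DifferentiableAt ℝ (fun t : ℝ => a + t • w) 0 := by fun_prop
      exact MDifferentiableAt.comp_of_eq (0 : ℝ) hsd h1.mdifferentiableAt (by simp)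
    · have h1 : HasDerivAt (fun t : ℝ => a + t • w) w 0 := by
        simpa using ((hasDerivAt_id (0 : ℝ)).smul_const w).const_add a
      have h2 := mfderiv_comp_of_eq (x := (0 : ℝ)) (I := 𝓘(ℝ, ℝ)) (f := fun t : ℝ => a + t • w)
        hsd h1.differentiableAt.mdifferentiableAt (by simp)
      change (mfderiv 𝓘(ℝ, ℝ) 𝓘(ℝ, Rn (n + m)) (s ∘ fun t : ℝ => a + t • w) 0 (1 : ℝ)
        : Rn (n + m)) = _
      rw [h2]
      have h3 : (mfderiv 𝓘(ℝ, ℝ) 𝓘(ℝ, Rn n) (fun t : ℝ => a + t • w) 0 (1 : ℝ) : Rn n)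
          = w := by
        rw [mfderiv_eq_fderiv]
        exact h1.deriv
      have h4 : ∀ b : Rn n, b = a →
          (mfderiv 𝓘(ℝ, Rn n) 𝓘(ℝ, Rn (n + m)) s b w : Rn (n + m)) =
            mfderiv 𝓘(ℝ, Rn n) 𝓘(ℝ, Rn (n + m)) s a w := by
        rintro _ rfl
        rfl
      refine Eq.trans ?_ (h4 (a + (0 : ℝ) • w) (by simp))
      exact congrArg (fun z : Rn n =>
        (mfderiv 𝓘(ℝ, Rn n) 𝓘(ℝ, Rn (n + m)) s (a + (0 : ℝ) • w) z : Rn (n + m))) h3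

theorem finrank_tangentSpaceOf {L : Set E} (hL : IsEmbeddedSubmanifold n m L) {q : E}
    (hq : q ∈ L) : Module.finrank ℝ (tangentSpaceOf (V := Rn (n + m)) L q) = n := by
  obtain ⟨s, a, rfl, h⟩ := hL q hq
  rw [tangentSpaceOf_eq_range h]
  exact (LinearMap.finrank_range_of_inj h.injective).trans finrank_euclideanSpace_fin

end Submanifolds

/-! ### Jets of submanifolds and of immersions -/

section Jets

variable {n m : ℕ} {E : Type*} [TopologicalSpace E] [ChartedSpace (Rn (n + m)) E]

/-- An `n`-dimensional embedded submanifold of `E` together with one of its points. -/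
structure PointedSubmanifold (n m : ℕ) (E : Type*) [TopologicalSpace E]
    [ChartedSpace (Rn (n + m)) E] where
  carrier : Set E
  isEmbedded : IsEmbeddedSubmanifold n m carrier
  pt : E
  mem : pt ∈ carrier

/-- `L` and `L'` have a contact of order `r` at their common base point `p`: they have local
parametrizations near `p` with the same Taylor expansion up to order `r`. -/
def HasContact (r : ℕ) (P Q : PointedSubmanifold n m E) : Prop :=
  P.pt = Q.pt ∧ ∃ (s t : Rn n → E) (a : Rn n),
    IsLocalParam (m := m) P.carrier s a ∧ IsLocalParam (m := m) Q.carrier t a ∧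
    s a = P.pt ∧ t a = P.pt ∧
    ∀ k ≤ r, iteratedFDeriv ℝ k (extChartAt 𝓘(ℝ, Rn (n + m)) P.pt ∘ s) a =
      iteratedFDeriv ℝ k (extChartAt 𝓘(ℝ, Rn (n + m)) P.pt ∘ t) a

/-- `J²(E,n)`: the classes `[L]²_p` of `n`-dimensional submanifolds of `E` for the relation of
contact of order two. -/
def J2 (n m : ℕ) (E : Type*) [TopologicalSpace E] [ChartedSpace (Rn (n + m)) E] : Type _ :=
  Quot (HasContact (n := n) (m := m) (E := E) 2)

/-- The first jet `[L]¹_q`, that is the tangent plane `T_q L`. -/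
def jet1 {L : Set E} (hL : IsEmbeddedSubmanifold n m L) {q : E} (hq : q ∈ L) : J1 n m E where
  pt := q
  plane := tangentSpaceOf (V := Rn (n + m)) L q
  finrank_eq := finrank_tangentSpaceOf hL hq

/-- `L⁽¹⁾`, the image of `j₁L : L → J¹(E,n)`. -/
def PointedSubmanifold.prolong (P : PointedSubmanifold n m E) : Set (J1 n m E) :=
  {θ | ∃ (q : E) (hq : q ∈ P.carrier), θ = jet1 P.isEmbedded hq}

theorem mem_tangentSpaceOf_iff {L : Set E} {s : Rn n → E} {a : Rn n} {q : E}
    (h : IsLocalParam (m := m) L s a) (hq : s a = q) (v : Tan (n + m) q) :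
    v ∈ tangentSpaceOf (V := Rn (n + m)) L q ↔
      ∃ u : Rn n, fderiv ℝ (extChartAt 𝓘(ℝ, Rn (n + m)) q ∘ s) a u = (v : Rn (n + m)) := by
  subst hq
  have hsd : MDifferentiableAt 𝓘(ℝ, Rn n) 𝓘(ℝ, Rn (n + m)) s a :=
    h.smooth.self_of_nhds.mdifferentiableAt (by simp)
  rw [tangentSpaceOf_eq_range h, mfderiv_eq_fderiv_extChartAt hsd]
  rfl

theorem jet1_eq_of_hasContact {P Q : PointedSubmanifold n m E} (h : HasContact 2 P Q) :
    jet1 P.isEmbedded P.mem = jet1 Q.isEmbedded Q.mem := by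
  obtain ⟨L, hL, p, hp⟩ := P
  obtain ⟨L', hL', p', hp'⟩ := Q
  obtain ⟨rfl, s, t, a, hs, ht, hsa, hta, hst⟩ := h
  have h1 := hst 1 (by norm_num)
  have h2 : fderiv ℝ (extChartAt 𝓘(ℝ, Rn (n + m)) p ∘ s) a =
      fderiv ℝ (extChartAt 𝓘(ℝ, Rn (n + m)) p ∘ t) a := by
    ext1 u
    have := congrArg (fun f => f fun _ => u) h1
    simpa [iteratedFDeriv_one_apply] using this
  unfold jet1
  congr 1
  ext v
  rw [mem_tangentSpaceOf_iff hs hsa, mem_tangentSpaceOf_iff ht hta, h2]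

/-- The projection `π₂₁ : J²(E,n) → J¹(E,n)`. -/
def J2.proj : J2 n m E → J1 n m E :=
  Quot.lift (fun P => jet1 P.isEmbedded P.mem) fun _ _ h => jet1_eq_of_hasContact h

/-- The `R`-plane `R_θ = T_{[L]¹_p} L⁽¹⁾` of the point `θ = [L]²_p` of `J²(E,n)`, as a subspace of
the tangent space of `J¹(E,n)` at `θ₁ = [L]¹_p = π₂₁ θ`. It does not depend on the submanifold `L`
that represents `θ`. -/
def J2.rPlane [IsManifold 𝓘(ℝ, Rn (n + m)) ∞ E] (θ : J2 n m E) (θ₁ : J1 n m E) :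
    Submodule ℝ (TangentSpace 𝓘(ℝ, J1Model n m) θ₁) :=
  tangentSpaceOf (V := J1Model n m) (Quot.out θ : PointedSubmanifold n m E).prolong θ₁

variable {M : Type*} [TopologicalSpace M] [ChartedSpace (Rn n) M]

/-- The germ at `pt ∈ M` of an immersion of a neighbourhood of `pt` into `E`, i.e. of a
parametrized `n`-dimensional submanifold. -/
structure ImmersionGerm (n m : ℕ) (M E : Type*) [TopologicalSpace M] [ChartedSpace (Rn n) M]
    [TopologicalSpace E] [ChartedSpace (Rn (n + m)) E] where
  toFun : M → E
  pt : M
  immersion : ∀ᶠ y in 𝓝 pt, ContMDiffAt 𝓘(ℝ, Rn n) 𝓘(ℝ, Rn (n + m)) ∞ toFun y ∧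
    Function.Injective (mfderiv 𝓘(ℝ, Rn n) 𝓘(ℝ, Rn (n + m)) toFun y)

/-- Two germs of immersions have the same jet of order `r`: same source and target, and same Taylor
expansion in charts up to order `r`. -/
def jetSetoid (n m : ℕ) (M E : Type*) [TopologicalSpace M] [ChartedSpace (Rn n) M]
    [TopologicalSpace E] [ChartedSpace (Rn (n + m)) E] (r : ℕ) : Setoid (ImmersionGerm n m M E) where
  r f g := f.pt = g.pt ∧ f.toFun f.pt = g.toFun g.pt ∧
    ∀ k ≤ r,
      iteratedFDeriv ℝ k (writtenInExtChartAt 𝓘(ℝ, Rn n) 𝓘(ℝ, Rn (n + m)) f.pt f.toFun)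
          (extChartAt 𝓘(ℝ, Rn n) f.pt f.pt) =
        iteratedFDeriv ℝ k (writtenInExtChartAt 𝓘(ℝ, Rn n) 𝓘(ℝ, Rn (n + m)) g.pt g.toFun)
          (extChartAt 𝓘(ℝ, Rn n) g.pt g.pt)
  iseqv := ⟨fun _ => ⟨rfl, rfl, fun _ _ => rfl⟩,
    fun h => ⟨h.1.symm, h.2.1.symm, fun k hk => (h.2.2 k hk).symm⟩,
    fun h h' => ⟨h.1.trans h'.1, h.2.1.trans h'.2.1,
      fun k hk => (h.2.2 k hk).trans (h'.2.2 k hk)⟩⟩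

/-- `Imm J² pr_M`: the second-order jets `[s]²_x` of immersions of `M` into `E`. -/
def ImmJ2 (n m : ℕ) (M E : Type*) [TopologicalSpace M] [ChartedSpace (Rn n) M]
    [TopologicalSpace E] [ChartedSpace (Rn (n + m)) E] : Type _ :=
  Quotient (jetSetoid n m M E 2)

/-- The first jet `[s]¹_x = (x, s x, T_x s)`. -/
def ImmersionGerm.jet1 (f : ImmersionGerm n m M E) : ImmJ1 n m M E where
  pt := f.pt
  val := f.toFun f.pt
  lin := mfderiv 𝓘(ℝ, Rn n) 𝓘(ℝ, Rn (n + m)) f.toFun f.pt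
  inj := f.immersion.self_of_nhds.2

/-- The image of `j₁s : U → Imm J¹ pr_M`. -/
def ImmersionGerm.prolong (f : ImmersionGerm n m M E) : Set (ImmJ1 n m M E) :=
  {θ | ∃ (y : M) (hy : Function.Injective (mfderiv 𝓘(ℝ, Rn n) 𝓘(ℝ, Rn (n + m)) f.toFun y)),
    θ = ⟨y, f.toFun y, mfderiv 𝓘(ℝ, Rn n) 𝓘(ℝ, Rn (n + m)) f.toFun y, hy⟩}

theorem ImmersionGerm.jet1_eq {f g : ImmersionGerm n m M E} (h : jetSetoid n m M E 2 f g) :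
    f.jet1 = g.jet1 := by
  obtain ⟨f, x, hf⟩ := f
  obtain ⟨g, y, hg⟩ := g
  obtain ⟨h1, h2, h3⟩ := h
  dsimp only at h1 h2 h3
  subst h1
  have hfd := hf.self_of_nhds.1.mdifferentiableAt (by simp)
  have hgd := hg.self_of_nhds.1.mdifferentiableAt (by simp)
  have h4 : (mfderiv 𝓘(ℝ, Rn n) 𝓘(ℝ, Rn (n + m)) f x : Rn n →L[ℝ] Rn (n + m)) =
      mfderiv 𝓘(ℝ, Rn n) 𝓘(ℝ, Rn (n + m)) g x := by
    rw [hfd.mfderiv, hgd.mfderiv]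
    ext1 u
    have := congrArg (fun f => f fun _ => u) (h3 1 (by norm_num))
    have h5 :
        fderiv ℝ (writtenInExtChartAt 𝓘(ℝ, Rn n) 𝓘(ℝ, Rn (n + m)) x f)
            (extChartAt 𝓘(ℝ, Rn n) x x) u =
          fderiv ℝ (writtenInExtChartAt 𝓘(ℝ, Rn n) 𝓘(ℝ, Rn (n + m)) x g)
            (extChartAt 𝓘(ℝ, Rn n) x x) u := by
      simpa only [iteratedFDeriv_one_apply] using this
    simp only [modelWithCornersSelf_coe, range_id, fderivWithin_univ]
    exact h5
  have key : ∀ (p q : E) (hpq : p = q) (l : Tan n x →L[ℝ] Tan (n + m) p)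
      (l' : Tan n x →L[ℝ] Tan (n + m) q) (hl : Function.Injective l)
      (hl' : Function.Injective l'),
      ((l : Rn n →L[ℝ] Rn (n + m)) = l') →
        (⟨x, p, l, hl⟩ : ImmJ1 n m M E) = ⟨x, q, l', hl'⟩ := by
    rintro p _ rfl l l' hl hl' hll
    have : l = l' := hll
    subst this
    rfl
  exact key _ _ h2 _ _ _ _ h4

/-- The projection `pr_{M 2,1} : Imm J² pr_M → Imm J¹ pr_M`. -/
def ImmJ2.proj : ImmJ2 n m M E → ImmJ1 n m M E :=
  Quotient.lift (fun f => f.jet1) fun _ _ h => ImmersionGerm.jet1_eq h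

/-- The `R`-plane of the point `θ = [s]²_x` of `Imm J² pr_M`, i.e. the tangent space of the image of
`j₁s`, as a subspace of the tangent space of `Imm J¹ pr_M` at `θ₁ = [s]¹_x`. It does not depend on
the immersion `s` that represents `θ`. -/
def ImmJ2.rPlane [IsManifold 𝓘(ℝ, Rn n) ∞ M] [IsManifold 𝓘(ℝ, Rn (n + m)) ∞ E]
    (θ : ImmJ2 n m M E) (θ₁ : ImmJ1 n m M E) :
    Submodule ℝ (TangentSpace 𝓘(ℝ, ImmJ1Model n m) θ₁) :=
  tangentSpaceOf (V := ImmJ1Model n m) (Quot.out θ : ImmersionGerm n m M E).prolong θ₁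

/-! ### Prolongations of the projection `pr_E : M × E → E` -/

/-- `pr_E⁽¹⁾ : Imm J¹ pr_M → J¹(E,n)`, `[s]¹_x ↦ [im s]¹_{s x} = im T_x s`. -/
def prE1 (θ : ImmJ1 n m M E) : J1 n m E where
  pt := θ.val
  plane := LinearMap.range θ.lin.toLinearMap
  finrank_eq := (LinearMap.finrank_range_of_inj θ.inj).trans finrank_euclideanSpace_fin

theorem map_eq_nhdsWithin_image {k : ℕ} {F : Type*} [TopologicalSpace F] {s : M → F}
    {x y : M} {U : Set M} (hU : U ∈ 𝓝 y)
    (hUx : U ⊆ (chartAt (Rn n) x).source)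
    (hs : ContinuousAt s y) {ψ : F → Rn k} (hψ : ContinuousAt ψ (s y)) {C : ℝ}
    (hC : ∀ w ∈ U, ‖chartAt (Rn n) x w - chartAt (Rn n) x y‖ ≤ C * ‖ψ (s w) - ψ (s y)‖) :
    map s (𝓝 y) = 𝓝[s '' U] (s y) := by
  apply le_antisymm
  · exact tendsto_nhdsWithin_iff.2 ⟨hs, by filter_upwards [hU] with w hw using ⟨w, hw, rfl⟩⟩
  · intro W hW
    have hyU : y ∈ U := mem_of_mem_nhds hU
    have h1 : Tendsto (fun e => C * ‖ψ e - ψ (s y)‖) (𝓝 (s y)) (𝓝 0) := by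
      have : Tendsto (fun e => ψ e - ψ (s y)) (𝓝 (s y)) (𝓝 0) :=
        tendsto_sub_nhds_zero_iff.2 hψ
      simpa using this.norm.const_mul C
    have h2 : (chartAt (Rn n) x).symm ⁻¹' (s ⁻¹' W) ∈ 𝓝 (chartAt (Rn n) x y) := by
      have hc := (chartAt (Rn n) x).continuousAt_symm
        ((chartAt (Rn n) x).map_source (hUx hyU))
      apply hc
      rw [(chartAt (Rn n) x).left_inv (hUx hyU)]
      exact hW
    obtain ⟨ε, hε, hball⟩ := Metric.mem_nhds_iff.1 h2
    have h3 : ∀ᶠ e in 𝓝 (s y), C * ‖ψ e - ψ (s y)‖ < ε := h1.eventually (gt_mem_nhds hε)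
    filter_upwards [mem_nhdsWithin_of_mem_nhds h3, self_mem_nhdsWithin] with e he heU
    obtain ⟨w, hw, rfl⟩ := heU
    have h4 : chartAt (Rn n) x w ∈ Metric.ball (chartAt (Rn n) x y) ε := by
      rw [Metric.mem_ball, dist_eq_norm]
      exact (hC w hw).trans_lt he
    have h5 := hball h4
    simp only [mem_preimage, (chartAt (Rn n) x).left_inv (hUx hw)] at h5
    exact h5

theorem ImmersionGerm.exists_image [IsManifold 𝓘(ℝ, Rn n) ∞ M] [IsManifold 𝓘(ℝ, Rn (n + m)) ∞ E]
    (f : ImmersionGerm n m M E) :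
    ∃ U ∈ 𝓝 f.pt, IsEmbeddedSubmanifold n m (f.toFun '' U) := by
  obtain ⟨s, x, hs⟩ := f
  change ∃ U ∈ 𝓝 x, IsEmbeddedSubmanifold n m (s '' U)
  have hx := hs.self_of_nhds
  set φ := chartAt (Rn n) x with hφ
  set ψ := chartAt (Rn (n + m)) (s x) with hψ
  have hsymm : ∀ b ∈ φ.target, ContMDiffAt 𝓘(ℝ, Rn n) 𝓘(ℝ, Rn n) ∞ φ.symm b := fun b hb =>
    (contMDiffOn_chart_symm (I := 𝓘(ℝ, Rn n)) (x := x) b hb).contMDiffAt (φ.open_target.mem_nhds hb)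
  have hφx : x ∈ φ.source := mem_chart_source _ x
  -- the immersion in the chart of `M`
  have hcomp : ∀ y ∈ φ.source, (ContMDiffAt 𝓘(ℝ, Rn n) 𝓘(ℝ, Rn (n + m)) ∞ s y ∧
      Function.Injective (mfderiv 𝓘(ℝ, Rn n) 𝓘(ℝ, Rn (n + m)) s y)) →
      ContMDiffAt 𝓘(ℝ, Rn n) 𝓘(ℝ, Rn (n + m)) ∞ (s ∘ φ.symm) (φ y) ∧
      Function.Injective (mfderiv 𝓘(ℝ, Rn n) 𝓘(ℝ, Rn (n + m)) (s ∘ φ.symm) (φ y)) := by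
    intro y hy hsy
    have h1 := hsymm (φ y) (φ.map_source hy)
    have h2 : φ.symm (φ y) = y := φ.left_inv hy
    refine ⟨ContMDiffAt.comp_of_eq hsy.1 h1 h2, ?_⟩
    have h3 := h1.mdifferentiableAt (by simp)
    rw [← h2] at hsy
    rw [mfderiv_comp (φ y) (hsy.1.mdifferentiableAt (by simp)) h3]
    refine hsy.2.comp ?_
    have hid : mfderiv 𝓘(ℝ, Rn n) 𝓘(ℝ, Rn n) (φ ∘ φ.symm) (φ y) =
        ContinuousLinearMap.id ℝ (TangentSpace 𝓘(ℝ, Rn n) (φ y)) := by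
      have : φ ∘ φ.symm =ᶠ[𝓝 (φ y)] id := by
        filter_upwards [φ.open_target.mem_nhds (φ.map_source hy)] with b hb using φ.right_inv hb
      rw [this.mfderiv_eq]
      exact mfderiv_id
    have h4 : MDifferentiableAt 𝓘(ℝ, Rn n) 𝓘(ℝ, Rn n) φ (φ.symm (φ y)) := by
      rw [h2]
      exact mdifferentiableAt_atlas (chart_mem_atlas _ x) hy
    rw [mfderiv_comp (φ y) h4 h3] at hid
    intro u v huv
    have h5 := congrArg (mfderiv 𝓘(ℝ, Rn n) 𝓘(ℝ, Rn n) φ (φ.symm (φ y))) huv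
    have h6 : ∀ w, mfderiv 𝓘(ℝ, Rn n) 𝓘(ℝ, Rn n) φ (φ.symm (φ y))
        (mfderiv 𝓘(ℝ, Rn n) 𝓘(ℝ, Rn n) φ.symm (φ y) w) = w := fun w =>
      DFunLike.congr_fun hid w
    exact (h6 u).symm.trans (h5.trans (h6 v))
  have hc0 := hcomp x hφx hx
  have h0 : φ.symm (φ x) = x := φ.left_inv hφx
  have hg := contDiffAt_extChartAt_comp hc0.1
  have hinj := hc0.2
  rw [mfderiv_eq_fderiv_extChartAt (hc0.1.mdifferentiableAt (by simp))] at hinj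
  have heq : (s ∘ φ.symm) (φ x) = s x := congrArg s h0
  rw [heq] at hg hinj
  obtain ⟨C, -, V, hV, hC⟩ := exists_antilipschitz_nhds (hg.hasStrictFDerivAt (by simp)) hinj
  have hev : ∀ᶠ y in 𝓝 x, (ContMDiffAt 𝓘(ℝ, Rn n) 𝓘(ℝ, Rn (n + m)) ∞ s y ∧
      Function.Injective (mfderiv 𝓘(ℝ, Rn n) 𝓘(ℝ, Rn (n + m)) s y)) ∧ y ∈ φ.source ∧ φ y ∈ V ∧
      s y ∈ ψ.source := by
    filter_upwards [hs, φ.open_source.mem_nhds hφx, (φ.continuousAt hφx) hV,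
      hx.1.continuousAt (ψ.open_source.mem_nhds (mem_chart_source _ (s x)))] with y h1 h2 h3 h4
    exact ⟨h1, h2, h3, h4⟩
  obtain ⟨U, hU, hUo, hxU⟩ := eventually_nhds_iff.1 hev
  refine ⟨U, hUo.mem_nhds hxU, ?_⟩
  rintro _ ⟨y, hy, rfl⟩
  obtain ⟨hy1, hy2, hy3, hy4⟩ := hU y hy
  have hyy : φ.symm (φ y) = y := φ.left_inv hy2
  refine ⟨s ∘ φ.symm, φ y, congrArg s hyy, ?_, (hcomp y hy2 hy1).2, ?_⟩
  · have hUt : φ.symm ⁻¹' U ∩ φ.target ∈ 𝓝 (φ y) := by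
      refine inter_mem ?_ (φ.open_target.mem_nhds (φ.map_source hy2))
      apply φ.continuousAt_symm (φ.map_source hy2)
      rw [hyy]
      exact hUo.mem_nhds hy
    filter_upwards [hUt] with b hb
    have h1 := (hcomp (φ.symm b) (φ.map_target hb.2) (hU _ hb.1).1).1
    rwa [φ.right_inv hb.2] at h1
  · have h1 : map φ.symm (𝓝 (φ y)) = 𝓝 y := by
      have := φ.symm.map_nhds_eq (x := φ y) (φ.map_source hy2)
      rwa [hyy] at this
    have h2 : (s ∘ φ.symm) (φ y) = s y := congrArg s hyy
    rw [h2, ← Filter.map_map, h1]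
    refine map_eq_nhdsWithin_image (x := x) (ψ := ψ) (C := C) (hUo.mem_nhds hy)
      (fun w hw => (hU w hw).2.1) hy1.1.continuousAt (ψ.continuousAt hy4) fun w hw => ?_
    have h3 := hC (φ w) (hU w hw).2.2.1 (φ y) hy3
    have h4 : φ.symm (φ w) = w := φ.left_inv (hU w hw).2.1
    simpa [Function.comp_def, h4, hyy] using h3

/-- The submanifold parametrized by (a restriction of) an immersion, pointed at the image of the
base point. -/
def ImmersionGerm.image [IsManifold 𝓘(ℝ, Rn n) ∞ M] [IsManifold 𝓘(ℝ, Rn (n + m)) ∞ E]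
    (f : ImmersionGerm n m M E) : PointedSubmanifold n m E where
  carrier := f.toFun '' f.exists_image.choose
  isEmbedded := f.exists_image.choose_spec.2
  pt := f.toFun f.pt
  mem := ⟨f.pt, mem_of_mem_nhds f.exists_image.choose_spec.1, rfl⟩

/-- `pr_E⁽²⁾ : Imm J² pr_M → J²(E,n)`, `[s]²_x ↦ [im s]²_{s x}`. The value does not depend on the
immersion that represents the jet. -/
def prE2 [IsManifold 𝓘(ℝ, Rn n) ∞ M] [IsManifold 𝓘(ℝ, Rn (n + m)) ∞ E]
    (θ : ImmJ2 n m M E) : J2 n m E :=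
  Quot.mk _ (Quot.out θ : ImmersionGerm n m M E).image

end Jets

/-! ### Linear connections and totally geodesic submanifolds -/

section Connections

open CovariantDerivative

/-- A linear connection on the tangent bundle `TP → P`. -/
abbrev Connection (k : ℕ) (P : Type*) [TopologicalSpace P] [ChartedSpace (Rn k) P]
    [IsManifold 𝓘(ℝ, Rn k) ∞ P] : Type _ :=
  CovariantDerivative 𝓘(ℝ, Rn k) (Rn k) (TangentSpace 𝓘(ℝ, Rn k) : P → Type _)

section

variable {k : ℕ} {P : Type*} [TopologicalSpace P] [ChartedSpace (Rn k) P]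
  [IsManifold 𝓘(ℝ, Rn k) ∞ P]

/-- The vector field `Y` is differentiable at `p`. -/
def FieldDiffAt (Y : ∀ q : P, Tan k q) (p : P) : Prop :=
  MDifferentiableAt 𝓘(ℝ, Rn k) 𝓘(ℝ, Rn k).tangent
    (fun q => (⟨q, Y q⟩ : TangentBundle 𝓘(ℝ, Rn k) P)) p

/-- The Christoffel symbols `Γ(v, w) = v^A w^B Γ_A^C_B ∂_C` at `p` in the preferred chart at `p`:
the covariant derivative in the direction `v` of the field whose components in this chart are
constant and which equals `w` at `p`. -/
def christoffel (Γ : Connection k P) (p : P) (v w : Tan k p) : Tan k p :=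
  Γ (fun q => (tangentCoord (achart (Rn k) p) q).symm (tangentCoord (achart (Rn k) p) p w)) p v

end

variable {n m : ℕ} {M E : Type*} [TopologicalSpace M] [ChartedSpace (Rn n) M]
  [TopologicalSpace E] [ChartedSpace (Rn (n + m)) E]
  [IsManifold 𝓘(ℝ, Rn n) ∞ M] [IsManifold 𝓘(ℝ, Rn (n + m)) ∞ E]

/-- The second fundamental form `II(X, Y) = ∇_X Y mod T_p L` of the submanifold `L` vanishes at the
base point `p`. Here `Y` is any vector field on `E` which is tangent to `L` at the points of `L`. -/
def SecondFundamentalFormVanishes (Γ : Connection (n + m) E) (P : PointedSubmanifold n m E) :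
    Prop :=
  ∀ Y : ∀ q : E, Tan (n + m) q, FieldDiffAt Y P.pt →
    (∀ᶠ q in 𝓝[P.carrier] P.pt, Y q ∈ tangentSpaceOf (V := Rn (n + m)) P.carrier q) →
    ∀ X ∈ tangentSpaceOf (V := Rn (n + m)) P.carrier P.pt,
      (tangentSpaceOf (V := Rn (n + m)) P.carrier P.pt).mkQ (Γ Y P.pt X) = 0

/-- The equation `𝒮 ⊆ J²(E,n)` of unparametrized totally geodesic submanifolds. -/
def unparamEquation (Γ : Connection (n + m) E) : Set (J2 n m E) :=
  {θ | ∃ P : PointedSubmanifold n m E, Quot.mk _ P = θ ∧ SecondFundamentalFormVanishes Γ P}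

/-- The form `II_{pr_M}(X, Y) = ∇^Γ_{Ts(X)} (Ts(Y)) - Ts(∇^Θ_X Y)` of the immersion `s` vanishes at
the base point. The field `Ts(Y)` along `s` is represented by a vector field `Y'` on `E` which is
`s`-related to `Y`. -/
def ParamSecondFundamentalFormVanishes (Γ : Connection (n + m) E) (Θ : Connection n M)
    (f : ImmersionGerm n m M E) : Prop :=
  ∀ (Y : ∀ x : M, Tan n x) (Y' : ∀ q : E, Tan (n + m) q),
    FieldDiffAt Y f.pt → FieldDiffAt Y' (f.toFun f.pt) →
    (∀ᶠ x in 𝓝 f.pt,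
      Y' (f.toFun x) = mfderiv 𝓘(ℝ, Rn n) 𝓘(ℝ, Rn (n + m)) f.toFun x (Y x)) →
    ∀ X : Tan n f.pt,
      Γ Y' (f.toFun f.pt) (mfderiv 𝓘(ℝ, Rn n) 𝓘(ℝ, Rn (n + m)) f.toFun f.pt X) -
        mfderiv 𝓘(ℝ, Rn n) 𝓘(ℝ, Rn (n + m)) f.toFun f.pt (Θ Y f.pt X) = 0

/-- The equation `𝒮_{pr_M} ⊆ Imm J² pr_M` of parametrized totally geodesic submanifolds. -/
def paramEquation (Γ : Connection (n + m) E) (Θ : Connection n M) : Set (ImmJ2 n m M E) :=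
  {θ | ∃ f : ImmersionGerm n m M E, Quotient.mk _ f = θ ∧
    ParamSecondFundamentalFormVanishes Γ Θ f}

/-! ### The connections `Γ̇`, `Γ̇_{pr_M}` and the structures `Γ̈`, `Γ̈_{pr_M}` -/

/-- The vertical projection `(du^k_ξ + Γ̇_A^k_ξ du^A) ⊗ du^ξ ⊗ ∂_{u^k}` of the connection `Γ̇` on
`π₁₀ : J¹(E,n) → E`, at `θ`, where
`Γ̇_A^k_ξ = Γ_A^k_ξ + Γ_A^k_i u^i_ξ - u^k_β (Γ_A^β_ξ + Γ_A^β_i u^i_ξ)`.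
It is computed in the preferred divided chart at `θ`, which is also the chart that identifies the
tangent space at `θ` with `J1Model n m`. -/
def verticalJ1 (Γ : Connection (n + m) E) (θ : J1 n m E)
    (ζ : TangentSpace 𝓘(ℝ, J1Model n m) θ) (x : Rn n) : Rn m :=
  let v : Tan (n + m) θ.pt := mfderiv 𝓘(ℝ, J1Model n m) 𝓘(ℝ, Rn (n + m)) J1.pt θ ζ
  let D := dividedCoord θ.dividedChartAt θ.pt
  let u := J1.slope θ.dividedChartAt θ
  let g : Rn n × Rn m := D (christoffel Γ θ.pt v (D.symm (x, u x)))
  (show J1Model n m from ζ).2 x + (g.2 - u g.1)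

/-- The vertical projection of the connection `Γ̇_{pr_M} = pr_E^*Γ ⊗ pr_M^*Θ^*` on
`J¹ pr_M → M × E`, at `θ = (x, p, l)`, in the preferred charts at `x` and `p`:
`du^C_{x^η} + Γ_B^C_A u^A_{x^η} du^B - Θ_λ^ξ_η u^C_{x^ξ} dx^λ`. -/
def verticalImmJ1 (Γ : Connection (n + m) E) (Θ : Connection n M) (θ : ImmJ1 n m M E)
    (ζ : TangentSpace 𝓘(ℝ, ImmJ1Model n m) θ) (y : Tan n θ.pt) : Rn (n + m) :=
  let ξ : Tan n θ.pt := mfderiv 𝓘(ℝ, ImmJ1Model n m) 𝓘(ℝ, Rn n) ImmJ1.pt θ ζ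
  let v : Tan (n + m) θ.val := mfderiv 𝓘(ℝ, ImmJ1Model n m) 𝓘(ℝ, Rn (n + m)) ImmJ1.val θ ζ
  (show ImmJ1Model n m from ζ).2 (tangentCoord (achart (Rn n) θ.pt) θ.pt y) +
    tangentCoord (achart (Rn (n + m)) θ.val) θ.val
      (christoffel Γ θ.val v (θ.lin y) - θ.lin (christoffel Θ θ.pt ξ y))

/-- `G` is the `n`-Grassmannian structure `Γ̈`: the section of `π₂₁` whose `R`-planes are the
horizontal lifts of the planes `θ` by the connection `Γ̇`, i.e. `D² ∘ Γ̈ = D¹ ⌟ Γ̇`. -/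
structure IsGrassmannianStructure (Γ : Connection (n + m) E) (G : J1 n m E → J2 n m E) : Prop where
  proj_eq : ∀ θ, (G θ).proj = θ
  mem_rPlane_iff : ∀ (θ : J1 n m E) (ζ : TangentSpace 𝓘(ℝ, J1Model n m) θ),
    ζ ∈ (G θ).rPlane θ ↔
      mfderiv 𝓘(ℝ, J1Model n m) 𝓘(ℝ, Rn (n + m)) J1.pt θ ζ ∈ θ.plane ∧
        ∀ x, verticalJ1 Γ θ ζ x = 0

/-- `G` is the section `Γ̈_{pr_M}` of `pr_{M 2,1}` whose `R`-planes are the horizontal lifts by the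
connection `Γ̇_{pr_M}` of the planes `{(ξ, l ξ)}` of `T(M × E)`, for `θ = (x, p, l)`. -/
structure IsParamStructure (Γ : Connection (n + m) E) (Θ : Connection n M)
    (G : ImmJ1 n m M E → ImmJ2 n m M E) : Prop where
  proj_eq : ∀ θ, (G θ).proj = θ
  mem_rPlane_iff : ∀ (θ : ImmJ1 n m M E) (ζ : TangentSpace 𝓘(ℝ, ImmJ1Model n m) θ),
    ζ ∈ (G θ).rPlane θ ↔
      mfderiv 𝓘(ℝ, ImmJ1Model n m) 𝓘(ℝ, Rn (n + m)) ImmJ1.val θ ζ =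
          θ.lin (mfderiv 𝓘(ℝ, ImmJ1Model n m) 𝓘(ℝ, Rn n) ImmJ1.pt θ ζ) ∧
        ∀ y, verticalImmJ1 Γ Θ θ ζ y = 0

end Connections

/-! ### Coverings -/

section Coverings

variable {V : Type*} [NormedAddCommGroup V] [NormedSpace ℝ V] {N : Type*} [TopologicalSpace N]
  [ChartedSpace V N] [IsManifold 𝓘(ℝ, V) ∞ N]
  {V' : Type*} [NormedAddCommGroup V'] [NormedSpace ℝ V'] {N' : Type*} [TopologicalSpace N']
  [ChartedSpace V' N'] [IsManifold 𝓘(ℝ, V') ∞ N']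

/-- `D` is a smooth `d`-dimensional distribution on `N`: near every point it is spanned by `d`
linearly independent smooth vector fields. -/
def IsSmoothDistribution (d : ℕ) (D : ∀ x : N, Submodule ℝ (TangentSpace 𝓘(ℝ, V) x)) : Prop :=
  ∀ x₀ : N, ∃ Z : Fin d → ∀ x : N, TangentSpace 𝓘(ℝ, V) x, ∀ᶠ x in 𝓝 x₀,
    (∀ i, ContMDiffAt 𝓘(ℝ, V) 𝓘(ℝ, V).tangent ∞
      (fun y => (⟨y, Z i y⟩ : TangentBundle 𝓘(ℝ, V) N)) x) ∧
    LinearIndependent ℝ (fun i => Z i x) ∧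
    Submodule.span ℝ (range fun i => Z i x) = D x

/-- `τ : N' → N` is a covering of the manifold `N` with the `d`-dimensional distribution `D` by the
manifold `N'` with the `d`-dimensional distribution `D'`: a smooth surjection whose tangent map
sends each plane of `D'` isomorphically onto the corresponding plane of `D`. -/
structure IsCovering (d : ℕ) (τ : N' → N) (D' : ∀ x : N', Submodule ℝ (TangentSpace 𝓘(ℝ, V') x))
    (D : ∀ x : N, Submodule ℝ (TangentSpace 𝓘(ℝ, V) x)) : Prop where
  smooth_source : IsSmoothDistribution d D'
  smooth_target : IsSmoothDistribution d D
  contMDiff : ContMDiff 𝓘(ℝ, V') 𝓘(ℝ, V) ∞ τ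
  surjective : Function.Surjective τ
  bijOn : ∀ x, Set.BijOn (mfderiv 𝓘(ℝ, V') 𝓘(ℝ, V) τ x) (D' x) (D (τ x))

end Coverings

end TotGeod

end

/-! Write an immersion or a local parametrization in charts as `σ`, with values in `ℝⁿ⁺ᵐ`.
Everything is governed by its covariant Hessian `H(ξ, η) = D²σ(ξ, η) + Γ(Dσ ξ, Dσ η)`
(`covHessian`). By `tangentCoord_connection_along`, the covariant derivative of a field that equals
`Ts(y)` along `s` is `H(ξ, y) + Dσ(Dy ξ)`. Hence the second fundamental form of a submanifold
vanishes iff `H` takes values in the range of `Dσ` (`secondFundamentalFormVanishes_iff`), and that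
of an immersion vanishes iff `H = Dσ ∘ Θ` (`paramSecondFundamentalFormVanishes_iff`).

On the jet side, the tangent space of `j₁s` in charts is `{((ξ, Dσ ξ), D²σ ξ)}`, and that of `L⁽¹⁾`
is obtained by projecting `D²σ` modulo the tangent plane. Comparing with the horizontal lifts gives
the same two equations (`prolong_horizontal_iff_param`, `prolong_horizontal_iff`). So a section has
horizontal `R`-planes iff each of its values is represented by an object that is totally geodesic at
the point and has the given first jet (`isParamStructure_iff`, `isGrassmannianStructure_iff`). What
remains is a problem about second-order Taylor expansions.

Uniqueness: for immersions the equation prescribes `D²σ` outright. For submanifolds it does so only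
modulo the tangent plane; the ambiguity is that of the parametrization, and it is removed by
normalising `L ∘ σ = id` for a linear projection `L`
(`hasContact_of_secondFundamentalFormVanishes`). Existence: take a quadratic polynomial with the
prescribed second derivative, which is symmetric because the connections are torsion-free
(`exists_immersionGerm`). As the equations depend only on second-order jets, the images of the
sections are the two equations.

Compatibility: `H = Dσ ∘ Θ` is tangent, so the image of a totally geodesic germ is totally geodesic,
and `pr_E⁽¹⁾` maps the prolongation of a germ into that of its image. Thus `R`-planes go to
`R`-planes. Projection to `E` maps the `R`-plane of the source bijectively onto the plane `im ℓ`,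
and that of the target injectively into it, so the map between them is bijective
(`bijOn_mfderiv_prE1`). The distributions are smooth because the Christoffel symbols are. -/

noncomputable section

namespace TotGeod

/-! ### Vector fields and connections in charts -/

section ChartCalculus

variable {k : ℕ} {P : Type*} [TopologicalSpace P] [ChartedSpace (Rn k) P]
  [IsManifold 𝓘(ℝ, Rn k) ∞ P]

theorem mdifferentiableAt_chart (i : atlas (Rn k) P) {p : P} (hp : p ∈ i.1.source) :
    MDifferentiableAt 𝓘(ℝ, Rn k) 𝓘(ℝ, Rn k) i.1 p :=
  haveI : IsManifold 𝓘(ℝ, Rn k) 1 P := .of_le (n := ∞) (by simp)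
  mdifferentiableAt_atlas i.2 hp

theorem mfderiv_chart (i : atlas (Rn k) P) {p : P} (hp : p ∈ i.1.source) (v : Tan k p) :
    (mfderiv 𝓘(ℝ, Rn k) 𝓘(ℝ, Rn k) i.1 p v : Rn k) = tangentCoord i p v := by
  rw [tangentCoord_apply hp, (mdifferentiableAt_chart i hp).mfderiv]
  rfl

/-- The expression of a map in a chart of the target has derivative `tangentCoord ∘ mfderiv`. -/
theorem mfderiv_chart_comp {V : Type*} [NormedAddCommGroup V] [NormedSpace ℝ V] {H : Type*}
    [TopologicalSpace H] {I : ModelWithCorners ℝ V H} {X : Type*} [TopologicalSpace X]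
    [ChartedSpace H X] (i : atlas (Rn k) P) {s : X → P} {a : X}
    (hs : MDifferentiableAt I 𝓘(ℝ, Rn k) s a) (hp : s a ∈ i.1.source) (v : TangentSpace I a) :
    (mfderiv I 𝓘(ℝ, Rn k) (i.1 ∘ s) a v : Rn k) =
      tangentCoord i (s a) (mfderiv I 𝓘(ℝ, Rn k) s a v) := by
  rw [mfderiv_comp a (mdifferentiableAt_chart i hp) hs]
  exact mfderiv_chart i hp _

theorem fderiv_chart_comp {V : Type*} [NormedAddCommGroup V] [NormedSpace ℝ V]
    (i : atlas (Rn k) P) {s : V → P} {a : V}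
    (hs : MDifferentiableAt 𝓘(ℝ, V) 𝓘(ℝ, Rn k) s a) (hp : s a ∈ i.1.source) (v : V) :
    fderiv ℝ (i.1 ∘ s) a v = tangentCoord i (s a) (mfderiv 𝓘(ℝ, V) 𝓘(ℝ, Rn k) s a v) := by
  refine Eq.trans ?_ (mfderiv_chart_comp i hs hp v)
  rw [mfderiv_eq_fderiv]
  rfl

/-- The components of the vector field `Y` in the chart `i`. -/
def components (i : atlas (Rn k) P) (Y : ∀ q : P, Tan k q) (q : P) : Rn k :=
  tangentCoord i q (Y q)

/-- The vector field with constant components `w` in the chart `i`. -/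
def constField (i : atlas (Rn k) P) (w : Rn k) (q : P) : Tan k q := (tangentCoord i q).symm w

@[simp]
theorem components_constField (i : atlas (Rn k) P) (w : Rn k) (q : P) :
    components i (constField i w) q = w :=
  (tangentCoord i q).apply_symm_apply w

/-- The trivialization of the tangent bundle given by the chart `i`. -/
abbrev tangentTriv (i : atlas (Rn k) P) :
    Bundle.Trivialization (Rn k) (Bundle.TotalSpace.proj : TangentBundle 𝓘(ℝ, Rn k) P → P) :=
  (tangentBundleCore 𝓘(ℝ, Rn k) P).localTriv i

instance (i : atlas (Rn k) P) : MemTrivializationAtlas (tangentTriv i) :=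
  ⟨⟨i, rfl⟩⟩

theorem localTriv_snd_eq (i : atlas (Rn k) P) {p : P} (hp : p ∈ i.1.source) (v : Tan k p) :
    (tangentTriv i (⟨p, v⟩ : TangentBundle 𝓘(ℝ, Rn k) P)).2 =
      tangentCoord i p v := by
  rw [tangentCoord_apply hp]
  rfl

/-- Over the domain of `i`, `components` is the second coordinate in the trivialization given by
`i`. Elsewhere the two may differ, so they are compared only as germs at `p`. -/
theorem fieldDiffAt_iff (i : atlas (Rn k) P) {Y : ∀ q : P, Tan k q} {p : P}
    (hp : p ∈ i.1.source) :
    FieldDiffAt Y p ↔ MDifferentiableAt 𝓘(ℝ, Rn k) 𝓘(ℝ, Rn k) (components i Y) p := by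
  unfold FieldDiffAt
  have h := Bundle.Trivialization.mdifferentiableAt_section_iff 𝓘(ℝ, Rn k)
    (tangentTriv i) Y (b₀ := p) hp
  refine h.trans (Filter.EventuallyEq.mdifferentiableAt_iff ?_)
  filter_upwards [i.1.open_source.mem_nhds hp] with q hq
  exact localTriv_snd_eq i hq (Y q)

theorem contMDiffAt_field_iff (i : atlas (Rn k) P) {Y : ∀ q : P, Tan k q} {p : P}
    (hp : p ∈ i.1.source) :
    ContMDiffAt 𝓘(ℝ, Rn k) 𝓘(ℝ, Rn k).tangent ∞
      (fun q => (⟨q, Y q⟩ : TangentBundle 𝓘(ℝ, Rn k) P)) p ↔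
      ContMDiffAt 𝓘(ℝ, Rn k) 𝓘(ℝ, Rn k) ∞ (components i Y) p := by
  have h := Bundle.Trivialization.contMDiffAt_section_iff (IB := 𝓘(ℝ, Rn k)) (n := ∞)
    (tangentTriv i) (s := Y) (x₀ := p) hp
  refine h.trans (Filter.EventuallyEq.contMDiffAt_iff ?_)
  filter_upwards [i.1.open_source.mem_nhds hp] with q hq
  exact localTriv_snd_eq i hq (Y q)

theorem fieldDiffAt_constField (i : atlas (Rn k) P) (w : Rn k) {p : P} (hp : p ∈ i.1.source) :
    FieldDiffAt (constField i w) p := by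
  rw [fieldDiffAt_iff i hp]
  have : components i (constField i w) = fun _ => w := funext fun q => by simp
  rw [this]
  exact mdifferentiableAt_const

/-! ### Christoffel symbols in an arbitrary chart -/

/-- The covariant derivative of the `l`-th coordinate field, in coordinates. -/
def christoffelColumn (Γ : Connection k P) (i : atlas (Rn k) P) (p : P) (l : Fin k) :
    Rn k →L[ℝ] Rn k :=
  (tangentCoord i p : Tan k p →L[ℝ] Rn k).comp
    ((Γ (constField i (EuclideanSpace.single l 1)) p).comp
      ((tangentCoord i p).symm : Rn k →L[ℝ] Tan k p))

/-- The Christoffel symbols `(v, w) ↦ v^A w^B Γ_A^C_B` of `Γ` at `p` in the chart `i`. -/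
def christoffelOn (Γ : Connection k P) (i : atlas (Rn k) P) (p : P) :
    Rn k →L[ℝ] Rn k →L[ℝ] Rn k :=
  (∑ l, (EuclideanSpace.proj l : Rn k →L[ℝ] ℝ).smulRight (christoffelColumn Γ i p l)).flip

theorem christoffelOn_apply (Γ : Connection k P) (i : atlas (Rn k) P) (p : P) (v w : Rn k) :
    christoffelOn Γ i p v w = ∑ l, w l • christoffelColumn Γ i p l v := by
  simp [christoffelOn]

/-- Covariant derivatives are additive only on differentiable sections, so the differentiability of
the partial sums has to be carried through the induction. -/
theorem Connection.map_sum (Γ : Connection k P) {ι : Type*} (S : Finset ι)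
    (Y : ι → ∀ q : P, Tan k q) {p : P} (hY : ∀ l ∈ S, FieldDiffAt (Y l) p) :
    FieldDiffAt (∑ l ∈ S, Y l) p ∧ Γ (∑ l ∈ S, Y l) p = ∑ l ∈ S, Γ (Y l) p := by
  classical
  induction S using Finset.induction_on with
  | empty =>
    refine ⟨?_, ?_⟩
    · rw [Finset.sum_empty]
      exact Bundle.mdifferentiableAt_zeroSection ℝ _
    · rw [Finset.sum_empty, Finset.sum_empty, CovariantDerivative.zero]
      rfl
  | insert a S ha ih =>
    obtain ⟨h1, h2⟩ := ih fun l hl => hY l (Finset.mem_insert_of_mem hl)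
    have h3 := hY a (Finset.mem_insert_self a S)
    rw [Finset.sum_insert ha, Finset.sum_insert ha]
    refine ⟨mdifferentiableAt_add_section h3 h1, ?_⟩
    rw [← h2]
    exact Γ.isCovariantDerivativeOnUniv.add h3 h1

/-- The covariant derivative in coordinates: `∇_X Y = X(Y^C) + X^A Γ_A^C_B Y^B`. -/
theorem tangentCoord_connection (Γ : Connection k P) (i : atlas (Rn k) P) {p : P}
    (hp : p ∈ i.1.source) {Y : ∀ q : P, Tan k q} {D : Tan k p →L[ℝ] Rn k}
    (hD : HasMFDerivAt 𝓘(ℝ, Rn k) 𝓘(ℝ, Rn k) (components i Y) p D) (X : Tan k p) :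
    tangentCoord i p (Γ Y p X) =
      D X + christoffelOn Γ i p (tangentCoord i p X) (components i Y p) := by
  let e : Fin k → Rn k := fun l => EuclideanSpace.single l 1
  let g : Fin k → P → ℝ := fun l q => components i Y q l
  have hgd : ∀ l, HasMFDerivAt 𝓘(ℝ, Rn k) 𝓘(ℝ, ℝ) (g l) p
      ((EuclideanSpace.proj l : Rn k →L[ℝ] ℝ).comp D) := fun l =>
    ((EuclideanSpace.proj l : Rn k →L[ℝ] ℝ).hasMFDerivAt (x := components i Y p)).comp p hD
  have hc : ∀ l, FieldDiffAt (constField i (e l)) p := fun l => fieldDiffAt_constField i (e l) hp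
  -- The expansion in the coordinate frame holds at every point, because `tangentCoord i q` is a
  -- linear isomorphism even for `q` outside the chart domain. No localisation is needed before
  -- applying additivity and the Leibniz rule.
  have hsum : Y = ∑ l, (g l • constField i (e l)) := by
    funext q
    rw [Finset.sum_apply]
    apply (tangentCoord i q).injective
    rw [map_sum]
    have : ∀ l, tangentCoord i q ((g l • constField i (e l)) q) = g l q • e l := by
      intro l
      change tangentCoord i q (g l q • (tangentCoord i q).symm (e l)) = _
      rw [map_smul, ContinuousLinearEquiv.apply_symm_apply]
    simp_rw [this]
    ext l
    simp [g, e, components, Finset.sum_apply, Pi.single_apply]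
  have hl : ∀ l, Γ (g l • constField i (e l)) p =
      g l p • Γ (constField i (e l)) p + (mvfderiv 𝓘(ℝ, Rn k) (g l) p).smulRight
        (constField i (e l) p) := fun l =>
    Γ.isCovariantDerivativeOnUniv.leibniz (hc l) (hgd l).mdifferentiableAt
  have hm := (Γ.map_sum Finset.univ (fun l => g l • constField i (e l)) (p := p)
    fun l _ => (hgd l).mdifferentiableAt.smul_section (hc l)).2
  rw [← hsum] at hm
  rw [hm, sum_apply, map_sum, christoffelOn_apply, add_comm]
  have h1 : ∀ l, tangentCoord i p (Γ (g l • constField i (e l)) p X) =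
      components i Y p l • christoffelColumn Γ i p l (tangentCoord i p X) +
        D X l • e l := by
    intro l
    rw [hl l, add_apply, map_add]
    congr 1
    · change tangentCoord i p (g l p • (Γ (constField i (e l)) p X)) = _
      rw [map_smul]
      change _ = _ • tangentCoord i p (Γ (constField i (e l)) p
        ((tangentCoord i p).symm (tangentCoord i p X)))
      rw [ContinuousLinearEquiv.symm_apply_apply]
    · change tangentCoord i p ((mvfderiv 𝓘(ℝ, Rn k) (g l) p X) • (tangentCoord i p).symm (e l)) = _
      rw [map_smul, ContinuousLinearEquiv.apply_symm_apply]
      congr 1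
      change (mfderiv 𝓘(ℝ, Rn k) 𝓘(ℝ, ℝ) (g l) p X : ℝ) = _
      rw [(hgd l).mfderiv]
      rfl
  simp_rw [h1]
  rw [Finset.sum_add_distrib]
  congr 1
  ext l
  simp [e, Finset.sum_apply, Pi.single_apply]

theorem tangentCoord_connection_constField (Γ : Connection k P) (i : atlas (Rn k) P) {p : P}
    (hp : p ∈ i.1.source) (w : Rn k) (X : Tan k p) :
    tangentCoord i p (Γ (constField i w) p X) = christoffelOn Γ i p (tangentCoord i p X) w := by
  have h : HasMFDerivAt 𝓘(ℝ, Rn k) 𝓘(ℝ, Rn k) (components i (constField i w)) p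
      (0 : Tan k p →L[ℝ] Rn k) := by
    have : components i (constField i w) = fun _ => w := funext fun q => by simp
    rw [this]
    exact hasMFDerivAt_const w p
  rw [tangentCoord_connection Γ i hp h, components_constField]
  exact zero_add _

/-- The vertical projections use `christoffel`, which is tied to the preferred chart at `p`. It is
traded here for `christoffelOn`, which makes sense in a fixed chart while the point moves. -/
theorem tangentCoord_christoffel (Γ : Connection k P) (p : P) (v w : Tan k p) :
    tangentCoord (achart (Rn k) p) p (christoffel Γ p v w) =
      christoffelOn Γ (achart (Rn k) p) p (tangentCoord (achart (Rn k) p) p v)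
        (tangentCoord (achart (Rn k) p) p w) :=
  tangentCoord_connection_constField Γ (achart (Rn k) p) (mem_chart_source _ p) _ v

/-- The constant vector field `w` on the model space. -/
def modelField (w : Rn k) (z : Rn k) : TangentSpace 𝓘(ℝ, Rn k) z := w

theorem constField_eq_mpullback (i : atlas (Rn k) P) {q : P} (hq : q ∈ i.1.source) (w : Rn k) :
    constField i w q = VectorField.mpullback 𝓘(ℝ, Rn k) 𝓘(ℝ, Rn k) i.1 (modelField w) q := by
  rw [VectorField.mpullback_apply]
  have h : mfderiv 𝓘(ℝ, Rn k) 𝓘(ℝ, Rn k) i.1 q =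
      ((tangentCoord i q : Tan k q ≃L[ℝ] Rn k) : Tan k q →L[ℝ] Rn k) :=
    ContinuousLinearMap.ext fun v => mfderiv_chart i hq v
  rw [h]
  exact (congrArg (fun f : Rn k →L[ℝ] Tan k q => f w)
    (ContinuousLinearMap.inverse_equiv (tangentCoord i q))).symm

/-- Fields with constant components are pull-backs by the chart of constant fields on `ℝᵏ`. Those
commute, and pull-back is compatible with brackets. -/
theorem mlieBracket_constField (i : atlas (Rn k) P) {p : P} (hp : p ∈ i.1.source) (v w : Rn k) :
    VectorField.mlieBracket 𝓘(ℝ, Rn k) (constField i v) (constField i w) p = 0 := by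
  have hV : ∀ u : Rn k, constField i u =ᶠ[𝓝 p]
      VectorField.mpullback 𝓘(ℝ, Rn k) 𝓘(ℝ, Rn k) i.1 (modelField u) := fun u => by
    filter_upwards [i.1.open_source.mem_nhds hp] with q hq
    exact constField_eq_mpullback i hq u
  have hc : ∀ u : Rn k, MDifferentiableAt 𝓘(ℝ, Rn k) 𝓘(ℝ, Rn k).tangent
      (fun z : Rn k => (⟨z, modelField u z⟩ : TangentBundle 𝓘(ℝ, Rn k) (Rn k))) (i.1 p) :=
    fun u => by
      have h : ContDiffAt ℝ 1 (fun _ : Rn k => u) (i.1 p) := contDiffAt_const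
      exact ((contMDiffAt_vectorSpace_iff_contDiffAt (V := modelField u)).2 h).mdifferentiableAt
        (by simp)
  have h2 : minSmoothness ℝ 2 ≤ (∞ : WithTop ℕ∞) := by
    simpa using (WithTop.coe_le_coe.2 le_top : ((2 : ℕ∞) : WithTop ℕ∞) ≤ ∞)
  have : IsManifold 𝓘(ℝ, Rn k) (minSmoothness ℝ 2) P := .of_le (n := ∞) h2
  have : IsManifold 𝓘(ℝ, Rn k) (minSmoothness ℝ 2) (Rn k) := inferInstance
  rw [(hV v).mlieBracket_vectorField_eq (hV w)]
  have hi : ContMDiffAt 𝓘(ℝ, Rn k) 𝓘(ℝ, Rn k) ∞ i.1 p :=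
    contMDiffAt_of_mem_maximalAtlas (IsManifold.subset_maximalAtlas i.2) hp
  rw [← VectorField.mpullback_mlieBracket (n := ∞) (hc v) (hc w) hi h2,
    VectorField.mpullback_apply]
  have h0 : VectorField.mlieBracket 𝓘(ℝ, Rn k) (modelField v) (modelField w) (i.1 p) = 0 := by
    rw [← VectorField.mlieBracketWithin_univ, VectorField.mlieBracketWithin_eq_lieBracketWithin]
    have : ∀ u : Rn k, fderivWithin ℝ (modelField u) univ (i.1 p) = 0 := fun u =>
      fderivWithin_const_apply u
    change fderivWithin ℝ (modelField w) univ (i.1 p) v -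
      fderivWithin ℝ (modelField v) univ (i.1 p) w = 0
    rw [this, this]
    exact sub_self (0 : Rn k)
  exact (congrArg _ h0).trans (map_zero _)

/-- Torsion-freeness is applied to two fields with constant components, whose bracket vanishes. -/
theorem christoffelOn_symm (Γ : Connection k P) (hΓ : Γ.torsion = 0) (i : atlas (Rn k) P) {p : P}
    (hp : p ∈ i.1.source) (v w : Rn k) :
    christoffelOn Γ i p v w = christoffelOn Γ i p w v := by
  have h := Γ.torsion_eq_zero_iff.1 hΓ (fieldDiffAt_constField i v hp)
    (fieldDiffAt_constField i w hp)
  rw [mlieBracket_constField i hp] at h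
  have h' := congrArg (tangentCoord i p) (sub_eq_zero.1 h)
  rw [tangentCoord_connection_constField Γ _ hp, tangentCoord_connection_constField Γ _ hp] at h'
  have h1 : ∀ u : Rn k, tangentCoord i p (constField i u p) = u :=
    fun u => components_constField _ _ _
  rwa [h1, h1] at h'

/-- The smoothness of `Γ` speaks of sections smooth on all of `P`, whereas a coordinate field is
smooth only on its chart domain. It is cut off by a bump function supported in the domain; this is
where the Hausdorff property enters. -/
theorem contMDiffAt_christoffelColumn [T2Space P] (Γ : Connection k P)
    (hΓ : Γ.ContMDiffCovariantDerivative ∞) (i : atlas (Rn k) P) (l : Fin k) (v : Rn k) {p : P}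
    (hp : p ∈ i.1.source) :
    ContMDiffAt 𝓘(ℝ, Rn k) 𝓘(ℝ, Rn k) ∞ (fun q => christoffelColumn Γ i q l v) p := by
  set w : Rn k := EuclideanSpace.single l 1 with hw
  obtain ⟨f, hf⟩ := (SmoothBumpFunction.nhds_basis_tsupport (I := 𝓘(ℝ, Rn k)) p).mem_iff.1
    (i.1.open_source.mem_nhds hp)
  have hf := hf.2
  let σ : ∀ q : P, Tan k q := fun q => f q • constField i w q
  have hσ : ContMDiff 𝓘(ℝ, Rn k) 𝓘(ℝ, Rn k).tangent ∞
      (fun q => (⟨q, σ q⟩ : TangentBundle 𝓘(ℝ, Rn k) P)) := by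
    intro q
    by_cases hq : q ∈ i.1.source
    · rw [contMDiffAt_field_iff i hq]
      have : components i σ = fun q => f q • w := funext fun q => by
        change tangentCoord i q (f q • constField i w q) = _
        rw [map_smul]
        exact congrArg _ (components_constField i w q)
      rw [this]
      exact f.contMDiffAt.smul contMDiffAt_const
    · have h0 : ∀ᶠ z in 𝓝 q, σ z = 0 := by
        have := (isClosed_tsupport f).isOpen_compl.mem_nhds fun h => hq (hf h)
        filter_upwards [this] with z hz
        change f z • _ = _
        rw [image_eq_zero_of_notMem_tsupport hz, zero_smul]
      have hz := (Bundle.contMDiff_zeroSection ℝ (IB := 𝓘(ℝ, Rn k)) (n := ∞) (F := Rn k)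
        (TangentSpace 𝓘(ℝ, Rn k) : P → Type _)) q
      refine hz.congr_of_eventuallyEq ?_
      filter_upwards [h0] with z hz
      rw [hz]
      rfl
  have h1 := (hΓ.contMDiff.contMDiff (σ := σ) (by simpa using hσ.contMDiffOn)).contMDiffAt
    (x := p) univ_mem
  have h2 : ContMDiffAt 𝓘(ℝ, Rn k) 𝓘(ℝ, Rn k).tangent ∞
      (fun q => (⟨q, constField i v q⟩ : TangentBundle 𝓘(ℝ, Rn k) P)) p := by
    rw [contMDiffAt_field_iff i hp]
    have : components i (constField i v) = fun _ => v := funext fun q => by simp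
    rw [this]
    exact contMDiffAt_const
  have h3 := (contMDiffAt_field_iff i hp).1 (h1.clm_bundle_apply h2)
  refine h3.congr_of_eventuallyEq ?_
  -- For `q` near `p` the bump function equals one on a neighbourhood of `q`, so by locality the
  -- covariant derivatives of `σ` and of the coordinate field agree at `q`.
  filter_upwards [eventually_eventually_nhds.2 f.eventuallyEq_one,
    i.1.open_source.mem_nhds hp] with q hq hqi
  change tangentCoord i q (Γ (constField i w) q ((tangentCoord i q).symm v)) =
    tangentCoord i q (Γ σ q ((tangentCoord i q).symm v))
  congr 2
  refine Γ.isCovariantDerivativeOnUniv.congr_of_eventuallyEq (fieldDiffAt_constField i w hqi)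
    ((hσ q).mdifferentiableAt (by simp)) univ_mem ?_
  filter_upwards [hq] with z hz
  change _ = f z • constField i w z
  rw [hz, Pi.one_apply, one_smul]

theorem contMDiffAt_chart_symm (i : atlas (Rn k) P) {u : Rn k} (hu : u ∈ i.1.target) :
    ContMDiffAt 𝓘(ℝ, Rn k) 𝓘(ℝ, Rn k) ∞ i.1.symm u :=
  contMDiffAt_symm_of_mem_maximalAtlas (IsManifold.subset_maximalAtlas i.2) hu

theorem contMDiffAt_chart (i : atlas (Rn k) P) {p : P} (hp : p ∈ i.1.source) :
    ContMDiffAt 𝓘(ℝ, Rn k) 𝓘(ℝ, Rn k) ∞ i.1 p :=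
  contMDiffAt_of_mem_maximalAtlas (IsManifold.subset_maximalAtlas i.2) hp

theorem contDiffOn_christoffelOn [T2Space P] (Γ : Connection k P)
    (hΓ : Γ.ContMDiffCovariantDerivative ∞) (i : atlas (Rn k) P) :
    ContDiffOn ℝ ∞ (fun u => christoffelOn Γ i (i.1.symm u)) i.1.target := by
  rw [contDiffOn_clm_apply]
  intro v
  rw [contDiffOn_clm_apply]
  intro w
  simp_rw [christoffelOn_apply]
  intro u hu
  apply ContDiffAt.contDiffWithinAt
  refine ContDiffAt.sum fun l _ => ContDiffAt.const_smul (w l) ?_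
  rw [← contMDiffAt_iff_contDiffAt]
  exact ContMDiffAt.comp (I' := 𝓘(ℝ, Rn k)) u (g := fun q => christoffelColumn Γ i q l v)
    (f := i.1.symm) (contMDiffAt_christoffelColumn Γ hΓ i l v (i.1.map_target hu))
    (contMDiffAt_chart_symm i hu)

end ChartCalculus

/-! ### Inverse function theorem on `ℝⁿ` -/

section LocalInverses

variable {n k : ℕ}

theorem exists_continuous_leftInverse {D : Rn n →L[ℝ] Rn k} (hD : Function.Injective D) :
    ∃ L : Rn k →L[ℝ] Rn n, ∀ x, L (D x) = x := by
  obtain ⟨L, hL⟩ := LinearMap.exists_leftInverse_of_injective (D : Rn n →ₗ[ℝ] Rn k)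
    (LinearMap.ker_eq_bot.2 hD)
  exact ⟨LinearMap.toContinuousLinearMap L, fun x => LinearMap.congr_fun hL x⟩

theorem exists_continuousLinearEquiv_of_injective {D : Rn n →L[ℝ] Rn n}
    (hD : Function.Injective D) : ∃ e : Rn n ≃L[ℝ] Rn n, (e : Rn n →L[ℝ] Rn n) = D :=
  ⟨(LinearEquiv.ofInjectiveEndo (D : Rn n →ₗ[ℝ] Rn n) hD).toContinuousLinearEquiv, by ext1 x; rfl⟩

/-- The inverse function theorem makes the inverse smooth at the image of `a`. Since invertible
linear maps form an open set, the source can be shrunk until the derivative is invertible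
throughout, and then the inverse is smooth on the whole target. -/
theorem exists_local_inverse {g : Rn n → Rn n} {a : Rn n}
    (hg : ∀ᶠ x in 𝓝 a, ContDiffAt ℝ ∞ g x) (hinj : Function.Injective (fderiv ℝ g a)) :
    ∃ e : OpenPartialHomeomorph (Rn n) (Rn n), (e : Rn n → Rn n) = g ∧ a ∈ e.source ∧
      ∀ y ∈ e.target, ContDiffAt ℝ ∞ e.symm y := by
  have ha := hg.self_of_nhds
  obtain ⟨A, hA⟩ := exists_continuousLinearEquiv_of_injective hinj
  have hA' : HasFDerivAt g (A : Rn n →L[ℝ] Rn n) a := by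
    rw [hA]
    exact (ha.differentiableAt (by simp)).hasFDerivAt
  let e₀ := ha.toOpenPartialHomeomorph g hA' (by simp)
  have he₀ : (e₀ : Rn n → Rn n) = g := rfl
  have hU : ∀ᶠ x in 𝓝 a, ContDiffAt ℝ ∞ g x ∧
      fderiv ℝ g x ∈ range ((↑) : (Rn n ≃L[ℝ] Rn n) → Rn n →L[ℝ] Rn n) := by
    refine hg.and ?_
    have hc : ContinuousAt (fderiv ℝ g) a :=
      (ha.fderiv_right (m := 0) (by simp)).continuousAt
    exact hc ((ContinuousLinearEquiv.isOpen (𝕜 := ℝ)).mem_nhds ⟨A, hA⟩)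
  obtain ⟨U, hU, hUo, haU⟩ := eventually_nhds_iff.1 hU
  refine ⟨e₀.restrOpen U hUo, by simp [he₀], ?_, ?_⟩
  · exact ⟨ha.mem_toOpenPartialHomeomorph_source hA' (by simp), haU⟩
  · intro y hy
    have hys := (e₀.restrOpen U hUo).map_target hy
    obtain ⟨h1, B, hB⟩ := hU _ hys.2
    refine (e₀.restrOpen U hUo).contDiffAt_symm (f₀' := B) hy ?_ ?_
    · rw [hB]
      exact (h1.differentiableAt (by simp)).hasFDerivAt
    · exact h1

end LocalInverses

/-! ### Immersions of `ℝⁿ`: retractions and covariant derivatives along them -/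

section Immersions

variable {n k : ℕ} {E : Type*} [TopologicalSpace E] [ChartedSpace (Rn k) E]
  [IsManifold 𝓘(ℝ, Rn k) ∞ E] {s : Rn n → E} {a : Rn n}

theorem contDiffAt_chart_comp (i : atlas (Rn k) E) {a : Rn n}
    (hs : ContMDiffAt 𝓘(ℝ, Rn n) 𝓘(ℝ, Rn k) ∞ s a) (hp : s a ∈ i.1.source) :
    ContDiffAt ℝ ∞ (i.1 ∘ s) a :=
  contMDiffAt_iff_contDiffAt.1 ((contMDiffAt_chart i hp).comp a hs)

theorem eventually_chart_comp (i : atlas (Rn k) E)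
    (hs : ∀ᶠ x in 𝓝 a, ContMDiffAt 𝓘(ℝ, Rn n) 𝓘(ℝ, Rn k) ∞ s x) (hp : s a ∈ i.1.source) :
    ∀ᶠ x in 𝓝 a, s x ∈ i.1.source ∧ MDifferentiableAt 𝓘(ℝ, Rn n) 𝓘(ℝ, Rn k) s x ∧
      ContDiffAt ℝ ∞ (i.1 ∘ s) x := by
  filter_upwards [hs, hs.self_of_nhds.continuousAt (i.1.open_source.mem_nhds hp)] with x h1 h2
  exact ⟨h2, h1.mdifferentiableAt (by simp), contDiffAt_chart_comp i h1 h2⟩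

theorem injective_fderiv_chart_comp_iff (i : atlas (Rn k) E)
    (hs : MDifferentiableAt 𝓘(ℝ, Rn n) 𝓘(ℝ, Rn k) s a) (hp : s a ∈ i.1.source) :
    Function.Injective (fderiv ℝ (i.1 ∘ s) a) ↔
      Function.Injective (mfderiv 𝓘(ℝ, Rn n) 𝓘(ℝ, Rn k) s a) := by
  have h : (fderiv ℝ (i.1 ∘ s) a : Rn n → Rn k) =
      tangentCoord i (s a) ∘ mfderiv 𝓘(ℝ, Rn n) 𝓘(ℝ, Rn k) s a :=
    funext fun v => fderiv_chart_comp i hs hp v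
  rw [h]
  exact (tangentCoord i (s a)).injective.of_comp_iff _

/-- Injectivity is an open condition on linear maps between fixed spaces. It is therefore tested in
one chart, the tangent spaces at `s x` varying with `x`. -/
theorem eventually_injective_mfderiv
    (hs : ∀ᶠ x in 𝓝 a, ContMDiffAt 𝓘(ℝ, Rn n) 𝓘(ℝ, Rn k) ∞ s x)
    (hinj : Function.Injective (mfderiv 𝓘(ℝ, Rn n) 𝓘(ℝ, Rn k) s a)) :
    ∀ᶠ x in 𝓝 a, Function.Injective (mfderiv 𝓘(ℝ, Rn n) 𝓘(ℝ, Rn k) s x) := by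
  have hp : s a ∈ (achart (Rn k) (s a)).1.source := mem_chart_source _ _
  have h := eventually_chart_comp (achart (Rn k) (s a)) hs hp
  have h0 := h.self_of_nhds
  have hc : ContinuousAt (fderiv ℝ ((achart (Rn k) (s a)).1 ∘ s)) a :=
    (h0.2.2.fderiv_right (m := 0) (by simp)).continuousAt
  have h2 := hc (ContinuousLinearMap.isOpen_injective.mem_nhds
    ((injective_fderiv_chart_comp_iff _ h0.2.1 hp).2 hinj))
  filter_upwards [h, h2] with x hx hx2
  exact (injective_fderiv_chart_comp_iff _ hx.2.1 hx.1).1 hx2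

/-- An immersion has a smooth local retraction of the form `e⁻¹ ∘ L ∘ i`, with `L` linear and `i` a
chart. -/
theorem exists_retraction (i : atlas (Rn k) E)
    (hs : ∀ᶠ x in 𝓝 a, ContMDiffAt 𝓘(ℝ, Rn n) 𝓘(ℝ, Rn k) ∞ s x) (hp : s a ∈ i.1.source)
    {L : Rn k →L[ℝ] Rn n} (hL : Function.Injective (L.comp (fderiv ℝ (i.1 ∘ s) a))) :
    ∃ e : OpenPartialHomeomorph (Rn n) (Rn n), (e : Rn n → Rn n) = (fun x => L (i.1 (s x))) ∧
      a ∈ e.source ∧ (∀ y ∈ e.target, ContDiffAt ℝ ∞ e.symm y) ∧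
      (∀ᶠ x in 𝓝 a, e.symm (L (i.1 (s x))) = x) ∧
      ∀ᶠ q in 𝓝 (s a), ContMDiffAt 𝓘(ℝ, Rn k) 𝓘(ℝ, Rn n) ∞ (fun q => e.symm (L (i.1 q))) q := by
  have h := eventually_chart_comp i hs hp
  have hg : ∀ᶠ x in 𝓝 a, ContDiffAt ℝ ∞ (fun x => L (i.1 (s x))) x := by
    filter_upwards [h] with x hx
    exact L.contDiff.contDiffAt.comp x hx.2.2
  have hd : fderiv ℝ (fun x => L (i.1 (s x))) a = L.comp (fderiv ℝ (i.1 ∘ s) a) :=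
    (L.hasFDerivAt.comp a (h.self_of_nhds.2.2.differentiableAt (by simp)).hasFDerivAt).fderiv
  rw [← hd] at hL
  obtain ⟨e, he, ha, hsymm⟩ := exists_local_inverse hg hL
  have he' : ∀ x, e x = L (i.1 (s x)) := fun x => congrFun he x
  refine ⟨e, he, ha, hsymm, ?_, ?_⟩
  · filter_upwards [e.open_source.mem_nhds ha] with x hx
    rw [← he', e.left_inv hx]
  · have hc : ContinuousAt (fun q => L (i.1 q)) (s a) :=
      L.continuous.continuousAt.comp (i.1.continuousAt hp)
    have ht : L (i.1 (s a)) ∈ e.target := by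
      rw [← he']
      exact e.map_source ha
    filter_upwards [i.1.open_source.mem_nhds hp, hc (e.open_target.mem_nhds ht)] with q hq hqt
    have h1 : ContMDiffAt 𝓘(ℝ, Rn k) 𝓘(ℝ, Rn n) ∞ (fun q => L (i.1 q)) q :=
      ContMDiffAt.comp (I' := 𝓘(ℝ, Rn k)) q L.contMDiff.contMDiffAt (contMDiffAt_chart i hq)
    exact ContMDiffAt.comp (I' := 𝓘(ℝ, Rn n)) q (hsymm _ hqt).contMDiffAt h1

/-- For `L` a left inverse of the derivative at `a`, the map `L ∘ i ∘ s` has the identity as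
derivative at `a`. The resulting `r` also assigns parameters to points of `E` off the image, which
is what allows fields along `s` to be extended. -/
theorem exists_smooth_retraction
    (hs : ∀ᶠ x in 𝓝 a, ContMDiffAt 𝓘(ℝ, Rn n) 𝓘(ℝ, Rn k) ∞ s x)
    (hinj : Function.Injective (mfderiv 𝓘(ℝ, Rn n) 𝓘(ℝ, Rn k) s a)) :
    ∃ r : E → Rn n, (∀ᶠ x in 𝓝 a, r (s x) = x) ∧
      ∀ᶠ q in 𝓝 (s a), ContMDiffAt 𝓘(ℝ, Rn k) 𝓘(ℝ, Rn n) ∞ r q := by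
  have hp : s a ∈ (achart (Rn k) (s a)).1.source := mem_chart_source _ _
  have hd := hs.self_of_nhds.mdifferentiableAt (by simp)
  obtain ⟨L, hL⟩ := exists_continuous_leftInverse
    ((injective_fderiv_chart_comp_iff (achart (Rn k) (s a)) hd hp).2 hinj)
  obtain ⟨e, -, -, -, h1, h2⟩ := exists_retraction (achart (Rn k) (s a)) hs hp
    (L := L) (fun x y hxy => by rw [← hL x, ← hL y]; exact hxy)
  exact ⟨_, h1, h2⟩

/-- The Hessian of an immersion `s` in the chart `i`, corrected by the Christoffel symbols. -/
def covHessian (Γ : Connection k E) (i : atlas (Rn k) E) (s : Rn n → E) (a ξ η : Rn n) : Rn k :=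
  fderiv ℝ (fderiv ℝ (i.1 ∘ s)) a ξ η +
    christoffelOn Γ i (s a) (fderiv ℝ (i.1 ∘ s) a ξ) (fderiv ℝ (i.1 ∘ s) a η)

theorem hasFDerivAt_fderiv {V W : Type*} [NormedAddCommGroup V] [NormedSpace ℝ V]
    [NormedAddCommGroup W] [NormedSpace ℝ W] {f : V → W} {a : V} (h : ContDiffAt ℝ ∞ f a) :
    HasFDerivAt (fderiv ℝ f) (fderiv ℝ (fderiv ℝ f) a) a :=
  ((h.fderiv_right (m := 1) (WithTop.coe_le_coe.2 le_top)).differentiableAt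
    (by simp)).hasFDerivAt

/-- With `σ = i ∘ s`, the components of `Y` along `s` are `Dσ(y)`. Their derivative along `ξ` is
`D²σ(ξ, y) + Dσ(y' ξ)` by the product rule, and the Christoffel term of `∇` completes the first
summand to the covariant Hessian. -/
theorem tangentCoord_connection_along (Γ : Connection k E) (i : atlas (Rn k) E)
    (hs : ∀ᶠ x in 𝓝 a, ContMDiffAt 𝓘(ℝ, Rn n) 𝓘(ℝ, Rn k) ∞ s x) (hp : s a ∈ i.1.source)
    {Y : ∀ q : E, Tan k q} (hY : FieldDiffAt Y (s a)) {y : Rn n → Rn n} {y' : Rn n →L[ℝ] Rn n}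
    (hy : HasFDerivAt y y' a)
    (hYy : ∀ᶠ x in 𝓝 a, Y (s x) = mfderiv 𝓘(ℝ, Rn n) 𝓘(ℝ, Rn k) s x (y x)) (ξ : Rn n) :
    tangentCoord i (s a) (Γ Y (s a) (mfderiv 𝓘(ℝ, Rn n) 𝓘(ℝ, Rn k) s a ξ)) =
      covHessian Γ i s a ξ (y a) + fderiv ℝ (i.1 ∘ s) a (y' ξ) := by
  have h := eventually_chart_comp i hs hp
  obtain ⟨-, hsd, hσ⟩ := h.self_of_nhds
  let D : Tan k (s a) →L[ℝ] Rn k := mfderiv 𝓘(ℝ, Rn k) 𝓘(ℝ, Rn k) (components i Y) (s a)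
  have hD : HasMFDerivAt 𝓘(ℝ, Rn k) 𝓘(ℝ, Rn k) (components i Y) (s a) D :=
    ((fieldDiffAt_iff i hp).1 hY).hasMFDerivAt
  have hcomp : (components i Y ∘ s) =ᶠ[𝓝 a] fun x => fderiv ℝ (i.1 ∘ s) x (y x) := by
    filter_upwards [h, hYy] with x hx hx2
    change tangentCoord i (s x) (Y (s x)) = _
    rw [hx2]
    exact (fderiv_chart_comp i hx.2.1 hx.1 (y x)).symm
  have h1 : HasFDerivAt (components i Y ∘ s)
      (show Rn n →L[ℝ] Rn k from D.comp (mfderiv 𝓘(ℝ, Rn n) 𝓘(ℝ, Rn k) s a)) a :=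
    (hD.comp a hsd.hasMFDerivAt).hasFDerivAt
  have h2 := ((hasFDerivAt_fderiv hσ).clm_apply hy).congr_of_eventuallyEq hcomp
  have h3 := DFunLike.congr_fun (h1.unique h2) ξ
  have h4 : D (mfderiv 𝓘(ℝ, Rn n) 𝓘(ℝ, Rn k) s a ξ) =
      fderiv ℝ (i.1 ∘ s) a (y' ξ) + fderiv ℝ (fderiv ℝ (i.1 ∘ s)) a ξ (y a) := h3
  rw [tangentCoord_connection Γ i hp hD, h4]
  have h5 : components i Y (s a) = fderiv ℝ (i.1 ∘ s) a (y a) := hcomp.self_of_nhds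
  have h6 : tangentCoord i (s a) (mfderiv 𝓘(ℝ, Rn n) 𝓘(ℝ, Rn k) s a ξ) =
    fderiv ℝ (i.1 ∘ s) a ξ := (fderiv_chart_comp i hsd hp ξ).symm
  rw [h5, covHessian]
  erw [h6]
  abel

/-- The second fundamental forms are tested on fields of `E`, while `Ts(η)` exists only along `s`.
Its components are spread over a neighbourhood by composing them with the retraction `r`. -/
theorem exists_field_extension
    (hs : ∀ᶠ x in 𝓝 a, ContMDiffAt 𝓘(ℝ, Rn n) 𝓘(ℝ, Rn k) ∞ s x)
    (hinj : Function.Injective (mfderiv 𝓘(ℝ, Rn n) 𝓘(ℝ, Rn k) s a)) (η : Rn n) :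
    ∃ Y : ∀ q : E, Tan k q, FieldDiffAt Y (s a) ∧
      ∀ᶠ x in 𝓝 a, Y (s x) = mfderiv 𝓘(ℝ, Rn n) 𝓘(ℝ, Rn k) s x η := by
  obtain ⟨r, hr, hrs⟩ := exists_smooth_retraction hs hinj
  set i := achart (Rn k) (s a) with hi
  have hp : s a ∈ i.1.source := mem_chart_source _ _
  have h := eventually_chart_comp i hs hp
  refine ⟨fun q => (tangentCoord i q).symm (fderiv ℝ (i.1 ∘ s) (r q) η), ?_, ?_⟩
  · rw [fieldDiffAt_iff i hp]
    have h1 : components i (fun q => (tangentCoord i q).symm (fderiv ℝ (i.1 ∘ s) (r q) η)) =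
        (fun x => fderiv ℝ (i.1 ∘ s) x η) ∘ r :=
      funext fun q => (tangentCoord i q).apply_symm_apply _
    rw [h1]
    have h2 : DifferentiableAt ℝ (fun x => fderiv ℝ (i.1 ∘ s) x η) a :=
      ((hasFDerivAt_fderiv h.self_of_nhds.2.2).clm_apply (hasFDerivAt_const η a)).differentiableAt
    exact MDifferentiableAt.comp_of_eq (I' := 𝓘(ℝ, Rn n)) (s a) h2.mdifferentiableAt
      (hrs.self_of_nhds.mdifferentiableAt (by simp)) hr.self_of_nhds
  · filter_upwards [h, hr] with x hx hrx
    apply (tangentCoord i (s x)).injective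
    refine ((tangentCoord i (s x)).apply_symm_apply _).trans ?_
    rw [hrx]
    exact fderiv_chart_comp i hx.2.1 hx.1 η

/-- Injectivity of `Ts` near `a` leaves no choice for `y`, so only its regularity is at stake. With
`L` a left inverse of `Dσ` at `a`, one has `y = (L Dσ)⁻¹ (L Y)`, and inversion is differentiable at
the identity. -/
theorem exists_field_restriction
    (hs : ∀ᶠ x in 𝓝 a, ContMDiffAt 𝓘(ℝ, Rn n) 𝓘(ℝ, Rn k) ∞ s x)
    (hinj : Function.Injective (mfderiv 𝓘(ℝ, Rn n) 𝓘(ℝ, Rn k) s a))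
    {Y : ∀ q : E, Tan k q} (hY : FieldDiffAt Y (s a))
    (hYs : ∀ᶠ x in 𝓝 a, ∃ u : Rn n, Y (s x) = mfderiv 𝓘(ℝ, Rn n) 𝓘(ℝ, Rn k) s x u) :
    ∃ y : Rn n → Rn n, DifferentiableAt ℝ y a ∧
      ∀ᶠ x in 𝓝 a, Y (s x) = mfderiv 𝓘(ℝ, Rn n) 𝓘(ℝ, Rn k) s x (y x) := by
  set i := achart (Rn k) (s a) with hi
  have hp : s a ∈ i.1.source := mem_chart_source _ _
  have h := eventually_chart_comp i hs hp
  obtain ⟨-, hsd, hσ⟩ := h.self_of_nhds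
  obtain ⟨L, hL⟩ := exists_continuous_leftInverse
    ((injective_fderiv_chart_comp_iff i hsd hp).2 hinj)
  let A : Rn n → Rn n →L[ℝ] Rn n := fun x => L.comp (fderiv ℝ (i.1 ∘ s) x)
  have hA : DifferentiableAt ℝ A a :=
    ((hasFDerivAt_const L a).clm_comp (hasFDerivAt_fderiv hσ)).differentiableAt
  have hA1 : A a = 1 := ContinuousLinearMap.ext fun x => hL x
  have hu : ∀ᶠ x in 𝓝 a, IsUnit (A x) :=
    hA.continuousAt (Units.isOpen.mem_nhds (show IsUnit (A a) by rw [hA1]; exact isUnit_one))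
  have hc : DifferentiableAt ℝ (components i Y ∘ s) a :=
    (((fieldDiffAt_iff i hp).1 hY).comp a hsd).differentiableAt
  refine ⟨fun x => Ring.inverse (A x) (L (components i Y (s x))), ?_, ?_⟩
  · refine DifferentiableAt.clm_apply ?_ (L.differentiableAt.comp a hc)
    have h1 : DifferentiableAt ℝ (Ring.inverse : (Rn n →L[ℝ] Rn n) → _) (A a) := by
      rw [hA1]
      exact differentiableAt_inverse isUnit_one
    exact h1.comp a hA
  · filter_upwards [h, hYs, hu] with x hx hYx hux
    obtain ⟨u, hu⟩ := hYx
    have h2 : components i Y (s x) = fderiv ℝ (i.1 ∘ s) x u := by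
      rw [fderiv_chart_comp i hx.2.1 hx.1 u, ← hu]
      rfl
    have h3 : Ring.inverse (A x) (L (components i Y (s x))) = u := by
      rw [h2]
      exact DFunLike.congr_fun (Ring.inverse_mul_cancel _ hux) u
    rw [h3, hu]

end Immersions

/-! ### Local parametrizations of submanifolds and the second fundamental form -/

section LocalParametrizations

variable {n m : ℕ} {E : Type*} [TopologicalSpace E] [ChartedSpace (Rn (n + m)) E]
  {L : Set E} {s : Rn n → E} {a : Rn n}

theorem IsLocalParam.eventually_mem (h : IsLocalParam (m := m) L s a) : ∀ᶠ x in 𝓝 a, s x ∈ L := by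
  have : ∀ᶠ y in map s (𝓝 a), y ∈ L := by
    rw [h.map_nhds]
    exact self_mem_nhdsWithin
  exact this

theorem IsLocalParam.mdifferentiableAt (h : IsLocalParam (m := m) L s a) :
    MDifferentiableAt 𝓘(ℝ, Rn n) 𝓘(ℝ, Rn (n + m)) s a :=
  h.smooth.self_of_nhds.mdifferentiableAt (by simp)

/-- `map_nhds` turns a statement about the points of `L` near `s a` into one about parameters near
`a`. -/
theorem IsLocalParam.eventually_rightInverse (h : IsLocalParam (m := m) L s a) {r : E → Rn n}
    (hr : ∀ᶠ x in 𝓝 a, r (s x) = x) : ∀ᶠ q in 𝓝[L] (s a), s (r q) = q := by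
  rw [← h.map_nhds, eventually_map]
  filter_upwards [hr] with x hx
  rw [hx]

/-- Reparametrization by a local diffeomorphism. -/
theorem IsLocalParam.comp_symm (h : IsLocalParam (m := m) L s a)
    {e : OpenPartialHomeomorph (Rn n) (Rn n)} (ha : a ∈ e.source)
    (he : ∀ x ∈ e.source, DifferentiableAt ℝ e x)
    (hsymm : ∀ y ∈ e.target, ContDiffAt ℝ ∞ e.symm y) :
    IsLocalParam (m := m) L (s ∘ e.symm) (e a) := by
  have hea := e.map_source ha
  have hc : Tendsto e.symm (𝓝 (e a)) (𝓝 a) := by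
    have := (e.continuousAt_symm hea).tendsto
    rwa [e.left_inv ha] at this
  refine ⟨?_, ?_, ?_⟩
  · filter_upwards [e.open_target.mem_nhds hea, hc.eventually h.smooth] with y hy hys
    exact hys.comp y (hsymm y hy).contMDiffAt
  · have h1 : MDifferentiableAt 𝓘(ℝ, Rn n) 𝓘(ℝ, Rn n) e.symm (e a) :=
      ((hsymm _ hea).differentiableAt (by simp)).mdifferentiableAt
    have h2 : MDifferentiableAt 𝓘(ℝ, Rn n) 𝓘(ℝ, Rn (n + m)) s (e.symm (e a)) := by
      rw [e.left_inv ha]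
      exact h.mdifferentiableAt
    rw [mfderiv_comp (e a) h2 h1]
    have h3 : Function.Injective
        (mfderiv 𝓘(ℝ, Rn n) 𝓘(ℝ, Rn (n + m)) s (e.symm (e a))) := by
      rw [e.left_inv ha]
      exact h.injective
    refine h3.comp ?_
    rw [mfderiv_eq_fderiv]
    have h4 : (fderiv ℝ e (e.symm (e a))).comp (fderiv ℝ e.symm (e a)) =
        ContinuousLinearMap.id ℝ (Rn n) := by
      have h5 : DifferentiableAt ℝ e (e.symm (e a)) := he _ (e.map_target hea)
      rw [← fderiv_comp (e a) h5 ((hsymm _ hea).differentiableAt (by simp))]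
      have h6 : (e ∘ e.symm) =ᶠ[𝓝 (e a)] id := by
        filter_upwards [e.open_target.mem_nhds hea] with y hy using e.right_inv hy
      rw [h6.fderiv_eq, fderiv_id]
    intro u v huv
    have h7 := congrArg (fderiv ℝ e (e.symm (e a))) huv
    exact (DFunLike.congr_fun h4 u).symm.trans (h7.trans (DFunLike.congr_fun h4 v))
  · have h1 : map e.symm (𝓝 (e a)) = 𝓝 a := by
      have := e.symm.map_nhds_eq (x := e a) hea
      rwa [e.left_inv ha] at this
    rw [← Filter.map_map, h1, h.map_nhds]
    change _ = 𝓝[L] (s (e.symm (e a)))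
    rw [e.left_inv ha]

variable [IsManifold 𝓘(ℝ, Rn (n + m)) ∞ E]

/-- The only delicate condition at nearby parameters is `map_nhds`. On `L` near `s x` the retraction
satisfies `s ∘ r = id` and is continuous, whence `𝓝[L] (s x) ≤ map s (𝓝 x)`. -/
theorem IsLocalParam.eventually (h : IsLocalParam (m := m) L s a) :
    ∀ᶠ x in 𝓝 a, IsLocalParam (m := m) L s x := by
  obtain ⟨r, hr, hrs⟩ := exists_smooth_retraction h.smooth h.injective
  have hsr := h.eventually_rightInverse hr
  obtain ⟨W, hW, hWo, haW⟩ := eventually_nhds_iff.1 (eventually_nhdsWithin_iff.1 hsr)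
  have hsa := h.smooth.self_of_nhds.continuousAt
  filter_upwards [h.smooth.eventually_nhds, eventually_injective_mfderiv h.smooth h.injective,
    h.eventually_mem.eventually_nhds, hsa (hWo.mem_nhds haW), hr,
    hsa.eventually hrs] with x h1 h2 h3 h4 h5 h6
  refine ⟨h1, h2, le_antisymm ?_ ?_⟩
  · exact tendsto_nhdsWithin_iff.2 ⟨h1.self_of_nhds.continuousAt, h3⟩
  · have h7 : Tendsto r (𝓝[L] (s x)) (𝓝 x) := by
      have := h6.continuousAt.tendsto.mono_left (nhdsWithin_le_nhds (s := L))
      rwa [h5] at this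
    have h8 : Tendsto (fun q => s (r q)) (𝓝[L] (s x)) (map s (𝓝 x)) := tendsto_map.comp h7
    have h9 : (fun q => s (r q)) =ᶠ[𝓝[L] (s x)] id := by
      filter_upwards [nhdsWithin_le_nhds (hWo.mem_nhds h4), self_mem_nhdsWithin] with q hq hqL
      exact hW q hq hqL
    exact tendsto_id'.1 (h8.congr' h9)

/-- An immersion of `ℝⁿ` into an `n`-dimensional submanifold is a local parametrization of it. -/
theorem IsLocalParam.of_immersion (hL : IsEmbeddedSubmanifold n m L)
    (hs : ∀ᶠ x in 𝓝 a, ContMDiffAt 𝓘(ℝ, Rn n) 𝓘(ℝ, Rn (n + m)) ∞ s x)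
    (hinj : Function.Injective (mfderiv 𝓘(ℝ, Rn n) 𝓘(ℝ, Rn (n + m)) s a))
    (hsL : ∀ᶠ x in 𝓝 a, s x ∈ L) : IsLocalParam (m := m) L s a := by
  obtain ⟨t, b, htb, ht⟩ := hL (s a) hsL.self_of_nhds
  obtain ⟨r, hr, hrs⟩ := exists_smooth_retraction ht.smooth ht.injective
  have htr := ht.eventually_rightInverse hr
  rw [htb] at htr hrs
  have hsa := hs.self_of_nhds
  have hcont : Tendsto s (𝓝 a) (𝓝[L] (s a)) :=
    tendsto_nhdsWithin_iff.2 ⟨hsa.continuousAt, hsL⟩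
  -- Near `a`, `s` factors through the parametrization `t` by `r ∘ s : ℝⁿ → ℝⁿ`. By the chain rule
  -- this factor has injective, hence invertible, derivative; it is a local homeomorphism, and `s`
  -- inherits `map_nhds` from `t`.
  have heq : (t ∘ r ∘ s) =ᶠ[𝓝 a] s := hcont.eventually htr
  have hrsa : r (s a) = b := by rw [← htb]; exact hr.self_of_nhds
  have hg : ∀ᶠ x in 𝓝 a, ContDiffAt ℝ ∞ (r ∘ s) x := by
    filter_upwards [hs, hsa.continuousAt.eventually hrs] with x h1 h2
    exact contMDiffAt_iff_contDiffAt.1 (h2.comp x h1)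
  have hgd : Function.Injective (fderiv ℝ (r ∘ s) a) := by
    have h1 : MDifferentiableAt 𝓘(ℝ, Rn n) 𝓘(ℝ, Rn (n + m)) t ((r ∘ s) a) := by
      change MDifferentiableAt _ _ t (r (s a))
      rw [hrsa]
      exact ht.mdifferentiableAt
    have h2 : MDifferentiableAt 𝓘(ℝ, Rn n) 𝓘(ℝ, Rn n) (r ∘ s) a :=
      (hg.self_of_nhds.differentiableAt (by simp)).mdifferentiableAt
    have h3 := mfderiv_comp a h1 h2
    rw [heq.mfderiv_eq] at h3
    have h4 := h3 ▸ hinj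
    intro u v huv
    refine h4 ?_
    have h5 : mfderiv 𝓘(ℝ, Rn n) 𝓘(ℝ, Rn n) (r ∘ s) a u =
        mfderiv 𝓘(ℝ, Rn n) 𝓘(ℝ, Rn n) (r ∘ s) a v := by
      rw [mfderiv_eq_fderiv]
      exact huv
    exact congrArg (mfderiv 𝓘(ℝ, Rn n) 𝓘(ℝ, Rn (n + m)) t ((r ∘ s) a)) h5
  obtain ⟨e, he, hae, -⟩ := exists_local_inverse hg hgd
  have hmap : map (r ∘ s) (𝓝 a) = 𝓝 b := by
    have h1 := e.map_nhds_eq hae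
    rw [he] at h1
    rw [h1]
    exact congrArg 𝓝 hrsa
  refine ⟨hs, hinj, ?_⟩
  rw [← Filter.map_congr heq, ← Filter.map_map, hmap, ht.map_nhds, htb]

theorem IsLocalParam.mem_tangentSpaceOf_iff_coord (h : IsLocalParam (m := m) L s a)
    (i : atlas (Rn (n + m)) E) (hp : s a ∈ i.1.source) (v : Tan (n + m) (s a)) :
    v ∈ tangentSpaceOf (V := Rn (n + m)) L (s a) ↔
      tangentCoord i (s a) v ∈ range (fderiv ℝ (i.1 ∘ s) a) := by
  rw [tangentSpaceOf_eq_range h]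
  have h1 := fun u => fderiv_chart_comp i h.mdifferentiableAt hp u
  constructor
  · rintro ⟨u, rfl⟩
    exact ⟨u, h1 u⟩
  · rintro ⟨u, hu⟩
    exact ⟨u, (tangentCoord i (s a)).injective ((h1 u).symm.trans hu)⟩

/-- A submanifold is totally geodesic to first order at a point if and only if the covariant
Hessian of a parametrization is tangent. -/
theorem secondFundamentalFormVanishes_iff (Γ : Connection (n + m) E)
    {P : PointedSubmanifold n m E} (h : IsLocalParam (m := m) P.carrier s a) (hsa : s a = P.pt)
    (i : atlas (Rn (n + m)) E) (hp : P.pt ∈ i.1.source) :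
    SecondFundamentalFormVanishes Γ P ↔
      ∀ ξ η, covHessian Γ i s a ξ η ∈ range (fderiv ℝ (i.1 ∘ s) a) := by
  obtain ⟨L, hL, p, hpL⟩ := P
  change s a = p at hsa
  subst hsa
  change s a ∈ _ at hp
  change IsLocalParam (m := m) L s a at h
  have hmem := h.mem_tangentSpaceOf_iff_coord i hp
  unfold SecondFundamentalFormVanishes
  simp only [Submodule.mkQ_apply, Submodule.Quotient.mk_eq_zero]
  constructor
  · intro hP ξ η
    -- With `η` constant there is no term `Dσ(y' ξ)`, so the covariant derivative of this field is
    -- exactly the covariant Hessian.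
    obtain ⟨Y, hY, hYs⟩ := exists_field_extension h.smooth h.injective η
    have h1 := hP Y hY ?_ (mfderiv 𝓘(ℝ, Rn n) 𝓘(ℝ, Rn (n + m)) s a ξ) ?_
    · rw [hmem, tangentCoord_connection_along Γ i h.smooth hp hY (hasFDerivAt_const η a) hYs] at h1
      simpa using h1
    · rw [← h.map_nhds, eventually_map]
      filter_upwards [h.eventually, hYs] with x hx hxY
      rw [tangentSpaceOf_eq_range hx, hxY]
      exact ⟨η, rfl⟩
    · rw [tangentSpaceOf_eq_range h]
      exact ⟨ξ, rfl⟩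
  · intro hP Y hY hYs X hX
    rw [tangentSpaceOf_eq_range h] at hX
    obtain ⟨ξ, rfl⟩ := hX
    rw [← h.map_nhds, eventually_map] at hYs
    obtain ⟨y, hy, hyY⟩ := exists_field_restriction h.smooth h.injective hY (by
      filter_upwards [h.eventually, hYs] with x hx hxY
      rw [tangentSpaceOf_eq_range hx] at hxY
      obtain ⟨u, hu⟩ := hxY
      exact ⟨u, hu.symm⟩)
    rw [hmem]
    have h1 := tangentCoord_connection_along Γ i h.smooth hp hY hy.hasFDerivAt hyY ξ
    -- The other summand `Dσ(Dy ξ)` is tangent whatever `y` is, so modulo the tangent plane only the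
    -- Hessian counts.
    obtain ⟨u, hu⟩ := hP ξ (y a)
    refine ⟨u + fderiv ℝ y a ξ, ?_⟩
    rw [map_add, hu]
    exact h1.symm

end LocalParametrizations

/-! ### Germs of immersions of `M` and their second fundamental form -/

section Germs

variable {n m : ℕ} {M E : Type*} [TopologicalSpace M] [ChartedSpace (Rn n) M]
  [TopologicalSpace E] [ChartedSpace (Rn (n + m)) E]

/-- The expression of a germ of immersions in a chart of the source. -/
def ImmersionGerm.param (f : ImmersionGerm n m M E) (φ : atlas (Rn n) M) : Rn n → E :=
  f.toFun ∘ φ.1.symm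

theorem ImmersionGerm.param_chart (f : ImmersionGerm n m M E) {φ : atlas (Rn n) M} {y : M}
    (hy : y ∈ φ.1.source) : f.param φ (φ.1 y) = f.toFun y :=
  congrArg f.toFun (φ.1.left_inv hy)

theorem ImmersionGerm.eventually_param (f : ImmersionGerm n m M E) {φ : atlas (Rn n) M}
    (hφ : f.pt ∈ φ.1.source) {p : M → Prop} (h : ∀ᶠ y in 𝓝 f.pt, p y) :
    ∀ᶠ x in 𝓝 (φ.1 f.pt), x ∈ φ.1.target ∧ p (φ.1.symm x) := by
  have hc : Tendsto φ.1.symm (𝓝 (φ.1 f.pt)) (𝓝 f.pt) := by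
    have := (φ.1.continuousAt_symm (φ.1.map_source hφ)).tendsto
    rwa [φ.1.left_inv hφ] at this
  filter_upwards [φ.1.open_target.mem_nhds (φ.1.map_source hφ), hc.eventually h] with x h1 h2
  exact ⟨h1, h2⟩

variable [IsManifold 𝓘(ℝ, Rn n) ∞ M]

theorem ImmersionGerm.contMDiffAt_param (f : ImmersionGerm n m M E) {φ : atlas (Rn n) M}
    {x : Rn n} (hx : x ∈ φ.1.target)
    (hf : ContMDiffAt 𝓘(ℝ, Rn n) 𝓘(ℝ, Rn (n + m)) ∞ f.toFun (φ.1.symm x)) :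
    ContMDiffAt 𝓘(ℝ, Rn n) 𝓘(ℝ, Rn (n + m)) ∞ (f.param φ) x :=
  hf.comp x (contMDiffAt_chart_symm φ hx)

theorem ImmersionGerm.eventually_contMDiffAt_param (f : ImmersionGerm n m M E)
    {φ : atlas (Rn n) M} (hφ : f.pt ∈ φ.1.source) :
    ∀ᶠ x in 𝓝 (φ.1 f.pt), ContMDiffAt 𝓘(ℝ, Rn n) 𝓘(ℝ, Rn (n + m)) ∞ (f.param φ) x := by
  filter_upwards [f.eventually_param hφ f.immersion] with x hx
  exact f.contMDiffAt_param hx.1 hx.2.1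

variable [IsManifold 𝓘(ℝ, Rn (n + m)) ∞ E]

theorem ImmersionGerm.tangentCoord_mfderiv (f : ImmersionGerm n m M E) {φ : atlas (Rn n) M}
    (j : atlas (Rn (n + m)) E) {y : M} (hy : y ∈ φ.1.source)
    (hf : ContMDiffAt 𝓘(ℝ, Rn n) 𝓘(ℝ, Rn (n + m)) ∞ f.toFun y) (hj : f.toFun y ∈ j.1.source)
    (v : Tan n y) :
    tangentCoord j (f.toFun y) (mfderiv 𝓘(ℝ, Rn n) 𝓘(ℝ, Rn (n + m)) f.toFun y v) =
      fderiv ℝ (j.1 ∘ f.param φ) (φ.1 y) (tangentCoord φ y v) := by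
  rw [← mfderiv_chart_comp j (hf.mdifferentiableAt (by simp)) hj v]
  have h1 : (j.1 ∘ f.toFun) =ᶠ[𝓝 y] (j.1 ∘ f.param φ) ∘ φ.1 := by
    filter_upwards [φ.1.open_source.mem_nhds hy] with z hz
    change _ = j.1 (f.param φ (φ.1 z))
    rw [f.param_chart hz]
    rfl
  have h2 : ContMDiffAt 𝓘(ℝ, Rn n) 𝓘(ℝ, Rn (n + m)) ∞ (f.param φ) (φ.1 y) :=
    f.contMDiffAt_param (φ.1.map_source hy) (by rwa [φ.1.left_inv hy])
  have h3 : ContDiffAt ℝ ∞ (j.1 ∘ f.param φ) (φ.1 y) :=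
    contDiffAt_chart_comp j h2 (by rwa [f.param_chart hy])
  rw [h1.mfderiv_eq, mfderiv_comp y (h3.differentiableAt (by simp)).mdifferentiableAt
    (mdifferentiableAt_chart φ hy)]
  refine (congrArg (mfderiv 𝓘(ℝ, Rn n) 𝓘(ℝ, Rn (n + m)) (j.1 ∘ f.param φ) (φ.1 y))
    (mfderiv_chart φ hy v)).trans ?_
  rw [mfderiv_eq_fderiv]
  rfl

theorem ImmersionGerm.injective_fderiv_param (f : ImmersionGerm n m M E) {φ : atlas (Rn n) M}
    (hφ : f.pt ∈ φ.1.source) {j : atlas (Rn (n + m)) E} (hj : f.toFun f.pt ∈ j.1.source) :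
    Function.Injective (fderiv ℝ (j.1 ∘ f.param φ) (φ.1 f.pt)) := by
  obtain ⟨h1, h2⟩ := f.immersion.self_of_nhds
  intro u v huv
  have h3 : ∀ w, fderiv ℝ (j.1 ∘ f.param φ) (φ.1 f.pt) w =
      tangentCoord j (f.toFun f.pt) (mfderiv 𝓘(ℝ, Rn n) 𝓘(ℝ, Rn (n + m)) f.toFun f.pt
        ((tangentCoord φ f.pt).symm w)) := fun w => by
    rw [f.tangentCoord_mfderiv j hφ h1 hj, ContinuousLinearEquiv.apply_symm_apply]
  rw [h3, h3] at huv
  exact (tangentCoord φ f.pt).symm.injective (h2 ((tangentCoord j _).injective huv))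

theorem ImmersionGerm.injective_mfderiv_param (f : ImmersionGerm n m M E) {φ : atlas (Rn n) M}
    (hφ : f.pt ∈ φ.1.source) :
    Function.Injective (mfderiv 𝓘(ℝ, Rn n) 𝓘(ℝ, Rn (n + m)) (f.param φ) (φ.1 f.pt)) := by
  have hj : f.param φ (φ.1 f.pt) ∈
      (achart (Rn (n + m)) (f.toFun f.pt)).1.source := by
    rw [f.param_chart hφ]
    exact mem_chart_source _ _
  rw [← injective_fderiv_chart_comp_iff (achart (Rn (n + m)) (f.toFun f.pt))
    ((f.eventually_contMDiffAt_param hφ).self_of_nhds.mdifferentiableAt (by simp)) hj]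
  exact f.injective_fderiv_param hφ (mem_chart_source _ _)

/-- A variant of `tangentCoord_connection_along` with a free base point `p` and data given by
components. For `s = f.param φ` the equality `s a = f.toFun f.pt` is not definitional, and this form
avoids transports between tangent spaces. -/
theorem tangentCoord_connection_of_components {k : ℕ} {P : Type*} [TopologicalSpace P]
    [ChartedSpace (Rn k) P] [IsManifold 𝓘(ℝ, Rn k) ∞ P] {s : Rn n → P} {a : Rn n} {p : P}
    (Γ : Connection k P) (i : atlas (Rn k) P)
    (hs : ∀ᶠ x in 𝓝 a, ContMDiffAt 𝓘(ℝ, Rn n) 𝓘(ℝ, Rn k) ∞ s x) (hsa : s a = p)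
    (hp : p ∈ i.1.source) {Y : ∀ q : P, Tan k q} (hY : FieldDiffAt Y p) {y : Rn n → Rn n}
    {y' : Rn n →L[ℝ] Rn n} (hy : HasFDerivAt y y' a)
    (hYy : ∀ᶠ x in 𝓝 a, components i Y (s x) = fderiv ℝ (i.1 ∘ s) x (y x)) {v : Tan k p}
    {ξ : Rn n} (hv : tangentCoord i p v = fderiv ℝ (i.1 ∘ s) a ξ) :
    tangentCoord i p (Γ Y p v) = covHessian Γ i s a ξ (y a) + fderiv ℝ (i.1 ∘ s) a (y' ξ) := by
  subst hsa
  have h := eventually_chart_comp i hs hp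
  have hv' : v = mfderiv 𝓘(ℝ, Rn n) 𝓘(ℝ, Rn k) s a ξ := by
    apply (tangentCoord i (s a)).injective
    rw [hv]
    exact fderiv_chart_comp i h.self_of_nhds.2.1 hp ξ
  rw [hv']
  refine tangentCoord_connection_along Γ i hs hp hY hy ?_ ξ
  filter_upwards [h, hYy] with x hx hxY
  apply (tangentCoord i (s x)).injective
  exact hxY.trans (fderiv_chart_comp i hx.2.1 hx.1 (y x))

/-- A germ of immersions is totally geodesic to first order if and only if its covariant Hessian
is determined by the Christoffel symbols of the source. -/
theorem paramSecondFundamentalFormVanishes_iff (Γ : Connection (n + m) E) (Θ : Connection n M)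
    (f : ImmersionGerm n m M E) {φ : atlas (Rn n) M} (hφ : f.pt ∈ φ.1.source)
    {j : atlas (Rn (n + m)) E} (hj : f.toFun f.pt ∈ j.1.source) :
    ParamSecondFundamentalFormVanishes Γ Θ f ↔
      ∀ ξ η, covHessian Γ j (f.param φ) (φ.1 f.pt) ξ η =
        fderiv ℝ (j.1 ∘ f.param φ) (φ.1 f.pt) (christoffelOn Θ φ f.pt ξ η) := by
  obtain ⟨h1, h2⟩ := f.immersion.self_of_nhds
  have hs := f.eventually_contMDiffAt_param hφ
  have hsa := f.param_chart hφ
  have hev : ∀ᶠ y in 𝓝 f.pt, y ∈ φ.1.source ∧ f.toFun y ∈ j.1.source ∧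
      ContMDiffAt 𝓘(ℝ, Rn n) 𝓘(ℝ, Rn (n + m)) ∞ f.toFun y := by
    filter_upwards [φ.1.open_source.mem_nhds hφ, h1.continuousAt (j.1.open_source.mem_nhds hj),
      f.immersion] with y hy1 hy2 hy3
    exact ⟨hy1, hy2, hy3.1⟩
  constructor
  · intro hf ξ η
    -- On `M` the test field is the coordinate field `η`, for which `Θ` contributes only its
    -- Christoffel symbols; `Y'` extends its push-forward.
    obtain ⟨Y', hY', hYs⟩ := exists_field_extension hs (f.injective_mfderiv_param hφ) η
    rw [hsa] at hY'
    have hYc : ∀ᶠ x in 𝓝 (φ.1 f.pt), components j Y' (f.param φ x) =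
        fderiv ℝ (j.1 ∘ f.param φ) x η := by
      filter_upwards [hYs, eventually_chart_comp j hs (by rwa [hsa])] with x hx hx2
      rw [fderiv_chart_comp j hx2.2.1 hx2.1, ← hx]
      rfl
    have h3 := hf (constField φ η) Y' (fieldDiffAt_constField φ η hφ) hY' (by
      filter_upwards [hev, (φ.1.continuousAt hφ).eventually hYc] with y hy hyY
      apply (tangentCoord j (f.toFun y)).injective
      rw [f.tangentCoord_mfderiv j hy.1 hy.2.2 hy.2.1]
      rw [f.param_chart hy.1] at hyY
      refine hyY.trans ?_
      congr 1
      exact (components_constField φ η y).symm) ((tangentCoord φ f.pt).symm ξ)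
    have h4 := congrArg (tangentCoord j (f.toFun f.pt)) h3
    rw [map_sub, map_zero, f.tangentCoord_mfderiv j hφ h1 hj,
      tangentCoord_connection_constField Θ φ hφ, ContinuousLinearEquiv.apply_symm_apply,
      tangentCoord_connection_of_components Γ j hs hsa hj hY' (hasFDerivAt_const η _) hYc
        (ξ := ξ) (by rw [f.tangentCoord_mfderiv j hφ h1 hj,
          ContinuousLinearEquiv.apply_symm_apply])] at h4
    have h5 := sub_eq_zero.1 h4
    simpa using h5
  · intro hf Y Y' hY hY' hYY X
    apply (tangentCoord j (f.toFun f.pt)).injective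
    rw [map_sub, map_zero, f.tangentCoord_mfderiv j hφ h1 hj]
    set ξ := tangentCoord φ f.pt X with hξ
    let D : Tan n f.pt →L[ℝ] Rn n := mfderiv 𝓘(ℝ, Rn n) 𝓘(ℝ, Rn n) (components φ Y) f.pt
    have hD : HasMFDerivAt 𝓘(ℝ, Rn n) 𝓘(ℝ, Rn n) (components φ Y) f.pt D :=
      ((fieldDiffAt_iff φ hφ).1 hY).hasMFDerivAt
    let y : Rn n → Rn n := components φ Y ∘ φ.1.symm
    have hy : DifferentiableAt ℝ y (φ.1 f.pt) := by
      have h3 := (contMDiffAt_chart_symm φ (φ.1.map_source hφ)).mdifferentiableAt (by simp)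
      exact (MDifferentiableAt.comp_of_eq (φ.1 f.pt) hD.mdifferentiableAt h3
        (φ.1.left_inv hφ)).differentiableAt
    have hyφ : components φ Y =ᶠ[𝓝 f.pt] y ∘ φ.1 := by
      filter_upwards [φ.1.open_source.mem_nhds hφ] with z hz
      change _ = components φ Y (φ.1.symm (φ.1 z))
      rw [φ.1.left_inv hz]
    have hDX : D X = fderiv ℝ y (φ.1 f.pt) ξ := by
      change mfderiv 𝓘(ℝ, Rn n) 𝓘(ℝ, Rn n) (components φ Y) f.pt X = _
      rw [hyφ.mfderiv_eq, mfderiv_comp f.pt hy.mdifferentiableAt (mdifferentiableAt_chart φ hφ)]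
      refine (congrArg (mfderiv 𝓘(ℝ, Rn n) 𝓘(ℝ, Rn n) y (φ.1 f.pt))
        (mfderiv_chart φ hφ X)).trans ?_
      rw [mfderiv_eq_fderiv]
      rfl
    have hya : y (φ.1 f.pt) = components φ Y f.pt := hyφ.self_of_nhds.symm
    have hYc : ∀ᶠ x in 𝓝 (φ.1 f.pt), components j Y' (f.param φ x) =
        fderiv ℝ (j.1 ∘ f.param φ) x (y x) := by
      filter_upwards [f.eventually_param hφ (hev.and hYY)] with x hx
      obtain ⟨hx1, ⟨hx2, hx3, hx4⟩, hx5⟩ := hx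
      change tangentCoord j _ (Y' (f.toFun (φ.1.symm x))) = _
      rw [hx5, f.tangentCoord_mfderiv j hx2 hx4 hx3, φ.1.right_inv hx1]
      rfl
    -- The derivative of the components of `Y` enters both covariant derivatives through the same
    -- term `Dσ(Dy ξ)`, which cancels.
    rw [tangentCoord_connection_of_components Γ j hs hsa hj hY' hy.hasFDerivAt hYc (ξ := ξ)
      (by rw [f.tangentCoord_mfderiv j hφ h1 hj]), tangentCoord_connection Θ φ hφ hD, hDX, hf,
      hya, map_add]
    abel

end Germs

/-! ### Charts of a general manifold and tangent spaces of parametrized subsets -/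

section ManifoldCharts

variable {V : Type*} [NormedAddCommGroup V] [NormedSpace ℝ V] {N : Type*} [TopologicalSpace N]
  [ChartedSpace V N] [IsManifold 𝓘(ℝ, V) ∞ N]

theorem contMDiffAt_of_mem_atlas {e : OpenPartialHomeomorph N V} (he : e ∈ atlas V N) {x : N}
    (hx : x ∈ e.source) : ContMDiffAt 𝓘(ℝ, V) 𝓘(ℝ, V) ∞ e x :=
  contMDiffAt_of_mem_maximalAtlas (IsManifold.subset_maximalAtlas he) hx

theorem contMDiffAt_symm_of_mem_atlas {e : OpenPartialHomeomorph N V} (he : e ∈ atlas V N) {z : V}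
    (hz : z ∈ e.target) : ContMDiffAt 𝓘(ℝ, V) 𝓘(ℝ, V) ∞ e.symm z :=
  contMDiffAt_symm_of_mem_maximalAtlas (IsManifold.subset_maximalAtlas he) hz

theorem mdifferentiableAt_of_mem_atlas {e : OpenPartialHomeomorph N V} (he : e ∈ atlas V N) {x : N}
    (hx : x ∈ e.source) : MDifferentiableAt 𝓘(ℝ, V) 𝓘(ℝ, V) e x :=
  (contMDiffAt_of_mem_atlas he hx).mdifferentiableAt (by simp)

theorem openPartialHomeomorph_mdifferentiable {e : OpenPartialHomeomorph N V} (he : e ∈ atlas V N) :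
    e.MDifferentiable 𝓘(ℝ, V) 𝓘(ℝ, V) :=
  have : IsManifold 𝓘(ℝ, V) 1 N := .of_le (n := ∞) (by simp)
  mdifferentiable_of_mem_atlas he

/-- Smoothness of a map into a manifold can be checked in any chart of the target. -/
theorem contMDiffAt_of_chart_comp {V' : Type*} [NormedAddCommGroup V'] [NormedSpace ℝ V']
    {H' : Type*} [TopologicalSpace H'] {I : ModelWithCorners ℝ V' H'} {X : Type*}
    [TopologicalSpace X] [ChartedSpace H' X] {e : OpenPartialHomeomorph N V} (he : e ∈ atlas V N)
    {f : X → N} {a : X} (hf : ∀ᶠ x in 𝓝 a, f x ∈ e.source)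
    (hef : ContMDiffAt I 𝓘(ℝ, V) ∞ (fun x => e (f x)) a) : ContMDiffAt I 𝓘(ℝ, V) ∞ f a := by
  have h1 := (contMDiffAt_symm_of_mem_atlas he (e.map_source hf.self_of_nhds)).comp a hef
  refine h1.congr_of_eventuallyEq ?_
  filter_upwards [hf] with x hx
  exact (e.left_inv hx).symm

/-- A tangent vector is stored as its expression in the preferred chart. `verticalJ1` and
`verticalImmJ1` read `ζ` directly as an element of the model space, and this justifies that reading.
-/
theorem mfderiv_chartAt_self (x : N) (ζ : TangentSpace 𝓘(ℝ, V) x) :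
    (mfderiv 𝓘(ℝ, V) 𝓘(ℝ, V) (chartAt V x) x ζ : V) = (show V from ζ) := by
  have h := mdifferentiableAt_of_mem_atlas (chart_mem_atlas V x) (mem_chart_source V x)
  rw [h.mfderiv]
  have h1 : writtenInExtChartAt 𝓘(ℝ, V) 𝓘(ℝ, V) x (chartAt V x) =ᶠ[
      𝓝 (extChartAt 𝓘(ℝ, V) x x)] id := by
    filter_upwards [extChartAt_target_mem_nhds (I := 𝓘(ℝ, V)) x] with z hz
    have hz' : z ∈ (chartAt V x).target := by simpa using hz
    simp [writtenInExtChartAt, (chartAt V x).right_inv hz', chartAt_self_eq]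
  rw [modelWithCornersSelf_coe, range_id, fderivWithin_univ, h1.fderiv_eq, fderiv_id]
  rfl

/-- The tangent space of the image `S` of an immersion `j` with a left inverse `r`. -/
theorem mem_tangentSpaceOf_iff_of_retraction {n : ℕ} {S : Set N} {j : Rn n → N} {r : N → Rn n}
    {a : Rn n} {x : N} (hja : j a = x) (hj : MDifferentiableAt 𝓘(ℝ, Rn n) 𝓘(ℝ, V) j a)
    (hr : MDifferentiableAt 𝓘(ℝ, V) 𝓘(ℝ, Rn n) r x) (hra : r x = a)
    (hjS : ∀ᶠ y in 𝓝 a, j y ∈ S) (hS : ∀ᶠ z in 𝓝[S] x, j (r z) = z)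
    {e : OpenPartialHomeomorph N V} (he : e ∈ atlas V N) (hx : x ∈ e.source)
    (ζ : TangentSpace 𝓘(ℝ, V) x) :
    ζ ∈ tangentSpaceOf (V := V) S x ↔
      ∃ ξ : Rn n, (mfderiv 𝓘(ℝ, V) 𝓘(ℝ, V) e x ζ : V) = fderiv ℝ (fun y => e (j y)) a ξ := by
  subst hja
  have hcomp : ∀ ξ : Rn n, fderiv ℝ (fun y => e (j y)) a ξ =
      mfderiv 𝓘(ℝ, V) 𝓘(ℝ, V) e (j a) (mfderiv 𝓘(ℝ, Rn n) 𝓘(ℝ, V) j a ξ) := by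
    intro ξ
    have h1 := mfderiv_comp a (mdifferentiableAt_of_mem_atlas he hx) hj
    rw [mfderiv_eq_fderiv] at h1
    exact DFunLike.congr_fun h1 ξ
  have hinj := (openPartialHomeomorph_mdifferentiable he).mfderiv_injective hx
  have hrange : tangentSpaceOf (V := V) S (j a) =
      LinearMap.range (mfderiv 𝓘(ℝ, Rn n) 𝓘(ℝ, V) j a).toLinearMap := by
    apply le_antisymm
    · refine Submodule.span_le.2 ?_
      rintro v ⟨γ, hγ0, hγS, hγd, hγv⟩
      -- A curve in `S` through `j a` is the image under `j` of the curve `r ∘ γ` of parameters, so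
      -- its velocity lies in the range of the derivative of `j`.
      have h1 : (j ∘ (r ∘ γ)) =ᶠ[𝓝 (0 : ℝ)] γ := by
        have h2 : Tendsto γ (𝓝 0) (𝓝[S] (j a)) := by
          rw [← hγ0]
          exact tendsto_nhdsWithin_iff.2 ⟨hγd.continuousAt, hγS⟩
        exact h2.eventually hS
      have h2 : MDifferentiableAt 𝓘(ℝ, ℝ) 𝓘(ℝ, Rn n) (r ∘ γ) 0 :=
        MDifferentiableAt.comp_of_eq (0 : ℝ) hr hγd hγ0
      have h3 : (r ∘ γ) 0 = a := by
        change r (γ 0) = a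
        rw [hγ0, hra]
      have h4 := mfderiv_comp_of_eq (x := (0 : ℝ)) hj h2 h3
      rw [h1.mfderiv_eq] at h4
      refine ⟨mfderiv 𝓘(ℝ, ℝ) 𝓘(ℝ, Rn n) (r ∘ γ) 0 (1 : ℝ), ?_⟩
      have h5 : ∀ (b : Rn n) (w : Rn n), b = a →
          (mfderiv 𝓘(ℝ, Rn n) 𝓘(ℝ, V) j b w : V) = mfderiv 𝓘(ℝ, Rn n) 𝓘(ℝ, V) j a w := by
        rintro _ w rfl
        rfl
      refine Eq.trans ?_ hγv
      rw [h4]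
      exact (h5 ((r ∘ γ) 0) _ h3).symm
    · rintro _ ⟨v, rfl⟩
      let w : Rn n := v
      have h0 : a + (0 : ℝ) • w = a := by simp
      have h1 : HasDerivAt (fun t : ℝ => a + t • w) w 0 := by
        simpa using ((hasDerivAt_id (0 : ℝ)).smul_const w).const_add a
      refine Submodule.subset_span ⟨fun t => j (a + t • w), congrArg j h0, ?_, ?_, ?_⟩
      · have h2 : Tendsto (fun t : ℝ => a + t • w) (𝓝 0) (𝓝 a) := by
          have := h1.continuousAt.tendsto
          simpa using this
        exact h2.eventually hjS
      · exact MDifferentiableAt.comp_of_eq (0 : ℝ) hj h1.differentiableAt.mdifferentiableAt h0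
      · have h2 := mfderiv_comp_of_eq (x := (0 : ℝ)) (I := 𝓘(ℝ, ℝ)) (f := fun t : ℝ => a + t • w)
          hj h1.differentiableAt.mdifferentiableAt h0
        change (mfderiv 𝓘(ℝ, ℝ) 𝓘(ℝ, V) (j ∘ fun t : ℝ => a + t • w) 0 (1 : ℝ) : V) = _
        rw [h2]
        have h3 : (mfderiv 𝓘(ℝ, ℝ) 𝓘(ℝ, Rn n) (fun t : ℝ => a + t • w) 0 (1 : ℝ) : Rn n)
            = w := by
          rw [mfderiv_eq_fderiv]
          exact h1.deriv
        have h4 : ∀ b : Rn n, b = a →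
            (mfderiv 𝓘(ℝ, Rn n) 𝓘(ℝ, V) j b w : V) = mfderiv 𝓘(ℝ, Rn n) 𝓘(ℝ, V) j a w := by
          rintro _ rfl
          rfl
        refine Eq.trans ?_ (h4 (a + (0 : ℝ) • w) h0)
        exact congrArg (fun z : Rn n =>
          (mfderiv 𝓘(ℝ, Rn n) 𝓘(ℝ, V) j (a + (0 : ℝ) • w) z : V)) h3
  rw [hrange]
  constructor
  · rintro ⟨ξ, rfl⟩
    exact ⟨ξ, (hcomp ξ).symm⟩
  · rintro ⟨ξ, hξ⟩
    exact ⟨ξ, (hinj (hξ.trans (hcomp ξ))).symm⟩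

end ManifoldCharts

/-! ### Charts of the jet manifolds -/

section JetCharts

variable {n m : ℕ} {M E : Type*} [TopologicalSpace M] [ChartedSpace (Rn n) M]
  [TopologicalSpace E] [ChartedSpace (Rn (n + m)) E]
  [IsManifold 𝓘(ℝ, Rn (n + m)) ∞ E]

/-- The chart of `J¹(E,n)` induced by a divided chart. -/
def J1.openChart (c : DividedChart n m E) : OpenPartialHomeomorph (J1 n m E) (J1Model n m) :=
  (J1.core n m E).openPartialHomeomorph (J1.chart c) ⟨c, rfl⟩

theorem J1.openChart_mem_atlas (c : DividedChart n m E) :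
    J1.openChart c ∈ atlas (J1Model n m) (J1 n m E) :=
  mem_iUnion.2 ⟨J1.chart c, mem_iUnion.2 ⟨⟨c, rfl⟩, rfl⟩⟩

theorem J1.mem_dividedChartAt_source (θ : J1 n m E) :
    θ ∈ (J1.openChart θ.dividedChartAt).source := mem_chart_source (J1Model n m) θ

theorem J1.contMDiff_pt :
    ContMDiff 𝓘(ℝ, J1Model n m) 𝓘(ℝ, Rn (n + m)) ∞ (J1.pt : J1 n m E → E) := by
  intro θ
  have hθ := θ.mem_dividedChartAt_source
  refine contMDiffAt_of_chart_comp θ.dividedChartAt.1.2 ?_ ?_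
  · filter_upwards [(J1.openChart θ.dividedChartAt).open_source.mem_nhds hθ] with η hη
    exact hη.1
  · exact ContMDiffAt.comp (I' := 𝓘(ℝ, J1Model n m)) θ
      (g := fun z : J1Model n m => z.1) (f := J1.openChart θ.dividedChartAt)
      contDiff_fst.contMDiff.contMDiffAt
      (contMDiffAt_of_mem_atlas (J1.openChart_mem_atlas _) hθ)

theorem J1.tangentCoord_mfderiv_pt (c : DividedChart n m E) {θ : J1 n m E}
    (hθ : θ ∈ (J1.openChart c).source) (ζ : TangentSpace 𝓘(ℝ, J1Model n m) θ) :
    tangentCoord c.1 θ.pt (mfderiv 𝓘(ℝ, J1Model n m) 𝓘(ℝ, Rn (n + m)) J1.pt θ ζ) =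
      (show J1Model n m from
        mfderiv 𝓘(ℝ, J1Model n m) 𝓘(ℝ, J1Model n m) (J1.openChart c) θ ζ).1 := by
  rw [← mfderiv_chart_comp c.1 ((J1.contMDiff_pt θ).mdifferentiableAt (by simp)) hθ.1 ζ]
  have h1 : c.1.1 ∘ J1.pt = (ContinuousLinearMap.fst ℝ (Rn (n + m)) (Rn n →L[ℝ] Rn m)) ∘
      J1.openChart c := rfl
  rw [h1, mfderiv_comp θ (ContinuousLinearMap.mdifferentiableAt _)
    (mdifferentiableAt_of_mem_atlas (J1.openChart_mem_atlas c) hθ),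
    ContinuousLinearMap.mfderiv_eq]
  rfl

variable [IsManifold 𝓘(ℝ, Rn n) ∞ M]

/-- The chart of `Imm J¹ pr_M` induced by charts of `M` and `E`. -/
def ImmJ1.openChart (i : atlas (Rn n) M) (j : atlas (Rn (n + m)) E) :
    OpenPartialHomeomorph (ImmJ1 n m M E) (ImmJ1Model n m) :=
  (ImmJ1.core n m M E).openPartialHomeomorph (ImmJ1.chart i j) ⟨(i, j), rfl⟩

theorem ImmJ1.openChart_mem_atlas (i : atlas (Rn n) M) (j : atlas (Rn (n + m)) E) :
    ImmJ1.openChart i j ∈ atlas (ImmJ1Model n m) (ImmJ1 n m M E) :=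
  mem_iUnion.2 ⟨ImmJ1.chart i j, mem_iUnion.2 ⟨⟨(i, j), rfl⟩, rfl⟩⟩

theorem ImmJ1.contMDiff_pt :
    ContMDiff 𝓘(ℝ, ImmJ1Model n m) 𝓘(ℝ, Rn n) ∞ (ImmJ1.pt : ImmJ1 n m M E → M) := by
  intro θ
  have hθ := mem_chart_source (ImmJ1Model n m) θ
  refine contMDiffAt_of_chart_comp (chart_mem_atlas _ θ.pt) ?_ ?_
  · filter_upwards [(chartAt (ImmJ1Model n m) θ).open_source.mem_nhds hθ] with η hη
    exact hη.1
  · exact ContMDiffAt.comp (I' := 𝓘(ℝ, ImmJ1Model n m)) θ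
      (g := fun z : ImmJ1Model n m => z.1.1) (f := chartAt (ImmJ1Model n m) θ)
      (contDiff_fst.comp contDiff_fst).contMDiff.contMDiffAt
      (contMDiffAt_of_mem_atlas (chart_mem_atlas _ θ) hθ)

theorem ImmJ1.contMDiff_val :
    ContMDiff 𝓘(ℝ, ImmJ1Model n m) 𝓘(ℝ, Rn (n + m)) ∞ (ImmJ1.val : ImmJ1 n m M E → E) := by
  intro θ
  have hθ := mem_chart_source (ImmJ1Model n m) θ
  refine contMDiffAt_of_chart_comp (chart_mem_atlas _ θ.val) ?_ ?_
  · filter_upwards [(chartAt (ImmJ1Model n m) θ).open_source.mem_nhds hθ] with η hη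
    exact hη.2
  · exact ContMDiffAt.comp (I' := 𝓘(ℝ, ImmJ1Model n m)) θ
      (g := fun z : ImmJ1Model n m => z.1.2) (f := chartAt (ImmJ1Model n m) θ)
      (contDiff_snd.comp contDiff_fst).contMDiff.contMDiffAt
      (contMDiffAt_of_mem_atlas (chart_mem_atlas _ θ) hθ)

theorem ImmJ1.tangentCoord_mfderiv_pt (i : atlas (Rn n) M) (j : atlas (Rn (n + m)) E)
    {θ : ImmJ1 n m M E} (hθ : θ ∈ (ImmJ1.openChart i j).source)
    (ζ : TangentSpace 𝓘(ℝ, ImmJ1Model n m) θ) :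
    tangentCoord i θ.pt (mfderiv 𝓘(ℝ, ImmJ1Model n m) 𝓘(ℝ, Rn n) ImmJ1.pt θ ζ) =
      (show ImmJ1Model n m from
        mfderiv 𝓘(ℝ, ImmJ1Model n m) 𝓘(ℝ, ImmJ1Model n m) (ImmJ1.openChart i j) θ ζ).1.1 := by
  rw [← mfderiv_chart_comp i ((ImmJ1.contMDiff_pt θ).mdifferentiableAt (by simp)) hθ.1 ζ]
  have h1 : i.1 ∘ ImmJ1.pt = ((ContinuousLinearMap.fst ℝ (Rn n) (Rn (n + m))).comp
      (ContinuousLinearMap.fst ℝ (Rn n × Rn (n + m)) (Rn n →L[ℝ] Rn (n + m)))) ∘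
      ImmJ1.openChart i j := rfl
  rw [h1, mfderiv_comp θ (ContinuousLinearMap.mdifferentiableAt _)
    (mdifferentiableAt_of_mem_atlas (ImmJ1.openChart_mem_atlas i j) hθ),
    ContinuousLinearMap.mfderiv_eq]
  rfl

theorem ImmJ1.tangentCoord_mfderiv_val (i : atlas (Rn n) M) (j : atlas (Rn (n + m)) E)
    {θ : ImmJ1 n m M E} (hθ : θ ∈ (ImmJ1.openChart i j).source)
    (ζ : TangentSpace 𝓘(ℝ, ImmJ1Model n m) θ) :
    tangentCoord j θ.val (mfderiv 𝓘(ℝ, ImmJ1Model n m) 𝓘(ℝ, Rn (n + m)) ImmJ1.val θ ζ) =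
      (show ImmJ1Model n m from
        mfderiv 𝓘(ℝ, ImmJ1Model n m) 𝓘(ℝ, ImmJ1Model n m) (ImmJ1.openChart i j) θ ζ).1.2 := by
  rw [← mfderiv_chart_comp j ((ImmJ1.contMDiff_val θ).mdifferentiableAt (by simp)) hθ.2 ζ]
  have h1 : j.1 ∘ ImmJ1.val = ((ContinuousLinearMap.snd ℝ (Rn n) (Rn (n + m))).comp
      (ContinuousLinearMap.fst ℝ (Rn n × Rn (n + m)) (Rn n →L[ℝ] Rn (n + m)))) ∘
      ImmJ1.openChart i j := rfl
  rw [h1, mfderiv_comp θ (ContinuousLinearMap.mdifferentiableAt _)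
    (mdifferentiableAt_of_mem_atlas (ImmJ1.openChart_mem_atlas i j) hθ),
    ContinuousLinearMap.mfderiv_eq]
  rfl

/-! ### The projection `pr_E⁽¹⁾` in coordinates -/

/-- The component of a linear map into `ℝⁿ⁺ᵐ` along the base of the splitting `A`. -/
def baseBlock (A : Rn (n + m) ≃L[ℝ] (Rn n × Rn m)) (B : Rn n →L[ℝ] Rn (n + m)) :
    Rn n →L[ℝ] Rn n :=
  ((ContinuousLinearMap.fst ℝ (Rn n) (Rn m)).comp (A : Rn (n + m) →L[ℝ] Rn n × Rn m)).comp B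

/-- The component of a linear map into `ℝⁿ⁺ᵐ` along the fibre of the splitting `A`. -/
def fibreBlock (A : Rn (n + m) ≃L[ℝ] (Rn n × Rn m)) (B : Rn n →L[ℝ] Rn (n + m)) :
    Rn n →L[ℝ] Rn m :=
  ((ContinuousLinearMap.snd ℝ (Rn n) (Rn m)).comp (A : Rn (n + m) →L[ℝ] Rn n × Rn m)).comp B

theorem isUnit_of_injective {D : Rn n →L[ℝ] Rn n} (hD : Function.Injective D) : IsUnit D := by
  obtain ⟨e, he⟩ := exists_continuousLinearEquiv_of_injective hD
  exact ⟨ContinuousLinearEquiv.toUnit e, he⟩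

/-- In the splitting, the plane is the range of `x ↦ (base x, fibre x)`. This is the graph of `l`
exactly when `x` can be recovered from `base x` and `fibre = l ∘ base`. -/
theorem isGraphOf_prE1_iff (c : DividedChart n m E) (i : atlas (Rn n) M) (θ : ImmJ1 n m M E)
    (l : Rn n →L[ℝ] Rn m) :
    IsGraphOf c (prE1 θ) l ↔ IsUnit (baseBlock c.2 (θ.coord i c.1)) ∧
      l.comp (baseBlock c.2 (θ.coord i c.1)) = fibreBlock c.2 (θ.coord i c.1) := by
  set B := θ.coord i c.1 with hB
  have hBapp : ∀ v, B (tangentCoord i θ.pt v) = tangentCoord c.1 θ.val (θ.lin v) := fun v => by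
    change tangentCoord c.1 θ.val (θ.lin ((tangentCoord i θ.pt).symm (tangentCoord i θ.pt v))) = _
    rw [ContinuousLinearEquiv.symm_apply_apply]
  have hinj : Function.Injective B := θ.coord_injective i c.1
  have hmap : (prE1 θ).plane.map
      (dividedCoord c (prE1 θ).pt : Tan (n + m) (prE1 θ).pt →ₗ[ℝ] (Rn n × Rn m)) =
      LinearMap.range (((c.2 : Rn (n + m) →L[ℝ] Rn n × Rn m).comp B : Rn n →L[ℝ] Rn n × Rn m) :
        Rn n →ₗ[ℝ] Rn n × Rn m) := by
    ext z
    constructor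
    · rintro ⟨_, ⟨v, rfl⟩, rfl⟩
      exact ⟨tangentCoord i θ.pt v, congrArg c.2 (hBapp v)⟩
    · rintro ⟨x, rfl⟩
      refine ⟨_, ⟨(tangentCoord i θ.pt).symm x, rfl⟩, ?_⟩
      refine (congrArg c.2 (hBapp ((tangentCoord i θ.pt).symm x))).symm.trans ?_
      rw [ContinuousLinearEquiv.apply_symm_apply]
      rfl
  unfold IsGraphOf
  constructor
  · intro h
    have h1 := hmap.symm.trans h
    have h2 : ∀ x, fibreBlock c.2 B x = l (baseBlock c.2 B x) := by
      intro x
      have : c.2 (B x) ∈ LinearMap.graph (l : Rn n →ₗ[ℝ] Rn m) := by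
        rw [← h1]
        exact ⟨x, rfl⟩
      exact this
    refine ⟨isUnit_of_injective ?_, by ext1 x; exact (h2 x).symm⟩
    rw [injective_iff_map_eq_zero]
    intro x hx
    -- On a graph the fibre block is determined by the base block, so a vector in the kernel of the
    -- base block is in the kernel of the injective `B`.
    have h3 : c.2 (B x) = 0 := by
      apply Prod.ext
      · exact hx
      · refine (h2 x).trans ?_
        rw [hx, map_zero]
        rfl
    exact hinj ((c.2.map_eq_zero_iff.1 h3).trans (map_zero B).symm)
  · rintro ⟨hu, hl⟩
    refine hmap.trans ?_
    have h3 : ∀ x, baseBlock c.2 B (Ring.inverse (baseBlock c.2 B) x) = x := fun x =>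
      congrArg (fun f : Rn n →L[ℝ] Rn n => f x) (Ring.mul_inverse_cancel _ hu)
    have h4 : ∀ x, l (baseBlock c.2 B x) = fibreBlock c.2 B x := fun x => DFunLike.congr_fun hl x
    ext ⟨x, y⟩
    constructor
    · rintro ⟨u, hu'⟩
      have hx : baseBlock c.2 B u = x := congrArg Prod.fst hu'
      have hy : fibreBlock c.2 B u = y := congrArg Prod.snd hu'
      change y = l x
      rw [← hx, ← hy, h4]
    · intro h
      have hy : y = l x := h
      refine ⟨Ring.inverse (baseBlock c.2 B) x, Prod.ext (h3 x) ?_⟩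
      refine (h4 (Ring.inverse (baseBlock c.2 B) x)).symm.trans ?_
      change l _ = y
      rw [h3, hy]

/-- In charts the new slope is the fibre block composed with the inverse of the base block. The base
block stays invertible near `θ`, and inversion is smooth there. -/
theorem contMDiff_prE1 : ContMDiff 𝓘(ℝ, ImmJ1Model n m) 𝓘(ℝ, J1Model n m) ∞
    (prE1 : ImmJ1 n m M E → J1 n m E) := by
  intro θ
  set c := (prE1 θ).dividedChartAt with hc
  set i := achart (Rn n) θ.pt with hi
  have hθ : θ ∈ (ImmJ1.openChart i c.1).source := mem_chart_source (ImmJ1Model n m) θ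
  obtain ⟨-, l, hl⟩ := (prE1 θ).mem_dividedChartAt_source
  have hu := ((isGraphOf_prE1_iff c i θ l).1 hl).1
  have hA : ContDiff ℝ ∞ (fun z : ImmJ1Model n m => baseBlock c.2 z.2) :=
    contDiff_const.clm_comp contDiff_snd
  have hB : ContDiff ℝ ∞ (fun z : ImmJ1Model n m => fibreBlock c.2 z.2) :=
    contDiff_const.clm_comp contDiff_snd
  have hchart := contMDiffAt_of_mem_atlas (ImmJ1.openChart_mem_atlas i c.1) hθ
  have hev : ∀ᶠ η in 𝓝 θ, η ∈ (ImmJ1.openChart i c.1).source ∧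
      IsUnit (baseBlock c.2 (η.coord i c.1)) := by
    have h1 : ContinuousAt (fun η : ImmJ1 n m M E =>
        baseBlock c.2 (ImmJ1.openChart i c.1 η).2) θ :=
      hA.continuous.continuousAt.comp hchart.continuousAt
    filter_upwards [(ImmJ1.openChart i c.1).open_source.mem_nhds hθ,
      h1 (Units.isOpen.mem_nhds hu)] with η h2 h3
    exact ⟨h2, h3⟩
  have hgraph : ∀ η : ImmJ1 n m M E, IsUnit (baseBlock c.2 (η.coord i c.1)) →
      IsGraphOf c (prE1 η) ((fibreBlock c.2 (η.coord i c.1)).comp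
        (Ring.inverse (baseBlock c.2 (η.coord i c.1)))) := by
    intro η hη
    refine (isGraphOf_prE1_iff c i η _).2 ⟨hη, ?_⟩
    have : (Ring.inverse (baseBlock c.2 (η.coord i c.1))).comp
        (baseBlock c.2 (η.coord i c.1)) = 1 := Ring.inverse_mul_cancel _ hη
    rw [ContinuousLinearMap.comp_assoc, this]
    rfl
  refine contMDiffAt_of_chart_comp (J1.openChart_mem_atlas c) ?_ ?_
  · filter_upwards [hev] with η hη
    exact ⟨hη.1.2, _, hgraph η hη.2⟩
  · let F : ImmJ1Model n m → J1Model n m := fun z =>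
      (z.1.2, (fibreBlock c.2 z.2).comp (Ring.inverse (baseBlock c.2 z.2)))
    have hF : ContDiffAt ℝ ∞ F (ImmJ1.openChart i c.1 θ) := by
      refine (contDiff_snd.comp contDiff_fst).contDiffAt.prodMk (hB.contDiffAt.clm_comp ?_)
      obtain ⟨w, hw⟩ := hu
      have h1 : ContDiffAt ℝ ∞ (Ring.inverse : (Rn n →L[ℝ] Rn n) → _)
          (baseBlock c.2 (ImmJ1.openChart i c.1 θ).2) := by
        have h2 := contDiffAt_ringInverse ℝ (n := ∞) w
        rwa [hw] at h2
      exact ContDiffAt.comp (x := ImmJ1.openChart i c.1 θ) (g := Ring.inverse)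
        (f := fun z : ImmJ1Model n m => baseBlock c.2 z.2) h1 hA.contDiffAt
    have h1 := hF.contMDiffAt.comp θ hchart
    refine h1.congr_of_eventuallyEq ?_
    filter_upwards [hev] with η hη
    exact Prod.ext rfl (J1.slope_eq (hgraph η hη.2))

end JetCharts

/-! ### The prolongation `j₁f` of a germ of immersions and its tangent space -/

section ProlongedGerms

variable {n m : ℕ} {M E : Type*} [TopologicalSpace M] [ChartedSpace (Rn n) M]
  [TopologicalSpace E] [ChartedSpace (Rn (n + m)) E]

open Classical in
/-- The first jet of `f` at `y`; the value at points where `f` is not an immersion is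
irrelevant. -/
def ImmersionGerm.jetAt (f : ImmersionGerm n m M E) (y : M) : ImmJ1 n m M E :=
  if h : Function.Injective (mfderiv 𝓘(ℝ, Rn n) 𝓘(ℝ, Rn (n + m)) f.toFun y) then
    ⟨y, f.toFun y, mfderiv 𝓘(ℝ, Rn n) 𝓘(ℝ, Rn (n + m)) f.toFun y, h⟩
  else f.jet1

theorem ImmersionGerm.jetAt_eq (f : ImmersionGerm n m M E) {y : M}
    (h : Function.Injective (mfderiv 𝓘(ℝ, Rn n) 𝓘(ℝ, Rn (n + m)) f.toFun y)) :
    f.jetAt y = ⟨y, f.toFun y, mfderiv 𝓘(ℝ, Rn n) 𝓘(ℝ, Rn (n + m)) f.toFun y, h⟩ :=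
  dif_pos h

theorem ImmersionGerm.jetAt_pt (f : ImmersionGerm n m M E) : f.jetAt f.pt = f.jet1 :=
  f.jetAt_eq f.immersion.self_of_nhds.2

variable [IsManifold 𝓘(ℝ, Rn n) ∞ M] [IsManifold 𝓘(ℝ, Rn (n + m)) ∞ E]

theorem ImmersionGerm.openChart_jetAt (f : ImmersionGerm n m M E) {φ : atlas (Rn n) M}
    {j : atlas (Rn (n + m)) E} {y : M} (hy : y ∈ φ.1.source)
    (hf : ContMDiffAt 𝓘(ℝ, Rn n) 𝓘(ℝ, Rn (n + m)) ∞ f.toFun y) (hj : f.toFun y ∈ j.1.source)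
    (h : Function.Injective (mfderiv 𝓘(ℝ, Rn n) 𝓘(ℝ, Rn (n + m)) f.toFun y)) :
    f.jetAt y ∈ (ImmJ1.openChart φ j).source ∧ ImmJ1.openChart φ j (f.jetAt y) =
      ((φ.1 y, j.1 (f.toFun y)), fderiv ℝ (j.1 ∘ f.param φ) (φ.1 y)) := by
  rw [f.jetAt_eq h]
  refine ⟨⟨hy, hj⟩, Prod.ext rfl ?_⟩
  refine ContinuousLinearMap.ext fun v => ?_
  refine (f.tangentCoord_mfderiv j hy hf hj ((tangentCoord φ y).symm v)).trans ?_
  rw [ContinuousLinearEquiv.apply_symm_apply]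

theorem ImmersionGerm.eventually_openChart_jetAt (f : ImmersionGerm n m M E) {φ : atlas (Rn n) M}
    (hφ : f.pt ∈ φ.1.source) {j : atlas (Rn (n + m)) E} (hj : f.toFun f.pt ∈ j.1.source) :
    ∀ᶠ x in 𝓝 (φ.1 f.pt), f.jetAt (φ.1.symm x) ∈ (ImmJ1.openChart φ j).source ∧
      ImmJ1.openChart φ j (f.jetAt (φ.1.symm x)) =
        ((x, (j.1 ∘ f.param φ) x), fderiv ℝ (j.1 ∘ f.param φ) x) := by
  have h1 : ∀ᶠ y in 𝓝 f.pt, f.toFun y ∈ j.1.source :=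
    f.immersion.self_of_nhds.1.continuousAt (j.1.open_source.mem_nhds hj)
  filter_upwards [f.eventually_param hφ (f.immersion.and h1)] with x hx
  obtain ⟨hxt, ⟨hx1, hx2⟩, hx3⟩ := hx
  have h2 := f.openChart_jetAt (φ.1.map_target hxt) hx1 hx3 hx2
  rw [φ.1.right_inv hxt] at h2
  exact h2

theorem ImmersionGerm.contMDiffAt_jetAt (f : ImmersionGerm n m M E) {φ : atlas (Rn n) M}
    (hφ : f.pt ∈ φ.1.source) :
    ContMDiffAt 𝓘(ℝ, Rn n) 𝓘(ℝ, ImmJ1Model n m) ∞ (fun x => f.jetAt (φ.1.symm x))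
      (φ.1 f.pt) := by
  set j := achart (Rn (n + m)) (f.toFun f.pt) with hj
  have hev := f.eventually_openChart_jetAt hφ (j := j) (mem_chart_source _ _)
  refine contMDiffAt_of_chart_comp (ImmJ1.openChart_mem_atlas φ j) (hev.mono fun x hx => hx.1) ?_
  have h1 : ContDiffAt ℝ ∞ (j.1 ∘ f.param φ) (φ.1 f.pt) := by
    refine contDiffAt_chart_comp j (f.eventually_contMDiffAt_param hφ).self_of_nhds ?_
    rw [f.param_chart hφ]
    exact mem_chart_source _ _
  have h2 : ContDiffAt ℝ ∞ (fun x => (((x, (j.1 ∘ f.param φ) x), fderiv ℝ (j.1 ∘ f.param φ) x) :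
      ImmJ1Model n m)) (φ.1 f.pt) :=
    (contDiffAt_id.prodMk h1).prodMk (h1.fderiv_right (m := ∞) (by simp))
  refine h2.contMDiffAt.congr_of_eventuallyEq ?_
  filter_upwards [hev] with x hx using hx.2

/-- The tangent space of `j₁f` in coordinates. -/
theorem ImmersionGerm.mem_tangentSpaceOf_prolong_iff (f : ImmersionGerm n m M E)
    {φ : atlas (Rn n) M} (hφ : f.pt ∈ φ.1.source) {j : atlas (Rn (n + m)) E}
    (hj : f.toFun f.pt ∈ j.1.source) (ζ : TangentSpace 𝓘(ℝ, ImmJ1Model n m) f.jet1) :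
    ζ ∈ tangentSpaceOf (V := ImmJ1Model n m) f.prolong f.jet1 ↔
      ∃ ξ : Rn n, (mfderiv 𝓘(ℝ, ImmJ1Model n m) 𝓘(ℝ, ImmJ1Model n m) (ImmJ1.openChart φ j)
          f.jet1 ζ : ImmJ1Model n m) =
        ((ξ, fderiv ℝ (j.1 ∘ f.param φ) (φ.1 f.pt) ξ),
          fderiv ℝ (fderiv ℝ (j.1 ∘ f.param φ)) (φ.1 f.pt) ξ) := by
  have hsymm : φ.1.symm (φ.1 f.pt) = f.pt := φ.1.left_inv hφ
  have hja : f.jetAt (φ.1.symm (φ.1 f.pt)) = f.jet1 := by rw [hsymm, f.jetAt_pt]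
  -- The source map read in `φ` serves as retraction, because a point of `f.prolong` is determined
  -- by its source.
  have hr : ContMDiffAt 𝓘(ℝ, ImmJ1Model n m) 𝓘(ℝ, Rn n) ∞ (fun θ : ImmJ1 n m M E => φ.1 θ.pt)
      f.jet1 := (contMDiffAt_chart φ hφ).comp f.jet1 (ImmJ1.contMDiff_pt f.jet1)
  have hev := f.eventually_openChart_jetAt hφ hj
  have hjS : ∀ᶠ x in 𝓝 (φ.1 f.pt), f.jetAt (φ.1.symm x) ∈ f.prolong := by
    filter_upwards [f.eventually_param hφ f.immersion] with x hx
    exact ⟨_, hx.2.2, f.jetAt_eq hx.2.2⟩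
  have hS : ∀ᶠ z in 𝓝[f.prolong] f.jet1, f.jetAt (φ.1.symm (φ.1 z.pt)) = z := by
    have h1 : ∀ᶠ z : ImmJ1 n m M E in 𝓝 f.jet1, z.pt ∈ φ.1.source :=
      (ImmJ1.contMDiff_pt f.jet1).continuousAt (φ.1.open_source.mem_nhds hφ)
    filter_upwards [nhdsWithin_le_nhds h1, self_mem_nhdsWithin] with z hz hzf
    obtain ⟨y, hy, rfl⟩ := hzf
    rw [φ.1.left_inv hz]
    exact f.jetAt_eq hy
  rw [mem_tangentSpaceOf_iff_of_retraction hja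
    ((f.contMDiffAt_jetAt hφ).mdifferentiableAt (by simp)) (hr.mdifferentiableAt (by simp)) rfl
    hjS hS (ImmJ1.openChart_mem_atlas φ j) ⟨hφ, hj⟩]
  have hσ : ContDiffAt ℝ ∞ (j.1 ∘ f.param φ) (φ.1 f.pt) := by
    refine contDiffAt_chart_comp j (f.eventually_contMDiffAt_param hφ).self_of_nhds ?_
    rwa [f.param_chart hφ]
  have hfd : HasFDerivAt (fun x => ImmJ1.openChart φ j (f.jetAt (φ.1.symm x)))
      (((ContinuousLinearMap.id ℝ (Rn n)).prod (fderiv ℝ (j.1 ∘ f.param φ) (φ.1 f.pt))).prod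
        (fderiv ℝ (fderiv ℝ (j.1 ∘ f.param φ)) (φ.1 f.pt))) (φ.1 f.pt) := by
    refine HasFDerivAt.congr_of_eventuallyEq
      (((hasFDerivAt_id _).prodMk (hσ.differentiableAt (by simp)).hasFDerivAt).prodMk
        (hasFDerivAt_fderiv hσ)) ?_
    filter_upwards [hev] with x hx using hx.2
  rw [hfd.fderiv]
  rfl

end ProlongedGerms

/-! ### The prolongation `L⁽¹⁾` of a submanifold and its tangent space -/

section ProlongedSubmanifolds

variable {n m : ℕ} {E : Type*} [TopologicalSpace E] [ChartedSpace (Rn (n + m)) E]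
  {s : Rn n → E} {a : Rn n}

/-- The canonical chart of `ℝⁿ`. -/
def modelChart (n : ℕ) : atlas (Rn n) (Rn n) := ⟨OpenPartialHomeomorph.refl _, rfl⟩

/-- A local parametrization is an immersion of the manifold `M = ℝⁿ`. The coordinate description of
`prE1` and the results on germs thereby apply to submanifolds. -/
theorem IsLocalParam.jet1_eq {L : Set E} (hL : IsEmbeddedSubmanifold n m L)
    (h : IsLocalParam (m := m) L s a) {q : E} (hq : q ∈ L) (hsq : s a = q) :
    jet1 hL hq = prE1 (⟨a, s a, mfderiv 𝓘(ℝ, Rn n) 𝓘(ℝ, Rn (n + m)) s a, h.injective⟩ :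
      ImmJ1 n m (Rn n) E) := by
  subst hsq
  unfold jet1 prE1
  congr 1
  exact tangentSpaceOf_eq_range h

variable [IsManifold 𝓘(ℝ, Rn (n + m)) ∞ E]

/-- A local parametrization as a germ of immersions. -/
def IsLocalParam.germ {L : Set E} (h : IsLocalParam (m := m) L s a) :
    ImmersionGerm n m (Rn n) E :=
  ⟨s, a, h.smooth.and (eventually_injective_mfderiv h.smooth h.injective)⟩

theorem IsLocalParam.prE1_germ {P : PointedSubmanifold n m E}
    (h : IsLocalParam (m := m) P.carrier s a) (hsa : s a = P.pt) :
    jet1 P.isEmbedded P.mem = prE1 h.germ.jet1 :=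
  h.jet1_eq P.isEmbedded P.mem hsa

/-- The functional on `ℝⁿ⁺ᵐ` whose kernel is the graph of `u` in the splitting `A`. -/
def slopeProj (A : Rn (n + m) ≃L[ℝ] (Rn n × Rn m)) (u : Rn n →L[ℝ] Rn m) :
    Rn (n + m) →L[ℝ] Rn m :=
  (ContinuousLinearMap.snd ℝ (Rn n) (Rn m) -
    u.comp (ContinuousLinearMap.fst ℝ (Rn n) (Rn m))).comp (A : Rn (n + m) →L[ℝ] Rn n × Rn m)

theorem slopeProj_apply (A : Rn (n + m) ≃L[ℝ] (Rn n × Rn m)) (u : Rn n →L[ℝ] Rn m)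
    (z : Rn (n + m)) : slopeProj A u z = (A z).2 - u (A z).1 := rfl

/-- Under these hypotheses the range of `D` is the graph of `u` in the splitting `A`. Tangency thus
becomes a linear equation, whose left side is also the operation that appears in `Γ̇`. -/
theorem slopeProj_eq_zero_iff {A : Rn (n + m) ≃L[ℝ] (Rn n × Rn m)} {u : Rn n →L[ℝ] Rn m}
    {D : Rn n →L[ℝ] Rn (n + m)} (hu : IsUnit (baseBlock A D))
    (hD : u.comp (baseBlock A D) = fibreBlock A D) (z : Rn (n + m)) :
    slopeProj A u z = 0 ↔ z ∈ range D := by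
  have h1 : ∀ x, u (A (D x)).1 = (A (D x)).2 := fun x => DFunLike.congr_fun hD x
  constructor
  · intro hz
    have h2 : (A (D (Ring.inverse (baseBlock A D) (A z).1))).1 = (A z).1 :=
      congrArg (fun f : Rn n →L[ℝ] Rn n => f (A z).1) (Ring.mul_inverse_cancel _ hu)
    refine ⟨Ring.inverse (baseBlock A D) (A z).1, A.injective (Prod.ext h2 ?_)⟩
    refine (h1 _).symm.trans ?_
    rw [h2]
    exact (sub_eq_zero.1 hz).symm
  · rintro ⟨x, rfl⟩
    exact sub_eq_zero.2 (h1 x).symm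

/-- The tangent plane of a parametrized submanifold in a divided chart. -/
theorem IsLocalParam.isGraphOf_iff {P : PointedSubmanifold n m E}
    (h : IsLocalParam (m := m) P.carrier s a) (hsa : s a = P.pt) {c : DividedChart n m E}
    (hc : P.pt ∈ c.1.1.source) (l : Rn n →L[ℝ] Rn m) :
    IsGraphOf c (jet1 P.isEmbedded P.mem) l ↔
      IsUnit (baseBlock c.2 (fderiv ℝ (c.1.1 ∘ s) a)) ∧
        l.comp (baseBlock c.2 (fderiv ℝ (c.1.1 ∘ s) a)) =
          fibreBlock c.2 (fderiv ℝ (c.1.1 ∘ s) a) := by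
  have h1 := (h.germ.openChart_jetAt (φ := modelChart n) (j := c.1) (y := a) (mem_univ _)
    h.smooth.self_of_nhds (by rw [← hsa] at hc; exact hc) h.injective).2
  have h2 : h.germ.jet1.coord (modelChart n) c.1 = fderiv ℝ (c.1.1 ∘ s) a :=
    (congrArg (fun θ : ImmJ1 n m (Rn n) E => (ImmJ1.openChart (modelChart n) c.1 θ).2)
      h.germ.jetAt_pt).symm.trans (congrArg Prod.snd h1)
  rw [h.prE1_germ hsa, isGraphOf_prE1_iff c (modelChart n), h2]

/-- The tangent space of `L⁽¹⁾` in a divided chart. -/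
theorem IsLocalParam.mem_tangentSpaceOf_prolong_iff {P : PointedSubmanifold n m E}
    (h : IsLocalParam (m := m) P.carrier s a) (hsa : s a = P.pt) {c : DividedChart n m E}
    (hc : jet1 P.isEmbedded P.mem ∈ (J1.openChart c).source)
    (ζ : TangentSpace 𝓘(ℝ, J1Model n m) (jet1 P.isEmbedded P.mem)) :
    ζ ∈ tangentSpaceOf (V := J1Model n m) P.prolong (jet1 P.isEmbedded P.mem) ↔
      ∃ ξ : Rn n, (show J1Model n m from mfderiv 𝓘(ℝ, J1Model n m) 𝓘(ℝ, J1Model n m)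
          (J1.openChart c) _ ζ).1 = fderiv ℝ (c.1.1 ∘ s) a ξ ∧
        ∀ η, (show J1Model n m from mfderiv 𝓘(ℝ, J1Model n m) 𝓘(ℝ, J1Model n m)
          (J1.openChart c) _ ζ).2 (baseBlock c.2 (fderiv ℝ (c.1.1 ∘ s) a) η) =
            slopeProj c.2 (J1.slope c (jet1 P.isEmbedded P.mem))
              (fderiv ℝ (fderiv ℝ (c.1.1 ∘ s)) a ξ η) := by
  set θ := jet1 P.isEmbedded P.mem with hθ
  set σ := c.1.1 ∘ s with hσ
  obtain ⟨r, hr, hrs⟩ := exists_smooth_retraction h.smooth h.injective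
  have hsr := h.eventually_rightInverse hr
  have hra : r P.pt = a := by rw [← hsa]; exact hr.self_of_nhds
  have hsc : s a ∈ c.1.1.source := by rw [hsa]; exact hc.1
  -- The parametrization of `L⁽¹⁾` by tangent planes. Its retraction is `r ∘ pt`, since a point of
  -- `L⁽¹⁾` is determined by its base point.
  set J : Rn n → J1 n m E := fun x => prE1 (h.germ.jetAt x) with hJ
  have hJa : J a = θ := by
    rw [hθ, h.prE1_germ hsa, hJ]
    exact congrArg prE1 h.germ.jetAt_pt
  have hJs : ContMDiffAt 𝓘(ℝ, Rn n) 𝓘(ℝ, J1Model n m) ∞ J a :=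
    (contMDiff_prE1 _).comp a (h.germ.contMDiffAt_jetAt (φ := modelChart n) (mem_univ _))
  have hjet : ∀ x (hx : IsLocalParam (m := m) P.carrier s x) (hq : s x ∈ P.carrier),
      J x = jet1 P.isEmbedded hq := by
    intro x hx hq
    rw [hx.jet1_eq P.isEmbedded hq rfl]
    exact congrArg prE1 (h.germ.jetAt_eq hx.injective)
  have hjS : ∀ᶠ x in 𝓝 a, J x ∈ P.prolong := by
    filter_upwards [h.eventually, h.eventually_mem] with x hx hxL
    exact ⟨s x, hxL, hjet x hx hxL⟩
  have hrc : ContMDiffAt 𝓘(ℝ, Rn (n + m)) 𝓘(ℝ, Rn n) ∞ r P.pt := by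
    rw [← hsa]
    exact hrs.self_of_nhds
  have hS : ∀ᶠ z in 𝓝[P.prolong] θ, J (r z.pt) = z := by
    have h1 : Tendsto (J1.pt : J1 n m E → E) (𝓝[P.prolong] θ) (𝓝[P.carrier] P.pt) := by
      refine tendsto_nhdsWithin_iff.2 ⟨((J1.contMDiff_pt θ).continuousAt.tendsto).mono_left
        nhdsWithin_le_nhds, ?_⟩
      filter_upwards [self_mem_nhdsWithin] with z hz
      obtain ⟨q, hq, rfl⟩ := hz
      exact hq
    have h2 : ∀ᶠ q in 𝓝[P.carrier] P.pt, IsLocalParam (m := m) P.carrier s (r q) := by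
      have h3 : Tendsto r (𝓝[P.carrier] P.pt) (𝓝 a) := by
        have := hrc.continuousAt.tendsto.mono_left (nhdsWithin_le_nhds (s := P.carrier))
        rwa [hra] at this
      exact h3.eventually h.eventually
    rw [hsa] at hsr
    filter_upwards [h1.eventually (hsr.and h2), self_mem_nhdsWithin] with z hz hzP
    obtain ⟨q, hq, rfl⟩ := hzP
    obtain ⟨hz1, hz2⟩ := hz
    change s (r q) = q at hz1
    refine (hjet (r q) hz2 (by rw [hz1]; exact hq)).trans ?_
    congr 1
  have hrθ : MDifferentiableAt 𝓘(ℝ, J1Model n m) 𝓘(ℝ, Rn n) (fun z : J1 n m E => r z.pt) θ :=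
    (hrc.comp θ (J1.contMDiff_pt θ)).mdifferentiableAt (by simp)
  rw [mem_tangentSpaceOf_iff_of_retraction hJa (hJs.mdifferentiableAt (by simp)) hrθ hra hjS hS
    (J1.openChart_mem_atlas c) hc]
  have hsrc : ∀ᶠ x in 𝓝 a, J x ∈ (J1.openChart c).source := by
    refine hJs.continuousAt ((J1.openChart c).open_source.mem_nhds ?_)
    rw [hJa]
    exact hc
  have hgraph : ∀ᶠ x in 𝓝 a, (J1.slope c (J x)).comp (baseBlock c.2 (fderiv ℝ σ x)) =
      fibreBlock c.2 (fderiv ℝ σ x) := by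
    have h1 := h.germ.eventually_openChart_jetAt (φ := modelChart n) (mem_univ _) (j := c.1) hsc
    filter_upwards [hsrc, h1] with x hx hx1
    obtain ⟨-, l, hl⟩ := hx
    rw [J1.slope_eq hl]
    have h2 := ((isGraphOf_prE1_iff c (modelChart n) _ l).1 hl).2
    have h3 : (h.germ.jetAt x).coord (modelChart n) c.1 = fderiv ℝ σ x := congrArg Prod.snd hx1.2
    rwa [h3] at h2
  have hchart : ContDiffAt ℝ ∞ (fun x => J1.openChart c (J x)) a := by
    have h1 := contMDiffAt_of_mem_atlas (J1.openChart_mem_atlas c) hc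
    rw [← hJa] at h1
    exact contMDiffAt_iff_contDiffAt.1 (h1.comp a hJs)
  have hd := hchart.differentiableAt (by simp)
  have hfst : ∀ ξ, (fderiv ℝ (fun x => J1.openChart c (J x)) a ξ).1 = fderiv ℝ σ a ξ := by
    intro ξ
    have h1 : HasFDerivAt (fun x => (J1.openChart c (J x)).1) _ a := hd.hasFDerivAt.fst
    have h2 : (fun x => (J1.openChart c (J x)).1) =ᶠ[𝓝 a] σ := by
      filter_upwards [h.eventually] with x hx
      change c.1.1 (J x).pt = c.1.1 (s x)
      exact congrArg (fun θ : ImmJ1 n m (Rn n) E => c.1.1 (prE1 θ).pt)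
        (h.germ.jetAt_eq hx.injective)
    rw [← h2.fderiv_eq, h1.fderiv]
    rfl
  have hσs : ContDiffAt ℝ ∞ σ a := contDiffAt_chart_comp c.1 h.smooth.self_of_nhds hsc
  -- With `u(x)` the slope at `x`, differentiating the relation `u ∘ base(Dσ) = fibre(Dσ)` of
  -- `hgraph` gives `(Du ξ) ∘ base(Dσ) = fibre(D²σ ξ) - u ∘ base(D²σ ξ)`. No inverse has to be
  -- differentiated.
  have hsnd : ∀ ξ η, (fderiv ℝ (fun x => J1.openChart c (J x)) a ξ).2
      (baseBlock c.2 (fderiv ℝ σ a) η) =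
      slopeProj c.2 (J1.slope c θ) (fderiv ℝ (fderiv ℝ σ) a ξ η) := by
    intro ξ η
    have h1 : HasFDerivAt (fun x => J1.slope c (J x)) _ a := hd.hasFDerivAt.snd
    have h2 := hasFDerivAt_fderiv hσs
    have h3 : HasFDerivAt (fun x => baseBlock c.2 (fderiv ℝ σ x)) _ a :=
      (hasFDerivAt_const _ a).clm_comp h2
    have h4 : HasFDerivAt (fun x => fibreBlock c.2 (fderiv ℝ σ x)) _ a :=
      (hasFDerivAt_const _ a).clm_comp h2
    have h5 := (h1.clm_comp h3).unique (h4.congr_of_eventuallyEq hgraph)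
    have h6 := congrArg (fun f : Rn n →L[ℝ] Rn n →L[ℝ] Rn m => f ξ η) h5
    rw [hJa] at h6
    simp at h6
    rw [slopeProj_apply]
    exact eq_sub_of_add_eq' h6
  constructor
  · rintro ⟨ξ, hξ⟩
    exact ⟨ξ, (congrArg (fun z : J1Model n m => z.1) hξ).trans (hfst ξ), fun η =>
      (congrArg (fun z : J1Model n m => z.2 (baseBlock c.2 (fderiv ℝ σ a) η)) hξ).trans
        (hsnd ξ η)⟩
  · rintro ⟨ξ, h1, h2⟩
    refine ⟨ξ, Prod.ext (h1.trans (hfst ξ).symm) ?_⟩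
    have hu := ((h.isGraphOf_iff hsa hc.1 _).1 hc.2.choose_spec).1
    refine ContinuousLinearMap.ext fun w => ?_
    have hw : baseBlock c.2 (fderiv ℝ σ a) (Ring.inverse (baseBlock c.2 (fderiv ℝ σ a)) w) = w :=
      congrArg (fun f : Rn n →L[ℝ] Rn n => f w) (Ring.mul_inverse_cancel _ hu)
    rw [← hw]
    exact (h2 _).trans (hsnd ξ _).symm

end ProlongedSubmanifolds

/-! ### Smooth distributions from their expression in charts -/

section Distributions

variable {V : Type*} [NormedAddCommGroup V] [NormedSpace ℝ V] {N : Type*}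
  [TopologicalSpace N] [ChartedSpace V N] [IsManifold 𝓘(ℝ, V) ∞ N]

/-- A field of planes that is the range of a smooth injective linear map in charts is a smooth
distribution. -/
theorem isSmoothDistribution_of_chart [CompleteSpace V] {d : ℕ}
    {D : ∀ x : N, Submodule ℝ (TangentSpace 𝓘(ℝ, V) x)}
    (h : ∀ x₀ : N, ∃ e ∈ atlas V N, x₀ ∈ e.source ∧ ∃ H : V → Rn d →L[ℝ] V,
      ContDiffOn ℝ ∞ H e.target ∧ ∀ x ∈ e.source, Function.Injective (H (e x)) ∧
        ∀ ζ, ζ ∈ D x ↔ ∃ ξ, (mfderiv 𝓘(ℝ, V) 𝓘(ℝ, V) e x ζ : V) = H (e x) ξ) :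
    IsSmoothDistribution d D := by
  intro x₀
  obtain ⟨e, he, hx₀, H, hH, hD⟩ := h x₀
  have hem := openPartialHomeomorph_mdifferentiable he
  let b : Fin d → Rn d := EuclideanSpace.basisFun (Fin d) ℝ
  -- The images under `H(z)` of the standard basis; their pull-backs by `e` will be the local frame.
  let W : Fin d → ∀ z : V, TangentSpace 𝓘(ℝ, V) z := fun i z => H z (b i)
  refine ⟨fun i => VectorField.mpullback 𝓘(ℝ, V) 𝓘(ℝ, V) e (W i), ?_⟩
  filter_upwards [e.open_source.mem_nhds hx₀] with x hx
  have hinvb : (mfderiv 𝓘(ℝ, V) 𝓘(ℝ, V) e x).IsInvertible := ⟨hem.mfderiv hx, rfl⟩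
  have hZ : ∀ i, (mfderiv 𝓘(ℝ, V) 𝓘(ℝ, V) e x
      (VectorField.mpullback 𝓘(ℝ, V) 𝓘(ℝ, V) e (W i) x) : V) = H (e x) (b i) := by
    intro i
    exact hinvb.self_apply_inverse _
  have hinj := hem.mfderiv_injective hx
  refine ⟨fun i => ?_, ?_, ?_⟩
  · have h1 : IsManifold 𝓘(ℝ, V) 1 N := .of_le (n := ∞) (by simp)
    have h2 : ContMDiffAt 𝓘(ℝ, V) 𝓘(ℝ, V).tangent ∞
        (fun z => (⟨z, W i z⟩ : TangentBundle 𝓘(ℝ, V) V)) (e x) := by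
      rw [contMDiffAt_vectorSpace_iff_contDiffAt]
      exact (hH.contDiffAt (e.open_target.mem_nhds (e.map_source hx))).clm_apply
        contDiffAt_const
    exact ContMDiffAt.mpullback_vectorField_preimage h2 (contMDiffAt_of_mem_atlas he hx) hinvb
      (by simp)
  · let T : TangentSpace 𝓘(ℝ, V) x →ₗ[ℝ] V := (mfderiv 𝓘(ℝ, V) 𝓘(ℝ, V) e x).toLinearMap
    refine LinearIndependent.of_comp T ?_
    have h1 : T ∘ (fun i => VectorField.mpullback 𝓘(ℝ, V) 𝓘(ℝ, V) e (W i) x) =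
        (H (e x) : Rn d →ₗ[ℝ] V) ∘ b := funext hZ
    rw [h1]
    exact (EuclideanSpace.basisFun (Fin d) ℝ).toBasis.linearIndependent.map' _
      (LinearMap.ker_eq_bot.2 (hD x hx).1) |> fun h => by simpa using h
  · apply le_antisymm
    · refine Submodule.span_le.2 ?_
      rintro _ ⟨i, rfl⟩
      exact ((hD x hx).2 _).2 ⟨b i, hZ i⟩
    · intro ζ hζ
      obtain ⟨ξ, hξ⟩ := ((hD x hx).2 ζ).1 hζ
      have h1 : ζ = ∑ i, ξ i • VectorField.mpullback 𝓘(ℝ, V) 𝓘(ℝ, V) e (W i) x := by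
        apply hinj
        rw [map_sum]
        refine hξ.trans ?_
        have h2 : ξ = ∑ i, ξ i • b i := ((EuclideanSpace.basisFun (Fin d) ℝ).sum_repr ξ).symm
        conv_lhs => rw [h2]
        rw [map_sum]
        refine Finset.sum_congr rfl fun i _ => ?_
        rw [map_smul, map_smul]
        exact congrArg (fun z : V => ξ i • z) (hZ i).symm
      rw [h1]
      exact Submodule.sum_mem _ fun i _ => Submodule.smul_mem _ _ (Submodule.subset_span ⟨i, rfl⟩)

theorem exists_mfderiv_eq {e : OpenPartialHomeomorph N V} (he : e ∈ atlas V N) {x : N}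
    (hx : x ∈ e.source) (z : V) :
    ∃ ζ : TangentSpace 𝓘(ℝ, V) x, (mfderiv 𝓘(ℝ, V) 𝓘(ℝ, V) e x ζ : V) = z :=
  (openPartialHomeomorph_mdifferentiable he).mfderiv_surjective hx z

end Distributions

/-! ### Horizontal planes on `Imm J¹ pr_M` and totally geodesic maps -/

section ParametrizedHorizontal

variable {n m : ℕ} {M E : Type*} [TopologicalSpace M] [ChartedSpace (Rn n) M]
  [TopologicalSpace E] [ChartedSpace (Rn (n + m)) E]
  [IsManifold 𝓘(ℝ, Rn n) ∞ M] [IsManifold 𝓘(ℝ, Rn (n + m)) ∞ E]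

/-- The horizontal lift of the plane `{(ξ, B ξ)}` in the coordinates `((x, v), B)` of
`Imm J¹ pr_M`. -/
def immHorizontal (Γ : Connection (n + m) E) (Θ : Connection n M) (i : atlas (Rn n) M)
    (j : atlas (Rn (n + m)) E) (z : ImmJ1Model n m) : Rn n →L[ℝ] ImmJ1Model n m :=
  ((ContinuousLinearMap.id ℝ (Rn n)).prod z.2).prod
    ((ContinuousLinearMap.compL ℝ (Rn n) (Rn n) (Rn (n + m)) z.2).comp
        (christoffelOn Θ i (i.1.symm z.1.1)) -
      (ContinuousLinearMap.bilinearComp (christoffelOn Γ j (j.1.symm z.1.2)) z.2 z.2))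

theorem immHorizontal_fst (Γ : Connection (n + m) E) (Θ : Connection n M) (i : atlas (Rn n) M)
    (j : atlas (Rn (n + m)) E) (z : ImmJ1Model n m) (ξ : Rn n) :
    (immHorizontal Γ Θ i j z ξ).1 = (ξ, z.2 ξ) := rfl

theorem immHorizontal_snd (Γ : Connection (n + m) E) (Θ : Connection n M) (i : atlas (Rn n) M)
    (j : atlas (Rn (n + m)) E) (z : ImmJ1Model n m) (ξ η : Rn n) :
    (immHorizontal Γ Θ i j z ξ).2 η = z.2 (christoffelOn Θ i (i.1.symm z.1.1) ξ η) -
      christoffelOn Γ j (j.1.symm z.1.2) (z.2 ξ) (z.2 η) := rfl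

theorem immHorizontal_injective (Γ : Connection (n + m) E) (Θ : Connection n M)
    (i : atlas (Rn n) M) (j : atlas (Rn (n + m)) E) (z : ImmJ1Model n m) :
    Function.Injective (immHorizontal Γ Θ i j z) := fun _ _ h =>
  congrArg (fun w : ImmJ1Model n m => w.1.1) h

theorem contDiffOn_immHorizontal [T2Space M] [T2Space E] (Γ : Connection (n + m) E)
    (hΓ : Γ.ContMDiffCovariantDerivative ∞) (Θ : Connection n M)
    (hΘ : Θ.ContMDiffCovariantDerivative ∞) (i : atlas (Rn n) M) (j : atlas (Rn (n + m)) E) :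
    ContDiffOn ℝ ∞ (immHorizontal Γ Θ i j) (ImmJ1.openChart i j).target := by
  set S := (ImmJ1.openChart i j).target with hS
  have c1 : ContDiffOn ℝ ∞ (fun z : ImmJ1Model n m => z.1.1) S :=
    (contDiff_fst.comp contDiff_fst).contDiffOn
  have c2 : ContDiffOn ℝ ∞ (fun z : ImmJ1Model n m => z.1.2) S :=
    (contDiff_snd.comp contDiff_fst).contDiffOn
  have c3 : ContDiffOn ℝ ∞ (fun z : ImmJ1Model n m => z.2) S := contDiff_snd.contDiffOn
  have k1 := (contDiffOn_christoffelOn Θ hΘ i).comp c1 fun z hz => hz.1.1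
  have k2 := (contDiffOn_christoffelOn Γ hΓ j).comp c2 fun z hz => hz.1.2
  refine contDiffOn_clm_apply.2 fun ξ => ?_
  refine (contDiffOn_const.prodMk (c3.clm_apply contDiffOn_const)).prodMk ?_
  refine contDiffOn_clm_apply.2 fun η => ?_
  exact (c3.clm_apply ((k1.clm_apply contDiffOn_const).clm_apply contDiffOn_const)).sub
    ((k2.clm_apply (c3.clm_apply contDiffOn_const)).clm_apply (c3.clm_apply contDiffOn_const))

/-- The preferred chart has identity derivative at `θ`, so `ζ` is a triple `((ξ, v), w)`. The first
condition becomes `v = B ξ`, and then the vertical projection vanishes iff `w η = B Θ(ξ, η) - Γ(B ξ,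
B η)`. -/
theorem horizontal_immJ1_iff (Γ : Connection (n + m) E) (Θ : Connection n M)
    (θ : ImmJ1 n m M E) (ζ : TangentSpace 𝓘(ℝ, ImmJ1Model n m) θ) :
    (mfderiv 𝓘(ℝ, ImmJ1Model n m) 𝓘(ℝ, Rn (n + m)) ImmJ1.val θ ζ =
          θ.lin (mfderiv 𝓘(ℝ, ImmJ1Model n m) 𝓘(ℝ, Rn n) ImmJ1.pt θ ζ) ∧
        ∀ y, verticalImmJ1 Γ Θ θ ζ y = 0) ↔
      ∃ ξ : Rn n, (mfderiv 𝓘(ℝ, ImmJ1Model n m) 𝓘(ℝ, ImmJ1Model n m)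
          (ImmJ1.openChart (achart _ θ.pt) (achart _ θ.val)) θ ζ : ImmJ1Model n m) =
        immHorizontal Γ Θ (achart _ θ.pt) (achart _ θ.val)
          (ImmJ1.openChart (achart _ θ.pt) (achart _ θ.val) θ) ξ := by
  set i := achart (Rn n) θ.pt with hi
  set j := achart (Rn (n + m)) θ.val with hj
  have hθ : θ ∈ (ImmJ1.openChart i j).source := mem_chart_source (ImmJ1Model n m) θ
  let w : ImmJ1Model n m := ζ
  have hw : (mfderiv 𝓘(ℝ, ImmJ1Model n m) 𝓘(ℝ, ImmJ1Model n m) (ImmJ1.openChart i j) θ ζ :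
      ImmJ1Model n m) = w := mfderiv_chartAt_self θ ζ
  have hpt : tangentCoord i θ.pt (mfderiv 𝓘(ℝ, ImmJ1Model n m) 𝓘(ℝ, Rn n) ImmJ1.pt θ ζ) = w.1.1 :=
    (ImmJ1.tangentCoord_mfderiv_pt i j hθ ζ).trans (congrArg (fun z : ImmJ1Model n m => z.1.1) hw)
  have hval : tangentCoord j θ.val
      (mfderiv 𝓘(ℝ, ImmJ1Model n m) 𝓘(ℝ, Rn (n + m)) ImmJ1.val θ ζ) = w.1.2 :=
    (ImmJ1.tangentCoord_mfderiv_val i j hθ ζ).trans (congrArg (fun z : ImmJ1Model n m => z.1.2) hw)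
  set B := θ.coord i j with hB
  have hBlin : ∀ y, tangentCoord j θ.val (θ.lin y) = B (tangentCoord i θ.pt y) := fun y => by
    change _ = tangentCoord j θ.val (θ.lin ((tangentCoord i θ.pt).symm (tangentCoord i θ.pt y)))
    rw [ContinuousLinearEquiv.symm_apply_apply]
  have hvert : ∀ y, verticalImmJ1 Γ Θ θ ζ y = w.2 (tangentCoord i θ.pt y) +
      (christoffelOn Γ j θ.val w.1.2 (B (tangentCoord i θ.pt y)) -
        B (christoffelOn Θ i θ.pt w.1.1 (tangentCoord i θ.pt y))) := by
    intro y
    rw [← hval, ← hpt, ← hBlin y]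
    refine congrArg (fun z : Rn (n + m) => w.2 (tangentCoord i θ.pt y) + z) ?_
    refine (map_sub (tangentCoord j θ.val) _ _).trans ?_
    refine congrArg₂ (fun a b : Rn (n + m) => a - b) (tangentCoord_christoffel Γ θ.val _ _) ?_
    refine (hBlin _).trans (congrArg B ?_)
    exact tangentCoord_christoffel Θ θ.pt _ _
  have he1 : i.1.symm (ImmJ1.openChart i j θ).1.1 = θ.pt := i.1.left_inv hθ.1
  have he2 : j.1.symm (ImmJ1.openChart i j θ).1.2 = θ.val := j.1.left_inv hθ.2
  have heB : (ImmJ1.openChart i j θ).2 = B := rfl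
  constructor
  · rintro ⟨h1, h2⟩
    have h3 : w.1.2 = B w.1.1 := by
      rw [← hval, h1, hBlin]
      exact congrArg B hpt
    refine ⟨w.1.1, hw.trans (Prod.ext ?_ ?_)⟩
    · rw [immHorizontal_fst, heB, ← h3]
    · refine ContinuousLinearMap.ext fun η => ?_
      rw [immHorizontal_snd, he1, he2, heB, ← h3]
      have h4 := h2 ((tangentCoord i θ.pt).symm η)
      rw [hvert, ContinuousLinearEquiv.apply_symm_apply] at h4
      rw [eq_neg_of_add_eq_zero_left h4, neg_sub]
  · rintro ⟨ξ, hξ⟩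
    have h0 := hw.symm.trans hξ
    have h1 : w.1 = (ξ, B ξ) := congrArg Prod.fst h0
    have h2 : w.1.1 = ξ := congrArg Prod.fst h1
    have h3 : w.1.2 = B ξ := congrArg Prod.snd h1
    constructor
    · apply (tangentCoord j θ.val).injective
      rw [hval, hBlin, h3]
      exact congrArg B (h2.symm.trans hpt.symm)
    · intro y
      have h4 : w.2 (tangentCoord i θ.pt y) = _ :=
        congrArg (fun z : ImmJ1Model n m => z.2 (tangentCoord i θ.pt y)) h0
      rw [hvert, h4, immHorizontal_snd, he1, he2, heB, h2, h3]
      abel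

/-- A germ of immersions satisfies the equation of totally geodesic maps if and only if the
tangent space of its prolongation is horizontal. -/
theorem prolong_horizontal_iff_param (Γ : Connection (n + m) E) (Θ : Connection n M)
    {f : ImmersionGerm n m M E} {θ : ImmJ1 n m M E} (hf : f.jet1 = θ) {i : atlas (Rn n) M}
    {j : atlas (Rn (n + m)) E} (hθ : θ ∈ (ImmJ1.openChart i j).source) :
    (∀ ζ, ζ ∈ tangentSpaceOf (V := ImmJ1Model n m) f.prolong θ ↔
      ∃ ξ : Rn n, (mfderiv 𝓘(ℝ, ImmJ1Model n m) 𝓘(ℝ, ImmJ1Model n m)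
          (ImmJ1.openChart i j) θ ζ : ImmJ1Model n m) =
        immHorizontal Γ Θ i j (ImmJ1.openChart i j θ) ξ) ↔
      ParamSecondFundamentalFormVanishes Γ Θ f := by
  subst hf
  obtain ⟨hi, hj⟩ := hθ
  change f.pt ∈ i.1.source at hi
  change f.toFun f.pt ∈ j.1.source at hj
  set D := fderiv ℝ (j.1 ∘ f.param i) (i.1 f.pt) with hD
  have hchart : ImmJ1.openChart i j f.jet1 = ((i.1 f.pt, j.1 (f.toFun f.pt)), D) := by
    rw [← f.jetAt_pt]
    exact (f.openChart_jetAt hi f.immersion.self_of_nhds.1 hj f.immersion.self_of_nhds.2).2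
  -- The two vectors agree over `M × E`. Equality of their remaining components is `D²σ(ξ, η) = D
  -- Θ(ξ, η) - Γ(D ξ, D η)`, which is the differential equation.
  have he : ∀ ξ, immHorizontal Γ Θ i j (ImmJ1.openChart i j f.jet1) ξ =
        ((ξ, D ξ), fderiv ℝ (fderiv ℝ (j.1 ∘ f.param i)) (i.1 f.pt) ξ) ↔
      ∀ η, covHessian Γ j (f.param i) (i.1 f.pt) ξ η = D (christoffelOn Θ i f.pt ξ η) := by
    intro ξ
    rw [hchart]
    have h1 : ∀ η, (immHorizontal Γ Θ i j ((i.1 f.pt, j.1 (f.toFun f.pt)), D) ξ).2 η =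
        D (christoffelOn Θ i f.pt ξ η) - christoffelOn Γ j (f.toFun f.pt) (D ξ) (D η) := by
      intro η
      rw [immHorizontal_snd]
      simp only [i.1.left_inv hi, j.1.left_inv hj]
    have h2 : ∀ η, covHessian Γ j (f.param i) (i.1 f.pt) ξ η =
        fderiv ℝ (fderiv ℝ (j.1 ∘ f.param i)) (i.1 f.pt) ξ η +
          christoffelOn Γ j (f.toFun f.pt) (D ξ) (D η) := by
      intro η
      rw [covHessian, f.param_chart hi]
    constructor
    · intro h η
      have h3 := h1 η
      rw [h] at h3
      rw [h2, h3, sub_add_cancel]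
    · intro h
      refine Prod.ext rfl (ContinuousLinearMap.ext fun η => ?_)
      rw [h1, ← h η, h2, add_sub_cancel_right]
  rw [paramSecondFundamentalFormVanishes_iff Γ Θ f hi hj]
  constructor
  · intro h ξ
    refine (he ξ).1 ?_
    -- This is the vector of the prolongation over `ξ`. It is horizontal by hypothesis, and
    -- comparing the components along `M` shows that it is the lift of `ξ` itself.
    obtain ⟨ζ, hζ⟩ := exists_mfderiv_eq (ImmJ1.openChart_mem_atlas i j)
      (x := f.jet1) ⟨hi, hj⟩
      ((ξ, D ξ), fderiv ℝ (fderiv ℝ (j.1 ∘ f.param i)) (i.1 f.pt) ξ)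
    obtain ⟨ξ', hξ'⟩ := (h ζ).1 ((f.mem_tangentSpaceOf_prolong_iff hi hj ζ).2 ⟨ξ, hζ⟩)
    have h1 := hζ.symm.trans hξ'
    have h2 : ξ = ξ' := congrArg (fun z : ImmJ1Model n m => z.1.1) h1
    rw [h1, h2]
  · intro h ζ
    rw [f.mem_tangentSpaceOf_prolong_iff hi hj ζ]
    refine exists_congr fun ξ => ?_
    rw [(he ξ).2 (h ξ)]

end ParametrizedHorizontal

/-! ### Horizontal planes on `J¹(E,n)` and totally geodesic submanifolds -/

section GrassmannHorizontal

variable {n m : ℕ} {E : Type*} [TopologicalSpace E] [ChartedSpace (Rn (n + m)) E]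
  [IsManifold 𝓘(ℝ, Rn (n + m)) ∞ E]

/-- The inclusion `x ↦ (x, u x)` of the graph of `u` in the splitting `A`. -/
def graphIncl (A : Rn (n + m) ≃L[ℝ] (Rn n × Rn m)) (u : Rn n →L[ℝ] Rn m) :
    Rn n →L[ℝ] Rn (n + m) :=
  (A.symm : (Rn n × Rn m) →L[ℝ] Rn (n + m)).comp ((ContinuousLinearMap.id ℝ (Rn n)).prod u)

theorem graphIncl_apply (A : Rn (n + m) ≃L[ℝ] (Rn n × Rn m)) (u : Rn n →L[ℝ] Rn m) (x : Rn n) :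
    graphIncl A u x = A.symm (x, u x) := rfl

theorem graphIncl_injective (A : Rn (n + m) ≃L[ℝ] (Rn n × Rn m)) (u : Rn n →L[ℝ] Rn m) :
    Function.Injective (graphIncl A u) := fun _ _ h =>
  congrArg Prod.fst (A.symm.injective h)

/-- The tangent plane is described both by graph coordinates and by the parametrization; `baseBlock
A D` is the linear change of parameters between the two. It allows `grassHorizontal` to be evaluated
on vectors `D η`. -/
theorem graphIncl_baseBlock {A : Rn (n + m) ≃L[ℝ] (Rn n × Rn m)} {u : Rn n →L[ℝ] Rn m}
    {D : Rn n →L[ℝ] Rn (n + m)} (hD : u.comp (baseBlock A D) = fibreBlock A D) (η : Rn n) :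
    graphIncl A u (baseBlock A D η) = D η := by
  have h1 : u (baseBlock A D η) = (A (D η)).2 := DFunLike.congr_fun hD η
  rw [graphIncl_apply, h1]
  exact A.symm_apply_apply (D η)

/-- The horizontal lift of the graph of `u` in the divided coordinates `(v, u)` of `J¹(E,n)`. -/
def grassHorizontal (Γ : Connection (n + m) E) (c : DividedChart n m E) (z : J1Model n m) :
    Rn n →L[ℝ] J1Model n m :=
  (graphIncl c.2 z.2).prod
    (-(ContinuousLinearMap.compL ℝ (Rn n) (Rn (n + m)) (Rn m) (slopeProj c.2 z.2)).comp
      (ContinuousLinearMap.bilinearComp (christoffelOn Γ c.1 (c.1.1.symm z.1))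
        (graphIncl c.2 z.2) (graphIncl c.2 z.2)))

theorem grassHorizontal_fst (Γ : Connection (n + m) E) (c : DividedChart n m E)
    (z : J1Model n m) (x : Rn n) : (grassHorizontal Γ c z x).1 = graphIncl c.2 z.2 x := rfl

theorem grassHorizontal_snd (Γ : Connection (n + m) E) (c : DividedChart n m E)
    (z : J1Model n m) (x y : Rn n) : (grassHorizontal Γ c z x).2 y =
      -slopeProj c.2 z.2 (christoffelOn Γ c.1 (c.1.1.symm z.1) (graphIncl c.2 z.2 x)
        (graphIncl c.2 z.2 y)) := rfl

theorem grassHorizontal_injective (Γ : Connection (n + m) E) (c : DividedChart n m E)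
    (z : J1Model n m) : Function.Injective (grassHorizontal Γ c z) := fun _ _ h =>
  graphIncl_injective c.2 z.2 (congrArg Prod.fst h)

theorem contDiffOn_grassHorizontal [T2Space E] (Γ : Connection (n + m) E)
    (hΓ : Γ.ContMDiffCovariantDerivative ∞) (c : DividedChart n m E) :
    ContDiffOn ℝ ∞ (grassHorizontal Γ c) (J1.openChart c).target := by
  set S := (J1.openChart c).target with hS
  have c1 : ContDiffOn ℝ ∞ (fun z : J1Model n m => z.1) S := contDiff_fst.contDiffOn
  have c2 : ContDiffOn ℝ ∞ (fun z : J1Model n m => z.2) S := contDiff_snd.contDiffOn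
  have k := (contDiffOn_christoffelOn Γ hΓ c.1).comp c1 fun z hz => hz.1
  have g : ∀ x : Rn n, ContDiffOn ℝ ∞ (fun z : J1Model n m => graphIncl c.2 z.2 x) S := by
    intro x
    exact c.2.symm.contDiff.comp_contDiffOn
      (contDiffOn_const.prodMk (c2.clm_apply contDiffOn_const))
  refine contDiffOn_clm_apply.2 fun x => (g x).prodMk ?_
  refine contDiffOn_clm_apply.2 fun y => ContDiffOn.neg ?_
  have h := c.2.contDiff.comp_contDiffOn ((k.clm_apply (g x)).clm_apply (g y))
  exact (contDiff_snd.comp_contDiffOn h).sub (c2.clm_apply (contDiff_fst.comp_contDiffOn h))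

theorem IsGraphOf.mem_plane_iff {c : DividedChart n m E} {θ : J1 n m E} {l : Rn n →L[ℝ] Rn m}
    (h : IsGraphOf c θ l) (v : Tan (n + m) θ.pt) :
    v ∈ θ.plane ↔ tangentCoord c.1 θ.pt v = graphIncl c.2 l (c.2 (tangentCoord c.1 θ.pt v)).1 := by
  have h1 : v ∈ θ.plane ↔ dividedCoord c θ.pt v ∈ LinearMap.graph (l : Rn n →ₗ[ℝ] Rn m) := by
    rw [← show _ = _ from h]
    constructor
    · exact fun hv => ⟨v, hv, rfl⟩
    · rintro ⟨w, hw, hwv⟩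
      rwa [← (dividedCoord c θ.pt).injective hwv]
  rw [h1]
  change (c.2 (tangentCoord c.1 θ.pt v)).2 = l (c.2 (tangentCoord c.1 θ.pt v)).1 ↔ _
  rw [graphIncl_apply]
  constructor
  · intro h2
    rw [← h2]
    exact (c.2.symm_apply_apply _).symm
  · intro h2
    have h3 := congrArg c.2 h2
    rw [ContinuousLinearEquiv.apply_symm_apply] at h3
    exact congrArg Prod.snd h3

/-- Contracting the coefficients of `Γ̇` with the base velocity gives `slopeProj` of the Christoffel
term. Over the plane of `θ` this velocity has the form `graphIncl x`, and the vanishing of the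
vertical projection then fixes the slope velocity. -/
theorem horizontal_j1_iff (Γ : Connection (n + m) E) (θ : J1 n m E)
    (ζ : TangentSpace 𝓘(ℝ, J1Model n m) θ) :
    (mfderiv 𝓘(ℝ, J1Model n m) 𝓘(ℝ, Rn (n + m)) J1.pt θ ζ ∈ θ.plane ∧
        ∀ x, verticalJ1 Γ θ ζ x = 0) ↔
      ∃ x : Rn n, (mfderiv 𝓘(ℝ, J1Model n m) 𝓘(ℝ, J1Model n m)
          (J1.openChart θ.dividedChartAt) θ ζ : J1Model n m) =
        grassHorizontal Γ θ.dividedChartAt (J1.openChart θ.dividedChartAt θ) x := by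
  have hθ := θ.mem_dividedChartAt_source
  set c := θ.dividedChartAt with hc
  let w : J1Model n m := ζ
  have hw : (mfderiv 𝓘(ℝ, J1Model n m) 𝓘(ℝ, J1Model n m) (J1.openChart c) θ ζ :
      J1Model n m) = w := mfderiv_chartAt_self θ ζ
  have hpt : tangentCoord c.1 θ.pt (mfderiv 𝓘(ℝ, J1Model n m) 𝓘(ℝ, Rn (n + m)) J1.pt θ ζ) = w.1 :=
    (J1.tangentCoord_mfderiv_pt c hθ ζ).trans (congrArg (fun z : J1Model n m => z.1) hw)
  obtain ⟨hθ1, u, hu⟩ := hθ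
  have hslope : J1.slope c θ = u := J1.slope_eq hu
  have hvert : ∀ x, verticalJ1 Γ θ ζ x = w.2 x +
      slopeProj c.2 u (christoffelOn Γ c.1 θ.pt w.1 (graphIncl c.2 u x)) := by
    intro x
    have h1 : c.2 (tangentCoord c.1 θ.pt (christoffel Γ θ.pt
        (mfderiv 𝓘(ℝ, J1Model n m) 𝓘(ℝ, Rn (n + m)) J1.pt θ ζ)
        ((dividedCoord c θ.pt).symm (x, J1.slope c θ x)))) =
        c.2 (christoffelOn Γ c.1 θ.pt w.1 (graphIncl c.2 u x)) := by
      refine congrArg c.2 ((tangentCoord_christoffel Γ θ.pt _ _).trans ?_)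
      refine congrArg₂ (fun a b => christoffelOn Γ c.1 θ.pt a b) hpt ?_
      rw [hslope]
      exact (tangentCoord c.1 θ.pt).apply_symm_apply _
    rw [slopeProj_apply, ← h1, ← hslope]
    rfl
  have he1 : c.1.1.symm (J1.openChart c θ).1 = θ.pt := c.1.1.left_inv hθ1
  have he2 : (J1.openChart c θ).2 = u := hslope
  rw [hu.mem_plane_iff, hpt]
  constructor
  · rintro ⟨h1, h2⟩
    refine ⟨(c.2 w.1).1, hw.trans (Prod.ext ?_ ?_)⟩
    · rw [grassHorizontal_fst, he2, ← h1]
    · refine ContinuousLinearMap.ext fun y => ?_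
      rw [grassHorizontal_snd, he1, he2, ← h1]
      have h3 := h2 y
      rw [hvert] at h3
      exact eq_neg_of_add_eq_zero_left h3
  · rintro ⟨x, hx⟩
    have h0 := hw.symm.trans hx
    have h1 : w.1 = graphIncl c.2 u x := by
      rw [← he2]
      exact congrArg Prod.fst h0
    constructor
    · rw [h1, graphIncl_apply, ContinuousLinearEquiv.apply_symm_apply]
      rfl
    · intro y
      have h2 : w.2 y = _ := congrArg (fun z : J1Model n m => z.2 y) h0
      rw [hvert, h2, grassHorizontal_snd, he1, he2, h1]
      exact neg_add_cancel _

/-- The second fundamental form of a submanifold vanishes at a point if and only if the tangent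
space of its prolongation is horizontal. -/
theorem prolong_horizontal_iff (Γ : Connection (n + m) E) {P : PointedSubmanifold n m E}
    {θ : J1 n m E} (hP : jet1 P.isEmbedded P.mem = θ) {c : DividedChart n m E}
    (hθ : θ ∈ (J1.openChart c).source) :
    (∀ ζ, ζ ∈ tangentSpaceOf (V := J1Model n m) P.prolong θ ↔
      ∃ x : Rn n, (mfderiv 𝓘(ℝ, J1Model n m) 𝓘(ℝ, J1Model n m) (J1.openChart c) θ ζ :
        J1Model n m) = grassHorizontal Γ c (J1.openChart c θ) x) ↔
      SecondFundamentalFormVanishes Γ P := by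
  subst hP
  obtain ⟨s, a, hsa, h⟩ := P.isEmbedded P.pt P.mem
  have hpt : P.pt ∈ c.1.1.source := hθ.1
  obtain ⟨u, hu⟩ := hθ.2
  have hslope : J1.slope c (jet1 P.isEmbedded P.mem) = u := J1.slope_eq hu
  obtain ⟨hunit, hD⟩ := (h.isGraphOf_iff hsa hpt u).1 hu
  set D := fderiv ℝ (c.1.1 ∘ s) a with hDdef
  have hB1 : ∀ w, baseBlock c.2 D (Ring.inverse (baseBlock c.2 D) w) = w := fun w =>
    congrArg (fun f : Rn n →L[ℝ] Rn n => f w) (Ring.mul_inverse_cancel _ hunit)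
  have hB2 : ∀ w, Ring.inverse (baseBlock c.2 D) (baseBlock c.2 D w) = w := fun w =>
    congrArg (fun f : Rn n →L[ℝ] Rn n => f w) (Ring.inverse_mul_cancel _ hunit)
  have hgr := graphIncl_baseBlock hD
  have he1 : c.1.1.symm (J1.openChart c (jet1 P.isEmbedded P.mem)).1 = P.pt :=
    c.1.1.left_inv hpt
  have he2 : (J1.openChart c (jet1 P.isEmbedded P.mem)).2 = u := hslope
  have hhor1 : ∀ ξ, (grassHorizontal Γ c (J1.openChart c (jet1 P.isEmbedded P.mem))
      (baseBlock c.2 D ξ)).1 = D ξ := by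
    intro ξ
    rw [grassHorizontal_fst, he2, hgr]
  have hhor2 : ∀ ξ η, (grassHorizontal Γ c (J1.openChart c (jet1 P.isEmbedded P.mem))
      (baseBlock c.2 D ξ)).2 (baseBlock c.2 D η) =
        -slopeProj c.2 u (christoffelOn Γ c.1 P.pt (D ξ) (D η)) := by
    intro ξ η
    rw [grassHorizontal_snd, he1, he2, hgr, hgr]
  -- Tangency of the covariant Hessian is the vanishing of its `slopeProj`, that is, the equality of
  -- the slope velocities of `L⁽¹⁾` and of the horizontal lift over `D ξ`.
  have hiff : ∀ ξ η, covHessian Γ c.1 s a ξ η ∈ range D ↔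
      slopeProj c.2 u (fderiv ℝ (fderiv ℝ (c.1.1 ∘ s)) a ξ η) =
        -slopeProj c.2 u (christoffelOn Γ c.1 P.pt (D ξ) (D η)) := by
    intro ξ η
    rw [← slopeProj_eq_zero_iff hunit hD, covHessian, hsa, map_add, add_eq_zero_iff_eq_neg]
  have hmem := h.mem_tangentSpaceOf_prolong_iff hsa (c := c) hθ
  rw [hslope] at hmem
  rw [secondFundamentalFormVanishes_iff Γ h hsa c.1 hpt]
  constructor
  · intro hall ξ η
    refine (hiff ξ η).2 ?_
    -- The vector of the tangent space of `L⁽¹⁾` over `D ξ`. The inverse of the base block converts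
    -- its slope part from the parameters of `s` to graph coordinates.
    obtain ⟨ζ, hζ⟩ := exists_mfderiv_eq (J1.openChart_mem_atlas c) hθ
      (D ξ, ((slopeProj c.2 u).comp (fderiv ℝ (fderiv ℝ (c.1.1 ∘ s)) a ξ)).comp
        (Ring.inverse (baseBlock c.2 D)))
    have h1 : ζ ∈ tangentSpaceOf (V := J1Model n m) P.prolong (jet1 P.isEmbedded P.mem) := by
      refine (hmem ζ).2 ⟨ξ, congrArg (fun z : J1Model n m => z.1) hζ, fun η => ?_⟩
      refine (congrArg (fun z : J1Model n m => z.2 (baseBlock c.2 D η)) hζ).trans ?_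
      exact congrArg (fun w => slopeProj c.2 u (fderiv ℝ (fderiv ℝ (c.1.1 ∘ s)) a ξ w)) (hB2 η)
    obtain ⟨x, hx⟩ := (hall ζ).1 h1
    rw [← hB1 x] at hx
    set ξ' := Ring.inverse (baseBlock c.2 D) x with hξ'
    have h2 := hζ.symm.trans hx
    have h3 : D ξ = D ξ' := (congrArg Prod.fst h2).trans (hhor1 ξ')
    have h4 := (congrArg (fun z : J1Model n m => z.2 (baseBlock c.2 D η)) h2).trans (hhor2 ξ' η)
    rw [← h3] at h4
    refine Eq.trans ?_ h4
    exact congrArg (fun w => slopeProj c.2 u (fderiv ℝ (fderiv ℝ (c.1.1 ∘ s)) a ξ w)) (hB2 η).symm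
  · intro hall ζ
    rw [hmem]
    constructor
    · rintro ⟨ξ, h1, h2⟩
      refine ⟨baseBlock c.2 D ξ, Prod.ext (h1.trans (hhor1 ξ).symm) ?_⟩
      refine ContinuousLinearMap.ext fun w => ?_
      rw [← hB1 w]
      exact (h2 _).trans (((hiff _ _).1 (hall _ _)).trans (hhor2 _ _).symm)
    · rintro ⟨x, hx⟩
      rw [← hB1 x] at hx
      refine ⟨Ring.inverse (baseBlock c.2 D) x,
        (congrArg (fun z : J1Model n m => z.1) hx).trans (hhor1 _), fun η => ?_⟩
      refine (congrArg (fun z : J1Model n m => z.2 (baseBlock c.2 D η)) hx).trans ?_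
      exact (hhor2 _ _).trans ((hiff _ _).1 (hall _ _)).symm

end GrassmannHorizontal

/-! ### Taylor expansions of order two -/

section SecondOrder

variable {V W : Type*} [NormedAddCommGroup V] [NormedSpace ℝ V] [NormedAddCommGroup W]
  [NormedSpace ℝ W]

/-- Contact and jets are defined with `iteratedFDeriv`, whereas the covariant Hessian uses `fderiv`
twice; this translates between the two. -/
theorem iteratedFDeriv_eq_of_le_two_iff {f g : V → W} {a : V} :
    (∀ k ≤ 2, iteratedFDeriv ℝ k f a = iteratedFDeriv ℝ k g a) ↔
      f a = g a ∧ fderiv ℝ f a = fderiv ℝ g a ∧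
        fderiv ℝ (fderiv ℝ f) a = fderiv ℝ (fderiv ℝ g) a := by
  constructor
  · intro h
    refine ⟨?_, ?_, ?_⟩
    · have := congrArg (fun F => F 0) (h 0 (by norm_num))
      simpa [iteratedFDeriv_zero_apply] using this
    · ext1 u
      have := congrArg (fun F => F fun _ => u) (h 1 (by norm_num))
      simpa [iteratedFDeriv_one_apply] using this
    · ext1 u
      ext1 v
      have := congrArg (fun F => F ![u, v]) (h 2 le_rfl)
      simpa [iteratedFDeriv_two_apply] using this
  · rintro ⟨h0, h1, h2⟩ k hk
    ext w
    interval_cases k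
    · simpa [iteratedFDeriv_zero_apply] using h0
    · rw [iteratedFDeriv_one_apply, iteratedFDeriv_one_apply, h1]
    · rw [iteratedFDeriv_two_apply, iteratedFDeriv_two_apply, h2]

/-- These are the first two derivatives of `L ∘ σ = id`. The second one removes the freedom of
reparametrization from `D²σ`. -/
theorem fderiv_of_leftInverse {σ : V → W} {L : W →L[ℝ] V} {a : V} (hσ : ContDiffAt ℝ ∞ σ a)
    (h : ∀ᶠ y in 𝓝 a, L (σ y) = y) :
    (∀ ξ, L (fderiv ℝ σ a ξ) = ξ) ∧ ∀ ξ η, L (fderiv ℝ (fderiv ℝ σ) a ξ η) = 0 := by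
  have hd : ∀ᶠ y in 𝓝 a, DifferentiableAt ℝ σ y :=
    ((hσ.of_le (m := 1) (by simp)).eventually (by simp)).mono
      fun y hy => hy.differentiableAt (by simp)
  have h1 : ∀ᶠ y in 𝓝 a, L.comp (fderiv ℝ σ y) = ContinuousLinearMap.id ℝ V := by
    filter_upwards [hd, h.eventually_nhds] with y hy hyL
    have h2 : HasFDerivAt (fun y => L (σ y)) (L.comp (fderiv ℝ σ y)) y :=
      L.hasFDerivAt.comp y hy.hasFDerivAt
    exact h2.unique ((hasFDerivAt_id y).congr_of_eventuallyEq hyL)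
  refine ⟨fun ξ => DFunLike.congr_fun h1.self_of_nhds ξ, fun ξ η => ?_⟩
  have h2 : HasFDerivAt (fun y => L.comp (fderiv ℝ σ y)) _ a :=
    (hasFDerivAt_const L a).clm_comp (hasFDerivAt_fderiv hσ)
  have h3 := h2.unique ((hasFDerivAt_const (ContinuousLinearMap.id ℝ V) a).congr_of_eventuallyEq h1)
  have h4 := congrArg (fun F : V →L[ℝ] V →L[ℝ] V => F ξ η) h3
  simpa using h4

end SecondOrder

/-! ### Second-order jets of submanifolds: invariance and uniqueness -/

section Contact

variable {n m : ℕ} {E : Type*} [TopologicalSpace E] [ChartedSpace (Rn (n + m)) E]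
  [IsManifold 𝓘(ℝ, Rn (n + m)) ∞ E]

/-- The criterion by the covariant Hessian involves a parametrization only through its value and
first two derivatives at the point. -/
theorem SecondFundamentalFormVanishes.of_hasContact {Γ : Connection (n + m) E}
    {P Q : PointedSubmanifold n m E} (h : HasContact 2 P Q) :
    SecondFundamentalFormVanishes Γ P ↔ SecondFundamentalFormVanishes Γ Q := by
  obtain ⟨hpt, s, t, a, hs, ht, hsa, hta, hst⟩ := h
  obtain ⟨h0, h1, h2⟩ := iteratedFDeriv_eq_of_le_two_iff.1 hst
  have h1' : fderiv ℝ ((achart (Rn (n + m)) P.pt).1 ∘ s) a =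
    fderiv ℝ ((achart (Rn (n + m)) P.pt).1 ∘ t) a := h1
  have h2' : fderiv ℝ (fderiv ℝ ((achart (Rn (n + m)) P.pt).1 ∘ s)) a =
    fderiv ℝ (fderiv ℝ ((achart (Rn (n + m)) P.pt).1 ∘ t)) a := h2
  have hP := mem_chart_source (Rn (n + m)) P.pt
  rw [secondFundamentalFormVanishes_iff Γ hs hsa (achart _ P.pt) hP,
    secondFundamentalFormVanishes_iff Γ ht (hta.trans hpt) (achart _ P.pt) (by rwa [← hpt])]
  simp only [covHessian, h1', h2', hsa, hta]

/-- The equation of totally geodesic submanifolds is a condition on second-order jets. -/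
theorem secondFundamentalFormVanishes_iff_of_mk_eq {Γ : Connection (n + m) E}
    {P Q : PointedSubmanifold n m E} (h : (Quot.mk _ P : J2 n m E) = Quot.mk _ Q) :
    SecondFundamentalFormVanishes Γ P ↔ SecondFundamentalFormVanishes Γ Q :=
  -- Descending the predicate to the quotient makes it unnecessary to prove that contact is an
  -- equivalence relation.
  Eq.to_iff (congrArg (Quot.lift (SecondFundamentalFormVanishes Γ)
    fun _ _ h => propext (SecondFundamentalFormVanishes.of_hasContact h)) h)

/-- A parametrization adapted to a linear projection of the coordinates. -/
theorem IsLocalParam.exists_adapted {S : Set E} {s : Rn n → E} {a : Rn n}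
    (h : IsLocalParam (m := m) S s a) (i : atlas (Rn (n + m)) E) {p : E} (hsa : s a = p)
    (hp : p ∈ i.1.source) {L : Rn (n + m) →L[ℝ] Rn n}
    (hL : Function.Injective (L.comp (fderiv ℝ (i.1 ∘ s) a))) :
    ∃ t : Rn n → E, IsLocalParam (m := m) S t (L (i.1 p)) ∧ t (L (i.1 p)) = p ∧
      ∀ᶠ y in 𝓝 (L (i.1 p)), L (i.1 (t y)) = y := by
  subst hsa
  obtain ⟨e, he, hae, hes, -⟩ := exists_retraction i h.smooth hp hL
  have hea : e a = L (i.1 (s a)) := congrFun he a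
  rw [← hea]
  have hsrc : ∀ᶠ x in 𝓝 a, DifferentiableAt ℝ e x := by
    filter_upwards [eventually_chart_comp i h.smooth hp] with x hx
    rw [he]
    exact (L.contDiff.contDiffAt.comp x hx.2.2).differentiableAt (n := ∞) (by simp)
  obtain ⟨U, hU, hUo, haU⟩ := eventually_nhds_iff.1 hsrc
  -- Reparametrization asks for differentiability on the whole source of the local homeomorphism,
  -- which is known only near `a`.
  let e' := e.restrOpen U hUo
  refine ⟨s ∘ e.symm, ?_, congrArg s (e.left_inv hae), ?_⟩
  · have h1 := h.comp_symm (e := e') ⟨hae, haU⟩ (fun x hx => hU x hx.2)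
      fun y hy => hes y hy.1
    exact h1
  · filter_upwards [e.open_target.mem_nhds (e.map_source hae)] with y hy
    have h1 := e.right_inv hy
    rw [he] at h1
    exact h1

/-- Two submanifolds with the same tangent plane whose second fundamental forms vanish have a
contact of order two. -/
theorem hasContact_of_secondFundamentalFormVanishes {Γ : Connection (n + m) E}
    {P Q : PointedSubmanifold n m E}
    (h : jet1 P.isEmbedded P.mem = jet1 Q.isEmbedded Q.mem)
    (hP : SecondFundamentalFormVanishes Γ P) (hQ : SecondFundamentalFormVanishes Γ Q) :
    HasContact 2 P Q := by
  obtain ⟨S, hS, p, hp⟩ := P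
  obtain ⟨S', hS', p', hp'⟩ := Q
  have hpp : p = p' := congrArg J1.pt h
  subst hpp
  have hT : tangentSpaceOf (V := Rn (n + m)) S p = tangentSpaceOf (V := Rn (n + m)) S' p :=
    (J1.mk.inj h).2
  set i := achart (Rn (n + m)) p with hi
  have hip : p ∈ i.1.source := mem_chart_source _ p
  obtain ⟨s₀, a₀, hsa₀, hs₀⟩ := hS p hp
  obtain ⟨t₀, b₀, htb₀, ht₀⟩ := hS' p hp'
  have hrange : ∀ {A : Set E} {s : Rn n → E} {a : Rn n}, IsLocalParam (m := m) A s a →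
      s a = p → tangentSpaceOf (V := Rn (n + m)) A p = tangentSpaceOf (V := Rn (n + m)) S p →
      ∀ w, w ∈ range (fderiv ℝ (i.1 ∘ s) a) ↔
        (tangentCoord i p).symm w ∈ tangentSpaceOf (V := Rn (n + m)) S p := by
    intro A s a hs hsa hA w
    subst hsa
    rw [← hA, hs.mem_tangentSpaceOf_iff_coord i hip, ContinuousLinearEquiv.apply_symm_apply]
  have hinj : ∀ {A : Set E} {s : Rn n → E} {a : Rn n}, IsLocalParam (m := m) A s a →
      s a = p → Function.Injective (fderiv ℝ (i.1 ∘ s) a) := by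
    intro A s a hs hsa
    subst hsa
    exact (injective_fderiv_chart_comp_iff i hs.mdifferentiableAt hip).2 hs.injective
  -- `L` is injective on the common tangent plane, so both submanifolds can be parametrized by the
  -- values of `L`. After this normalisation their Taylor expansions can be compared.
  obtain ⟨L, hL⟩ := exists_continuous_leftInverse (hinj hs₀ hsa₀)
  have hLs : Function.Injective (L.comp (fderiv ℝ (i.1 ∘ s₀) a₀)) := fun x y hxy =>
    (hL x).symm.trans (hxy.trans (hL y))
  have hLt : Function.Injective (L.comp (fderiv ℝ (i.1 ∘ t₀) b₀)) := by
    rw [injective_iff_map_eq_zero]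
    intro x hx
    obtain ⟨y, hy⟩ := (hrange hs₀ hsa₀ rfl (fderiv ℝ (i.1 ∘ t₀) b₀ x)).2
      ((hrange ht₀ htb₀ hT.symm _).1 ⟨x, rfl⟩)
    have h1 : L (fderiv ℝ (i.1 ∘ t₀) b₀ x) = 0 := hx
    rw [← hy, hL] at h1
    rw [h1, map_zero] at hy
    exact hinj ht₀ htb₀ (hy.symm.trans (map_zero _).symm)
  obtain ⟨s, hs, hsa, hsL⟩ := hs₀.exists_adapted i hsa₀ hip hLs
  obtain ⟨t, ht, hta, htL⟩ := ht₀.exists_adapted i htb₀ hip hLt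
  set a := L (i.1 p) with ha
  have hσ : ContDiffAt ℝ ∞ (i.1 ∘ s) a :=
    contDiffAt_chart_comp i hs.smooth.self_of_nhds (by rwa [hsa])
  have hτ : ContDiffAt ℝ ∞ (i.1 ∘ t) a :=
    contDiffAt_chart_comp i ht.smooth.self_of_nhds (by rwa [hta])
  obtain ⟨hs1, hs2⟩ := fderiv_of_leftInverse hσ hsL
  obtain ⟨ht1, ht2⟩ := fderiv_of_leftInverse hτ htL
  have hmemts : ∀ w, w ∈ range (fderiv ℝ (i.1 ∘ t) a) ↔ w ∈ range (fderiv ℝ (i.1 ∘ s) a) :=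
    fun w => (hrange ht hta hT.symm w).trans (hrange hs hsa rfl w).symm
  have hD : fderiv ℝ (i.1 ∘ s) a = fderiv ℝ (i.1 ∘ t) a := by
    ext1 ξ
    obtain ⟨η, hη⟩ := (hmemts _).2 ⟨ξ, rfl⟩
    have h1 := congrArg L hη
    rw [ht1, hs1] at h1
    rw [← hη, h1]
  have hP' := (secondFundamentalFormVanishes_iff Γ (P := ⟨S, hS, p, hp⟩) hs hsa i hip).1 hP
  have hQ' := (secondFundamentalFormVanishes_iff Γ (P := ⟨S', hS', p, hp'⟩) ht hta i hip).1 hQ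
  refine ⟨rfl, s, t, a, hs, ht, hsa, hta, iteratedFDeriv_eq_of_le_two_iff.2 ⟨?_, hD, ?_⟩⟩
  · exact congrArg (extChartAt 𝓘(ℝ, Rn (n + m)) p) (hsa.trans hta.symm)
  · change fderiv ℝ (fderiv ℝ (i.1 ∘ s)) a = fderiv ℝ (fderiv ℝ (i.1 ∘ t)) a
    ext1 ξ
    ext1 η
    obtain ⟨x, hx⟩ := hP' ξ η
    obtain ⟨y, hy⟩ := hQ' ξ η
    rw [covHessian, hsa] at hx
    rw [covHessian, hta, ← hD] at hy
    -- The Christoffel terms coincide, so the difference of the second derivatives is tangent. It is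
    -- also killed by `L`, hence zero.
    have h1 : fderiv ℝ (i.1 ∘ s) a (x - y) = fderiv ℝ (fderiv ℝ (i.1 ∘ s)) a ξ η -
        fderiv ℝ (fderiv ℝ (i.1 ∘ t)) a ξ η := by
      rw [map_sub, hx, hy]
      abel
    have h2 := congrArg L h1
    rw [hs1, map_sub, hs2, ht2, sub_zero] at h2
    rw [h2, map_zero] at h1
    exact (sub_eq_zero.1 h1.symm)

end Contact

/-! ### Second-order jets of immersions: invariance and uniqueness -/

section GermContact

variable {n m : ℕ} {M E : Type*} [TopologicalSpace M] [ChartedSpace (Rn n) M]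
  [TopologicalSpace E] [ChartedSpace (Rn (n + m)) E]

/-- The definition writes each germ in the preferred charts at its own base points. Those charts
coincide once the base points do, which puts both germs in the same coordinates. -/
theorem jetSetoid_two_iff (f g : ImmersionGerm n m M E) :
    jetSetoid n m M E 2 f g ↔ f.pt = g.pt ∧ f.toFun f.pt = g.toFun g.pt ∧
      ∀ k ≤ 2,
        iteratedFDeriv ℝ k ((achart (Rn (n + m)) (f.toFun f.pt)).1 ∘ f.param (achart _ f.pt))
            ((achart (Rn n) f.pt).1 f.pt) =
          iteratedFDeriv ℝ k ((achart (Rn (n + m)) (f.toFun f.pt)).1 ∘ g.param (achart _ f.pt))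
            ((achart (Rn n) f.pt).1 f.pt) := by
  refine and_congr_right fun h1 => and_congr_right fun h2 => ?_
  have h3 : ∀ k, iteratedFDeriv ℝ k
      ((chartAt (Rn (n + m)) (g.toFun g.pt)) ∘ g.toFun ∘ (chartAt (Rn n) g.pt).symm)
      (chartAt (Rn n) g.pt g.pt) = iteratedFDeriv ℝ k
      ((chartAt (Rn (n + m)) (f.toFun f.pt)) ∘ g.toFun ∘ (chartAt (Rn n) f.pt).symm)
      (chartAt (Rn n) f.pt f.pt) := by
    intro k
    rw [← h2, ← h1]
  exact forall₂_congr fun k _ => Eq.congr_right (h3 k)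

variable [IsManifold 𝓘(ℝ, Rn n) ∞ M] [IsManifold 𝓘(ℝ, Rn (n + m)) ∞ E]

theorem ParamSecondFundamentalFormVanishes.of_jet_eq {Γ : Connection (n + m) E}
    {Θ : Connection n M} {f g : ImmersionGerm n m M E} (h : jetSetoid n m M E 2 f g) :
    ParamSecondFundamentalFormVanishes Γ Θ f ↔ ParamSecondFundamentalFormVanishes Γ Θ g := by
  obtain ⟨hpt, hval, hk⟩ := (jetSetoid_two_iff f g).1 h
  obtain ⟨h0, h1, h2⟩ := iteratedFDeriv_eq_of_le_two_iff.1 hk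
  have hφ := mem_chart_source (Rn n) f.pt
  have hj := mem_chart_source (Rn (n + m)) (f.toFun f.pt)
  have hf := f.param_chart (φ := achart (Rn n) f.pt) hφ
  have hg := g.param_chart (φ := achart (Rn n) f.pt) (y := f.pt) hφ
  rw [paramSecondFundamentalFormVanishes_iff Γ Θ f (φ := achart (Rn n) f.pt) hφ
      (j := achart (Rn (n + m)) (f.toFun f.pt)) hj,
    paramSecondFundamentalFormVanishes_iff Γ Θ g (φ := achart (Rn n) f.pt) (by rwa [← hpt])
      (j := achart (Rn (n + m)) (f.toFun f.pt)) (by rwa [← hval]), ← hpt]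
  have hfg : g.toFun f.pt = f.toFun f.pt := by rw [hval, hpt]
  simp only [covHessian, h1, h2, hf, hg, hfg]

theorem paramSecondFundamentalFormVanishes_iff_of_mk_eq {Γ : Connection (n + m) E}
    {Θ : Connection n M} {f g : ImmersionGerm n m M E}
    (h : (Quotient.mk _ f : ImmJ2 n m M E) = Quotient.mk _ g) :
    ParamSecondFundamentalFormVanishes Γ Θ f ↔ ParamSecondFundamentalFormVanishes Γ Θ g :=
  ParamSecondFundamentalFormVanishes.of_jet_eq (Quotient.exact h)

theorem ImmersionGerm.openChart_jet1 (f : ImmersionGerm n m M E) {φ : atlas (Rn n) M}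
    (hφ : f.pt ∈ φ.1.source) {j : atlas (Rn (n + m)) E} (hj : f.toFun f.pt ∈ j.1.source) :
    ImmJ1.openChart φ j f.jet1 = ((φ.1 f.pt, j.1 (f.toFun f.pt)),
      fderiv ℝ (j.1 ∘ f.param φ) (φ.1 f.pt)) := by
  rw [← f.jetAt_pt]
  exact (f.openChart_jetAt hφ f.immersion.self_of_nhds.1 hj f.immersion.self_of_nhds.2).2

/-- Two totally geodesic germs of immersions with the same first jet have the same second jet. -/
theorem jetSetoid_of_paramSecondFundamentalFormVanishes {Γ : Connection (n + m) E}
    {Θ : Connection n M} {f g : ImmersionGerm n m M E} (h : f.jet1 = g.jet1)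
    (hf : ParamSecondFundamentalFormVanishes Γ Θ f)
    (hg : ParamSecondFundamentalFormVanishes Γ Θ g) : jetSetoid n m M E 2 f g := by
  have hpt : f.pt = g.pt := congrArg ImmJ1.pt h
  have hval : f.toFun f.pt = g.toFun g.pt := congrArg ImmJ1.val h
  have hφ := mem_chart_source (Rn n) f.pt
  have hj := mem_chart_source (Rn (n + m)) (f.toFun f.pt)
  set φ := achart (Rn n) f.pt with hφdef
  set j := achart (Rn (n + m)) (f.toFun f.pt) with hjdef
  have hφ' : g.pt ∈ φ.1.source := by rw [← hpt]; exact hφ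
  have hj' : g.toFun g.pt ∈ j.1.source := by rw [← hval]; exact hj
  have h1 := (f.openChart_jet1 (φ := φ) hφ (j := j) hj).symm.trans
    ((congrArg (ImmJ1.openChart φ j) h).trans (g.openChart_jet1 hφ' hj'))
  have hD : fderiv ℝ (j.1 ∘ f.param φ) (φ.1 f.pt) = fderiv ℝ (j.1 ∘ g.param φ) (φ.1 f.pt) := by
    rw [hpt]
    rw [hpt] at h1
    exact congrArg Prod.snd h1
  have hf1 := f.param_chart (φ := φ) hφ
  have hg1 := g.param_chart (φ := φ) hφ'
  rw [← hpt] at hg1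
  have hfg : g.toFun f.pt = f.toFun f.pt := by rw [hval, hpt]
  have hf' := (paramSecondFundamentalFormVanishes_iff Γ Θ f (φ := φ) hφ (j := j) hj).1 hf
  have hg' := (paramSecondFundamentalFormVanishes_iff Γ Θ g hφ' hj').1 hg
  rw [← hpt] at hg'
  refine (jetSetoid_two_iff f g).2 ⟨hpt, hval, iteratedFDeriv_eq_of_le_two_iff.2 ⟨?_, hD, ?_⟩⟩
  · exact congrArg j.1 (hf1.trans (hfg.symm.trans hg1.symm))
  · ext1 ξ
    ext1 η
    -- No normalisation is needed here: the equation prescribes the full second derivative, not just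
    -- its class modulo the tangent plane.
    have h2 := hf' ξ η
    have h3 := hg' ξ η
    rw [covHessian, hf1, hD] at h2
    rw [covHessian, hg1, hfg] at h3
    exact add_right_cancel (h2.trans h3.symm)

end GermContact

/-! ### Existence of totally geodesic jets; images of germs of immersions -/

section Existence

variable {n m : ℕ} {M E : Type*} [TopologicalSpace M] [ChartedSpace (Rn n) M]
  [TopologicalSpace E] [ChartedSpace (Rn (n + m)) E]
  [IsManifold 𝓘(ℝ, Rn n) ∞ M] [IsManifold 𝓘(ℝ, Rn (n + m)) ∞ E]

/-- The polynomial of degree two with given Taylor coefficients at `a`. -/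
def quadraticMap {V W : Type*} [NormedAddCommGroup V] [NormedSpace ℝ V] [NormedAddCommGroup W]
    [NormedSpace ℝ W] (a : V) (w : W) (B : V →L[ℝ] W) (Q : V →L[ℝ] V →L[ℝ] W) (x : V) : W :=
  w + B (x - a) + (2⁻¹ : ℝ) • Q (x - a) (x - a)

section

variable {V W : Type*} [NormedAddCommGroup V] [NormedSpace ℝ V] [NormedAddCommGroup W]
  [NormedSpace ℝ W] (a : V) (w : W) (B : V →L[ℝ] W) {Q : V →L[ℝ] V →L[ℝ] W}

theorem quadraticMap_self : quadraticMap a w B Q a = w := by simp [quadraticMap]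

theorem contDiff_quadraticMap : ContDiff ℝ ∞ (quadraticMap a w B Q) := by
  unfold quadraticMap
  fun_prop

/-- The quadratic part contributes `½ (Q(x - a, y) + Q(y, x - a))`, which is `Q(x - a, y)` by
symmetry. -/
theorem fderiv_quadraticMap (hQ : ∀ x y, Q x y = Q y x) :
    fderiv ℝ (quadraticMap a w B Q) = fun x => B + Q (x - a) := by
  funext x
  have h1 : HasFDerivAt (fun x : V => x - a) (ContinuousLinearMap.id ℝ V) x :=
    (hasFDerivAt_id x).sub_const a
  have h2 := (((B.hasFDerivAt.comp x h1).const_add w).add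
    (((Q.hasFDerivAt.comp x h1).clm_apply h1).const_smul (2⁻¹ : ℝ))).fderiv
  refine Eq.trans h2 (ContinuousLinearMap.ext fun y => ?_)
  simp only [Function.comp_def, add_apply, smul_apply,
    ContinuousLinearMap.comp_apply, ContinuousLinearMap.id_apply,
    ContinuousLinearMap.flip_apply, hQ y (x - a), ← two_smul ℝ (Q (x - a) y), smul_smul]
  norm_num

theorem fderiv_fderiv_quadraticMap (hQ : ∀ x y, Q x y = Q y x) (x : V) :
    fderiv ℝ (fderiv ℝ (quadraticMap a w B Q)) x = Q := by
  rw [fderiv_quadraticMap a w B hQ]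
  exact ((Q.hasFDerivAt.comp x ((hasFDerivAt_id x).sub_const a)).const_add B).fderiv

end

/-- There is a germ of immersions with a given Taylor expansion of order two. -/
theorem exists_immersionGerm (x₀ : M) (p : E) (φ : atlas (Rn n) M) (hφ : x₀ ∈ φ.1.source)
    (j : atlas (Rn (n + m)) E) (hj : p ∈ j.1.source) {B : Rn n →L[ℝ] Rn (n + m)}
    (hB : Function.Injective B) {Q : Rn n →L[ℝ] Rn n →L[ℝ] Rn (n + m)}
    (hQ : ∀ x y, Q x y = Q y x) :
    ∃ f : ImmersionGerm n m M E, f.pt = x₀ ∧ f.toFun x₀ = p ∧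
      fderiv ℝ (j.1 ∘ f.param φ) (φ.1 x₀) = B ∧
      fderiv ℝ (fderiv ℝ (j.1 ∘ f.param φ)) (φ.1 x₀) = Q := by
  set a := φ.1 x₀ with ha
  set σ := quadraticMap a (j.1 p) B Q with hσ
  have hσa : σ a = j.1 p := quadraticMap_self a (j.1 p) B
  have hσs : ContDiff ℝ ∞ σ := contDiff_quadraticMap a (j.1 p) B
  have hσt : ∀ᶠ x in 𝓝 a, σ x ∈ j.1.target := by
    refine hσs.continuous.continuousAt (j.1.open_target.mem_nhds ?_)
    rw [hσa]
    exact j.1.map_source hj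
  set s : Rn n → E := fun x => j.1.symm (σ x) with hs
  have hsa : s a = p := by
    rw [hs]
    dsimp only
    rw [hσa, j.1.left_inv hj]
  have hss : ∀ᶠ x in 𝓝 a, ContMDiffAt 𝓘(ℝ, Rn n) 𝓘(ℝ, Rn (n + m)) ∞ s x := by
    filter_upwards [hσt] with x hx
    exact (contMDiffAt_chart_symm j hx).comp x hσs.contDiffAt.contMDiffAt
  have hjs : (j.1 ∘ s) =ᶠ[𝓝 a] σ := by
    filter_upwards [hσt] with x hx using j.1.right_inv hx
  have hD : fderiv ℝ (j.1 ∘ s) a = B := by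
    rw [hjs.fderiv_eq, hσ, fderiv_quadraticMap a (j.1 p) B hQ]
    simp
  have hinj : Function.Injective (mfderiv 𝓘(ℝ, Rn n) 𝓘(ℝ, Rn (n + m)) s a) := by
    rw [← injective_fderiv_chart_comp_iff j (hss.self_of_nhds.mdifferentiableAt (by simp))
      (by rw [hsa]; exact hj), hD]
    exact hB
  have himm : ∀ᶠ y in 𝓝 x₀, ContMDiffAt 𝓘(ℝ, Rn n) 𝓘(ℝ, Rn (n + m)) ∞ (s ∘ φ.1) y ∧
      Function.Injective (mfderiv 𝓘(ℝ, Rn n) 𝓘(ℝ, Rn (n + m)) (s ∘ φ.1) y) := by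
    filter_upwards [φ.1.open_source.mem_nhds hφ, (φ.1.continuousAt hφ).eventually
      (hss.and (eventually_injective_mfderiv hss hinj))] with y hy hy2
    refine ⟨hy2.1.comp y (contMDiffAt_chart φ hy), ?_⟩
    rw [mfderiv_comp y (hy2.1.mdifferentiableAt (by simp)) (mdifferentiableAt_chart φ hy)]
    exact hy2.2.comp ((openPartialHomeomorph_mdifferentiable φ.2).mfderiv_injective hy)
  have hparam : (j.1 ∘ (s ∘ φ.1) ∘ φ.1.symm) =ᶠ[𝓝 a] σ := by
    filter_upwards [φ.1.open_target.mem_nhds (φ.1.map_source hφ), hjs] with x hx hx2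
    refine Eq.trans ?_ hx2
    exact congrArg (j.1 ∘ s) (φ.1.right_inv hx)
  refine ⟨⟨s ∘ φ.1, x₀, himm⟩, rfl, hsa, ?_, ?_⟩
  · refine hparam.fderiv_eq.trans ?_
    rw [hσ, fderiv_quadraticMap a (j.1 p) B hQ]
    simp
  · exact hparam.fderiv.fderiv_eq.trans (fderiv_fderiv_quadraticMap a (j.1 p) B hQ a)

/-- Every first-order jet of immersions is the jet of a totally geodesic germ. -/
theorem exists_paramSecondFundamentalFormVanishes {Γ : Connection (n + m) E}
    (hΓ : Γ.torsion = 0) {Θ : Connection n M} (hΘ : Θ.torsion = 0) (θ : ImmJ1 n m M E) :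
    ∃ f : ImmersionGerm n m M E, f.jet1 = θ ∧ ParamSecondFundamentalFormVanishes Γ Θ f := by
  have hφ := mem_chart_source (Rn n) θ.pt
  have hj := mem_chart_source (Rn (n + m)) θ.val
  set φ := achart (Rn n) θ.pt with hφdef
  set j := achart (Rn (n + m)) θ.val with hjdef
  set B := θ.coord φ j with hB
  -- `Q` is the equation solved for the second derivative, `B ∘ Θ - Γ(B, B)`. Torsion-freeness of
  -- both connections makes it symmetric, as a second derivative has to be.
  obtain ⟨f, hpt, hval, hD, hQ⟩ := exists_immersionGerm θ.pt θ.val φ hφ j hj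
    (θ.coord_injective φ j)
    (Q := (ContinuousLinearMap.compL ℝ (Rn n) (Rn n) (Rn (n + m)) B).comp
        (christoffelOn Θ φ θ.pt) - (christoffelOn Γ j θ.val).bilinearComp B B) (by
      intro x y
      change B (christoffelOn Θ φ θ.pt x y) - christoffelOn Γ j θ.val (B x) (B y) =
        B (christoffelOn Θ φ θ.pt y x) - christoffelOn Γ j θ.val (B y) (B x)
      rw [christoffelOn_symm Θ hΘ φ hφ, christoffelOn_symm Γ hΓ j hj])
  have hφ' : f.pt ∈ φ.1.source := by rw [hpt]; exact hφ
  have hval' : f.toFun f.pt = θ.val := by rw [hpt, hval]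
  have hj' : f.toFun f.pt ∈ j.1.source := by rw [hval']; exact hj
  have hjet : f.jet1 = θ := by
    refine (ImmJ1.openChart φ j).injOn ⟨hφ', hj'⟩ ⟨hφ, hj⟩ ?_
    rw [f.openChart_jet1 hφ' hj', hpt, hval, hD]
    rfl
  refine ⟨f, hjet, ?_⟩
  rw [paramSecondFundamentalFormVanishes_iff Γ Θ f hφ' hj']
  intro ξ η
  rw [covHessian, f.param_chart hφ', hval', hpt, hD, hQ]
  exact sub_add_cancel _ _

/-- The source point plays no role: over an arbitrary point of `M`, the inclusion of the graph read
in charts is an injective linear map with the required image. -/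
theorem prE1_surjective [Nonempty M] :
    Function.Surjective (prE1 : ImmJ1 n m M E → J1 n m E) := by
  intro θ
  obtain ⟨hθ, u, hu⟩ := θ.mem_dividedChartAt_source
  set c := θ.dividedChartAt with hc
  let x₀ : M := Classical.arbitrary M
  have hx₀ := mem_chart_source (Rn n) x₀
  set φ := achart (Rn n) x₀ with hφ
  let η : ImmJ1 n m M E :=
    ImmJ1.ofCoord φ c.1 x₀ θ.pt (graphIncl c.2 u) (graphIncl_injective c.2 u)
  have hcoord : η.coord φ c.1 = graphIncl c.2 u := by
    refine (ImmJ1.coord_ofCoord (i := φ) (i' := φ) hx₀ hx₀ hθ hθ _ _).trans ?_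
    ext1 v
    change coordJac c.1 c.1 θ.pt (graphIncl c.2 u (coordJac φ φ x₀ v)) = _
    rw [coordJac_self hθ, coordJac_self (i := φ) hx₀]
  have hAA : ∀ x, c.2 (graphIncl c.2 u x) = (x, u x) := fun x => c.2.apply_symm_apply _
  have hbase : baseBlock c.2 (graphIncl c.2 u) = 1 :=
    ContinuousLinearMap.ext fun x => congrArg Prod.fst (hAA x)
  have hfibre : fibreBlock c.2 (graphIncl c.2 u) = u :=
    ContinuousLinearMap.ext fun x => congrArg Prod.snd (hAA x)
  have hη : IsGraphOf c (prE1 η) u := by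
    rw [isGraphOf_prE1_iff c φ, hcoord, hbase, hfibre]
    exact ⟨isUnit_one, rfl⟩
  exact ⟨η, hη.eq_ofGraph.symm.trans hu.eq_ofGraph⟩

/-- The neighbourhood defining `f.image` is an unspecified choice. It suffices that `f` is an
immersion with values in that submanifold near `f.pt`. -/
theorem ImmersionGerm.isLocalParam_image (f : ImmersionGerm n m M E) {φ : atlas (Rn n) M}
    (hφ : f.pt ∈ φ.1.source) :
    IsLocalParam (m := m) f.image.carrier (f.param φ) (φ.1 f.pt) := by
  refine IsLocalParam.of_immersion f.image.isEmbedded (f.eventually_contMDiffAt_param hφ)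
    (f.injective_mfderiv_param hφ) ?_
  filter_upwards [f.eventually_param hφ f.exists_image.choose_spec.1] with x hx
  exact ⟨_, hx.2, rfl⟩

/-- Both planes are graphs of the same linear map in a common divided chart. Comparing slopes avoids
an equality of subspaces of tangent spaces whose base points are only propositionally equal. -/
theorem ImmersionGerm.jet1_eq_prE1_jetAt (f : ImmersionGerm n m M E) {φ : atlas (Rn n) M} {y : M}
    (hy : y ∈ φ.1.source) (hf : ContMDiffAt 𝓘(ℝ, Rn n) 𝓘(ℝ, Rn (n + m)) ∞ f.toFun y)
    (hinj : Function.Injective (mfderiv 𝓘(ℝ, Rn n) 𝓘(ℝ, Rn (n + m)) f.toFun y))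
    {P : PointedSubmanifold n m E} (hP : f.toFun y = P.pt)
    (h : IsLocalParam (m := m) P.carrier (f.param φ) (φ.1 y)) :
    TotGeod.jet1 P.isEmbedded P.mem = prE1 (f.jetAt y) := by
  have hsa : f.param φ (φ.1 y) = P.pt := (f.param_chart hy).trans hP
  have hval : (f.jetAt y).val = P.pt := by rw [f.jetAt_eq hinj, ← hP]
  obtain ⟨A, l, hl⟩ := exists_dividedChart (prE1 (f.jetAt y))
  set j := achart (Rn (n + m)) (prE1 (f.jetAt y)).pt with hj
  have hjP : P.pt ∈ j.1.source := by
    rw [← hval]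
    exact mem_chart_source _ (f.jetAt y).val
  have hcoord : (f.jetAt y).coord φ j = fderiv ℝ (j.1 ∘ f.param φ) (φ.1 y) :=
    congrArg Prod.snd (f.openChart_jetAt hy hf (hP ▸ hjP) hinj).2
  have h1 := (isGraphOf_prE1_iff (j, A) φ (f.jetAt y) l).1 hl
  rw [hcoord] at h1
  have h2 := (h.isGraphOf_iff (c := (j, A)) hsa hjP l).2 h1
  refine h2.eq_ofGraph.symm.trans (Eq.trans ?_ hl.eq_ofGraph)
  exact congrArg (fun p => ofGraph (j, A) p l) hval.symm

theorem ImmersionGerm.jet1_image (f : ImmersionGerm n m M E) :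
    TotGeod.jet1 f.image.isEmbedded f.image.mem = prE1 f.jet1 := by
  have hφ := mem_chart_source (Rn n) f.pt
  rw [f.jet1_eq_prE1_jetAt (φ := achart (Rn n) f.pt) (P := f.image) hφ f.immersion.self_of_nhds.1
    f.immersion.self_of_nhds.2 rfl (f.isLocalParam_image hφ), f.jetAt_pt]

/-- The claim is local because `f.prolong` contains jets at all points where the derivative is
injective, whereas `f.image` only comes from a small neighbourhood of `f.pt`. -/
theorem ImmersionGerm.eventually_prE1_mem_prolong (f : ImmersionGerm n m M E) :
    ∀ᶠ z in 𝓝[f.prolong] f.jet1, prE1 z ∈ f.image.prolong := by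
  have hφ := mem_chart_source (Rn n) f.pt
  set φ := achart (Rn n) f.pt with hφdef
  have h1 : ∀ᶠ y in 𝓝 f.pt, y ∈ φ.1.source ∧
      ContMDiffAt 𝓘(ℝ, Rn n) 𝓘(ℝ, Rn (n + m)) ∞ f.toFun y ∧
      IsLocalParam (m := m) f.image.carrier (f.param φ) (φ.1 y) ∧ f.toFun y ∈ f.image.carrier := by
    filter_upwards [φ.1.open_source.mem_nhds hφ, f.immersion,
      (φ.1.continuousAt hφ).eventually (f.isLocalParam_image (φ := φ) hφ).eventually,
      f.exists_image.choose_spec.1] with y h2 h3 h4 h5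
    exact ⟨h2, h3.1, h4, y, h5, rfl⟩
  have h2 : Tendsto (ImmJ1.pt : ImmJ1 n m M E → M) (𝓝[f.prolong] f.jet1) (𝓝 f.pt) :=
    (ImmJ1.contMDiff_pt f.jet1).continuousAt.tendsto.mono_left nhdsWithin_le_nhds
  filter_upwards [h2.eventually h1, self_mem_nhdsWithin] with z hz hzf
  obtain ⟨y, hy, rfl⟩ := hzf
  obtain ⟨hz1, hz2, hz3, hz4⟩ := hz
  refine ⟨f.toFun y, hz4, ?_⟩
  rw [← f.jetAt_eq hy]
  exact (f.jet1_eq_prE1_jetAt (P := ⟨_, f.image.isEmbedded, f.toFun y, hz4⟩) hz1 hz2 hy rfl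
    hz3).symm

/-- The covariant Hessian equals `Dσ(Θ(ξ, η))`, which is tangent to the image. -/
theorem ParamSecondFundamentalFormVanishes.image {Γ : Connection (n + m) E} {Θ : Connection n M}
    {f : ImmersionGerm n m M E} (h : ParamSecondFundamentalFormVanishes Γ Θ f) :
    SecondFundamentalFormVanishes Γ f.image := by
  have hφ := mem_chart_source (Rn n) f.pt
  have hj := mem_chart_source (Rn (n + m)) (f.toFun f.pt)
  rw [secondFundamentalFormVanishes_iff Γ (f.isLocalParam_image (φ := achart (Rn n) f.pt) hφ)
    (f.param_chart hφ) (achart _ (f.toFun f.pt)) hj]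
  intro ξ η
  rw [(paramSecondFundamentalFormVanishes_iff Γ Θ f (φ := achart (Rn n) f.pt) hφ
    (j := achart _ (f.toFun f.pt)) hj).1 h ξ η]
  exact ⟨_, rfl⟩

/-- Every plane is the tangent plane of a submanifold with vanishing second fundamental form. -/
theorem exists_secondFundamentalFormVanishes {Γ : Connection (n + m) E} (hΓ : Γ.torsion = 0)
    (θ : J1 n m E) : ∃ P : PointedSubmanifold n m E, jet1 P.isEmbedded P.mem = θ ∧
      SecondFundamentalFormVanishes Γ P := by
  -- The plane is lifted to a jet of immersions with auxiliary source `ℝⁿ`. The germ chosen below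
  -- has covariant Hessian zero, the simplest tangent value.
  obtain ⟨η, rfl⟩ := prE1_surjective (M := Rn n) θ
  have hφ := mem_chart_source (Rn n) η.pt
  have hj := mem_chart_source (Rn (n + m)) η.val
  set φ := achart (Rn n) η.pt with hφdef
  set j := achart (Rn (n + m)) η.val with hjdef
  set B := η.coord φ j with hB
  obtain ⟨f, hpt, hval, hD, hQ⟩ := exists_immersionGerm η.pt η.val φ hφ j hj
    (η.coord_injective φ j) (Q := -(christoffelOn Γ j η.val).bilinearComp B B) (by
      intro x y
      change -christoffelOn Γ j η.val (B x) (B y) = -christoffelOn Γ j η.val (B y) (B x)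
      rw [christoffelOn_symm Γ hΓ j hj])
  have hφ' : f.pt ∈ φ.1.source := by rw [hpt]; exact hφ
  have hval' : f.toFun f.pt = η.val := by rw [hpt, hval]
  have hj' : f.toFun f.pt ∈ j.1.source := by rw [hval']; exact hj
  have hjet : f.jet1 = η := by
    refine (ImmJ1.openChart φ j).injOn ⟨hφ', hj'⟩ ⟨hφ, hj⟩ ?_
    rw [f.openChart_jet1 hφ' hj', hpt, hval, hD]
    rfl
  refine ⟨f.image, f.jet1_image.trans (congrArg prE1 hjet), ?_⟩
  rw [secondFundamentalFormVanishes_iff Γ (f.isLocalParam_image hφ') (f.param_chart hφ') j hj']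
  intro ξ η'
  refine ⟨0, ?_⟩
  rw [covHessian, f.param_chart hφ', hval', hpt, hD, hQ, map_zero]
  exact (neg_add_cancel _).symm

end Existence

/-- The spanning velocities of curves `γ` in `S` go to the velocities of `F ∘ γ`, which stays in
`S'` for small times. -/
theorem mfderiv_mem_tangentSpaceOf {V V' : Type*} [NormedAddCommGroup V] [NormedSpace ℝ V]
    [NormedAddCommGroup V'] [NormedSpace ℝ V'] {N N' : Type*} [TopologicalSpace N]
    [ChartedSpace V N] [TopologicalSpace N'] [ChartedSpace V' N'] {F : N → N'} {x : N}
    (hF : MDifferentiableAt 𝓘(ℝ, V) 𝓘(ℝ, V') F x) {S : Set N} {S' : Set N'}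
    (hS : ∀ᶠ z in 𝓝[S] x, F z ∈ S') {ζ : TangentSpace 𝓘(ℝ, V) x}
    (hζ : ζ ∈ tangentSpaceOf (V := V) S x) :
    mfderiv 𝓘(ℝ, V) 𝓘(ℝ, V') F x ζ ∈ tangentSpaceOf (V := V') S' (F x) := by
  have h : tangentSpaceOf (V := V) S x ≤ (tangentSpaceOf (V := V') S' (F x)).comap
      (mfderiv 𝓘(ℝ, V) 𝓘(ℝ, V') F x).toLinearMap := by
    refine Submodule.span_le.2 ?_
    rintro v ⟨γ, rfl, hγS, hγd, hγv⟩
    refine Submodule.subset_span ⟨F ∘ γ, rfl, ?_, hF.comp (0 : ℝ) hγd, ?_⟩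
    · have h2 : Tendsto γ (𝓝 0) (𝓝[S] (γ 0)) :=
        tendsto_nhdsWithin_iff.2 ⟨hγd.continuousAt, hγS⟩
      exact h2.eventually hS
    · rw [mfderiv_comp (0 : ℝ) hF hγd]
      exact congrArg (fun w : V => (mfderiv 𝓘(ℝ, V) 𝓘(ℝ, V') F (γ 0) w : V')) hγv
  exact h hζ

/-! ### The structures `Γ̈` and `Γ̈_{pr_M}` -/

section Structures

variable {n m : ℕ} {M E : Type*} [TopologicalSpace M] [ChartedSpace (Rn n) M]
  [TopologicalSpace E] [ChartedSpace (Rn (n + m)) E]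
  [IsManifold 𝓘(ℝ, Rn (n + m)) ∞ E] {Γ : Connection (n + m) E}

/-- `rPlane` is computed from the representative `Quot.out (G θ)`, so the horizontality of the
`R`-plane is a condition on this submanifold. By `prolong_horizontal_iff` in the preferred chart it
says that the second fundamental form vanishes. -/
theorem isGrassmannianStructure_iff {G : J1 n m E → J2 n m E} :
    IsGrassmannianStructure Γ G ↔
      ∀ θ, jet1 (Quot.out (G θ)).isEmbedded (Quot.out (G θ)).mem = θ ∧
        SecondFundamentalFormVanishes Γ (Quot.out (G θ)) := by
  have hproj : ∀ θ, (G θ).proj = jet1 (Quot.out (G θ)).isEmbedded (Quot.out (G θ)).mem :=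
    fun θ => congrArg J2.proj (Quot.out_eq (G θ)).symm
  constructor
  · intro hG θ
    have h1 := (hproj θ).symm.trans (hG.proj_eq θ)
    exact ⟨h1, (prolong_horizontal_iff Γ h1 θ.mem_dividedChartAt_source).1 fun ζ =>
      (hG.mem_rPlane_iff θ ζ).trans (horizontal_j1_iff Γ θ ζ)⟩
  · intro h
    exact ⟨fun θ => (hproj θ).trans (h θ).1, fun θ ζ =>
      ((prolong_horizontal_iff Γ (h θ).1 θ.mem_dividedChartAt_source).2 (h θ).2 ζ).trans
        (horizontal_j1_iff Γ θ ζ).symm⟩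

/-- Two totally geodesic representatives with the same tangent plane have contact of order two.
Uniqueness, the description of the range and the compatibility with `prE2` all rest on this. -/
theorem IsGrassmannianStructure.eq_mk {G : J1 n m E → J2 n m E}
    (hG : IsGrassmannianStructure Γ G) {P : PointedSubmanifold n m E} {θ : J1 n m E}
    (hP : jet1 P.isEmbedded P.mem = θ) (hII : SecondFundamentalFormVanishes Γ P) :
    G θ = Quot.mk _ P := by
  obtain ⟨h1, h2⟩ := isGrassmannianStructure_iff.1 hG θ
  rw [← Quot.out_eq (G θ)]
  exact Quot.sound (hasContact_of_secondFundamentalFormVanishes (h1.trans hP.symm) h2 hII)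

theorem existsUnique_isGrassmannianStructure (hΓ : Γ.torsion = 0) :
    ∃! G : J1 n m E → J2 n m E, IsGrassmannianStructure Γ G := by
  choose P hP hII using fun θ : J1 n m E => exists_secondFundamentalFormVanishes hΓ θ
  refine ⟨fun θ => Quot.mk _ (P θ), isGrassmannianStructure_iff.2 fun θ => ?_, fun G hG =>
    funext fun θ => hG.eq_mk (hP θ) (hII θ)⟩
  have h := Quot.out_eq (Quot.mk _ (P θ) : J2 n m E)
  exact ⟨(congrArg J2.proj h).trans (hP θ),
    (secondFundamentalFormVanishes_iff_of_mk_eq h).2 (hII θ)⟩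

theorem IsGrassmannianStructure.range_eq {G : J1 n m E → J2 n m E}
    (hG : IsGrassmannianStructure Γ G) : range G = unparamEquation Γ := by
  ext θ
  constructor
  · rintro ⟨η, rfl⟩
    exact ⟨_, Quot.out_eq _, (isGrassmannianStructure_iff.1 hG η).2⟩
  · rintro ⟨P, rfl, hII⟩
    exact ⟨_, hG.eq_mk rfl hII⟩

/-- The definition describes each plane in the preferred chart at its own point, which varies with
`θ`. Smoothness requires the description in a fixed chart, and the vanishing of the second
fundamental form, being independent of charts, provides the passage. -/
theorem IsGrassmannianStructure.mem_rPlane_iff_chart {G : J1 n m E → J2 n m E}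
    (hG : IsGrassmannianStructure Γ G) {c : DividedChart n m E} {θ : J1 n m E}
    (hθ : θ ∈ (J1.openChart c).source) (ζ : TangentSpace 𝓘(ℝ, J1Model n m) θ) :
    ζ ∈ (G θ).rPlane θ ↔ ∃ x : Rn n,
      (mfderiv 𝓘(ℝ, J1Model n m) 𝓘(ℝ, J1Model n m) (J1.openChart c) θ ζ : J1Model n m) =
        grassHorizontal Γ c (J1.openChart c θ) x := by
  obtain ⟨h1, h2⟩ := isGrassmannianStructure_iff.1 hG θ
  exact (prolong_horizontal_iff Γ h1 hθ).2 h2 ζ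

theorem IsGrassmannianStructure.isSmoothDistribution [T2Space E] {G : J1 n m E → J2 n m E}
    (hG : IsGrassmannianStructure Γ G) (hΓ : Γ.ContMDiffCovariantDerivative ∞) :
    IsSmoothDistribution n fun θ => (G θ).rPlane θ :=
  isSmoothDistribution_of_chart fun θ₀ => ⟨J1.openChart θ₀.dividedChartAt,
    J1.openChart_mem_atlas _, θ₀.mem_dividedChartAt_source, grassHorizontal Γ θ₀.dividedChartAt,
    contDiffOn_grassHorizontal Γ hΓ _, fun _ hθ =>
      ⟨grassHorizontal_injective Γ _ _, hG.mem_rPlane_iff_chart hθ⟩⟩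

/-- The `R`-planes are transversal to the fibres of `J¹(E,n) → E`. -/
theorem IsGrassmannianStructure.injOn_mfderiv_pt {G : J1 n m E → J2 n m E}
    (hG : IsGrassmannianStructure Γ G) (θ : J1 n m E) :
    InjOn (mfderiv 𝓘(ℝ, J1Model n m) 𝓘(ℝ, Rn (n + m)) J1.pt θ) ((G θ).rPlane θ) := by
  have hθ := θ.mem_dividedChartAt_source
  intro ζ hζ ζ' hζ' h
  obtain ⟨x, hx⟩ := (hG.mem_rPlane_iff_chart hθ ζ).1 hζ
  obtain ⟨x', hx'⟩ := (hG.mem_rPlane_iff_chart hθ ζ').1 hζ'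
  have h1 := congrArg (tangentCoord θ.dividedChartAt.1 θ.pt) h
  have h2 := (J1.tangentCoord_mfderiv_pt _ hθ ζ).symm.trans
    (h1.trans (J1.tangentCoord_mfderiv_pt _ hθ ζ'))
  have h3 : x = x' := graphIncl_injective _ _ <|
    (congrArg (fun z : J1Model n m => z.1) hx).symm.trans
      (h2.trans (congrArg (fun z : J1Model n m => z.1) hx'))
  refine (openPartialHomeomorph_mdifferentiable
    (J1.openChart_mem_atlas θ.dividedChartAt)).mfderiv_injective hθ ?_
  exact hx.trans ((congrArg _ h3).trans hx'.symm)

variable [IsManifold 𝓘(ℝ, Rn n) ∞ M] {Θ : Connection n M}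

theorem isParamStructure_iff {G : ImmJ1 n m M E → ImmJ2 n m M E} :
    IsParamStructure Γ Θ G ↔
      ∀ θ, (Quot.out (G θ) : ImmersionGerm n m M E).jet1 = θ ∧
        ParamSecondFundamentalFormVanishes Γ Θ (Quot.out (G θ)) := by
  have hproj : ∀ θ, (G θ).proj = (Quot.out (G θ) : ImmersionGerm n m M E).jet1 :=
    fun θ => congrArg ImmJ2.proj (Quot.out_eq (G θ)).symm
  constructor
  · intro hG θ
    have h1 := (hproj θ).symm.trans (hG.proj_eq θ)
    exact ⟨h1, (prolong_horizontal_iff_param Γ Θ h1 (mem_chart_source _ θ)).1 fun ζ =>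
      (hG.mem_rPlane_iff θ ζ).trans (horizontal_immJ1_iff Γ Θ θ ζ)⟩
  · intro h
    exact ⟨fun θ => (hproj θ).trans (h θ).1, fun θ ζ =>
      ((prolong_horizontal_iff_param Γ Θ (h θ).1 (mem_chart_source _ θ)).2 (h θ).2 ζ).trans
        (horizontal_immJ1_iff Γ Θ θ ζ).symm⟩

/-- The first jet and the equation of totally geodesic maps determine the second jet. -/
theorem IsParamStructure.eq_mk {G : ImmJ1 n m M E → ImmJ2 n m M E}
    (hG : IsParamStructure Γ Θ G) {f : ImmersionGerm n m M E} {θ : ImmJ1 n m M E}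
    (hf : f.jet1 = θ) (hII : ParamSecondFundamentalFormVanishes Γ Θ f) :
    G θ = Quotient.mk _ f := by
  obtain ⟨h1, h2⟩ := isParamStructure_iff.1 hG θ
  rw [← Quot.out_eq (G θ)]
  exact Quot.sound (jetSetoid_of_paramSecondFundamentalFormVanishes (h1.trans hf.symm) h2 hII)

theorem existsUnique_isParamStructure (hΓ : Γ.torsion = 0) (hΘ : Θ.torsion = 0) :
    ∃! G : ImmJ1 n m M E → ImmJ2 n m M E, IsParamStructure Γ Θ G := by
  choose f hf hII using fun θ : ImmJ1 n m M E =>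
    exists_paramSecondFundamentalFormVanishes hΓ hΘ θ
  refine ⟨fun θ => Quotient.mk _ (f θ), isParamStructure_iff.2 fun θ => ?_, fun G hG =>
    funext fun θ => hG.eq_mk (hf θ) (hII θ)⟩
  have h := Quot.out_eq (Quotient.mk _ (f θ) : ImmJ2 n m M E)
  exact ⟨(congrArg ImmJ2.proj h).trans (hf θ),
    (paramSecondFundamentalFormVanishes_iff_of_mk_eq h).2 (hII θ)⟩

theorem IsParamStructure.range_eq {G : ImmJ1 n m M E → ImmJ2 n m M E}
    (hG : IsParamStructure Γ Θ G) : range G = paramEquation Γ Θ := by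
  ext θ
  constructor
  · rintro ⟨η, rfl⟩
    exact ⟨_, Quot.out_eq _, (isParamStructure_iff.1 hG η).2⟩
  · rintro ⟨f, rfl, hII⟩
    exact ⟨_, hG.eq_mk rfl hII⟩

theorem IsParamStructure.mem_rPlane_iff_chart {G : ImmJ1 n m M E → ImmJ2 n m M E}
    (hG : IsParamStructure Γ Θ G) {i : atlas (Rn n) M} {j : atlas (Rn (n + m)) E}
    {θ : ImmJ1 n m M E} (hθ : θ ∈ (ImmJ1.openChart i j).source)
    (ζ : TangentSpace 𝓘(ℝ, ImmJ1Model n m) θ) :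
    ζ ∈ (G θ).rPlane θ ↔ ∃ ξ : Rn n,
      (mfderiv 𝓘(ℝ, ImmJ1Model n m) 𝓘(ℝ, ImmJ1Model n m) (ImmJ1.openChart i j) θ ζ :
        ImmJ1Model n m) = immHorizontal Γ Θ i j (ImmJ1.openChart i j θ) ξ := by
  obtain ⟨h1, h2⟩ := isParamStructure_iff.1 hG θ
  exact (prolong_horizontal_iff_param Γ Θ h1 hθ).2 h2 ζ

theorem IsParamStructure.isSmoothDistribution [T2Space M] [T2Space E]
    {G : ImmJ1 n m M E → ImmJ2 n m M E} (hG : IsParamStructure Γ Θ G)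
    (hΓ : Γ.ContMDiffCovariantDerivative ∞) (hΘ : Θ.ContMDiffCovariantDerivative ∞) :
    IsSmoothDistribution n fun θ => (G θ).rPlane θ :=
  isSmoothDistribution_of_chart fun θ₀ => ⟨ImmJ1.openChart (achart _ θ₀.pt) (achart _ θ₀.val),
    ImmJ1.openChart_mem_atlas _ _, mem_chart_source _ θ₀, immHorizontal Γ Θ _ _,
    contDiffOn_immHorizontal Γ hΓ Θ hΘ _ _, fun _ hθ =>
      ⟨immHorizontal_injective Γ Θ _ _ _, hG.mem_rPlane_iff_chart hθ⟩⟩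

/-- The derivative of `Imm J¹ pr_M → E` maps the `R`-plane at `(x, p, l)` bijectively onto the
image of `l`. -/
theorem IsParamStructure.bijOn_mfderiv_val {G : ImmJ1 n m M E → ImmJ2 n m M E}
    (hG : IsParamStructure Γ Θ G) (θ : ImmJ1 n m M E) :
    BijOn (mfderiv 𝓘(ℝ, ImmJ1Model n m) 𝓘(ℝ, Rn (n + m)) ImmJ1.val θ) ((G θ).rPlane θ)
      (LinearMap.range θ.lin.toLinearMap) := by
  set i := achart (Rn n) θ.pt with hi
  set j := achart (Rn (n + m)) θ.val with hj
  have hθ : θ ∈ (ImmJ1.openChart i j).source := mem_chart_source (ImmJ1Model n m) θ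
  have hmem := hG.mem_rPlane_iff_chart hθ
  refine ⟨fun ζ hζ => ?_, fun ζ hζ ζ' hζ' h => ?_, ?_⟩
  · exact ⟨_, ((hG.mem_rPlane_iff θ ζ).1 hζ).1.symm⟩
  · obtain ⟨x, hx⟩ := (hmem ζ).1 hζ
    obtain ⟨x', hx'⟩ := (hmem ζ').1 hζ'
    have h1 := congrArg (tangentCoord j θ.val) h
    have h2 := (ImmJ1.tangentCoord_mfderiv_val i j hθ ζ).symm.trans
      (h1.trans (ImmJ1.tangentCoord_mfderiv_val i j hθ ζ'))
    have h3 : x = x' := θ.coord_injective i j <|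
      (congrArg (fun z : ImmJ1Model n m => z.1.2) hx).symm.trans
        (h2.trans (congrArg (fun z : ImmJ1Model n m => z.1.2) hx'))
    refine (openPartialHomeomorph_mdifferentiable (ImmJ1.openChart_mem_atlas i j)).mfderiv_injective hθ ?_
    exact hx.trans ((congrArg _ h3).trans hx'.symm)
  · rintro _ ⟨w, rfl⟩
    obtain ⟨ζ, hζ⟩ := exists_mfderiv_eq (ImmJ1.openChart_mem_atlas i j) hθ
      (immHorizontal Γ Θ i j (ImmJ1.openChart i j θ) (tangentCoord i θ.pt w))
    refine ⟨ζ, (hmem ζ).2 ⟨_, hζ⟩, (tangentCoord j θ.val).injective ?_⟩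
    refine (ImmJ1.tangentCoord_mfderiv_val i j hθ ζ).trans
      ((congrArg (fun z : ImmJ1Model n m => z.1.2) hζ).trans ?_)
    change tangentCoord j θ.val (θ.lin ((tangentCoord i θ.pt).symm (tangentCoord i θ.pt w))) = _
    rw [ContinuousLinearEquiv.symm_apply_apply]
    rfl

/-- The image of the representing germ is totally geodesic at the point and has tangent plane `prE1
θ`, so it represents the value of `G` there. -/
theorem prE2_eq {G : J1 n m E → J2 n m E} {G' : ImmJ1 n m M E → ImmJ2 n m M E}
    (hG : IsGrassmannianStructure Γ G) (hG' : IsParamStructure Γ Θ G') (θ : ImmJ1 n m M E) :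
    prE2 (G' θ) = G (prE1 θ) := by
  obtain ⟨h1, h2⟩ := isParamStructure_iff.1 hG' θ
  refine (hG.eq_mk ?_ h2.image).symm
  exact (ImmersionGerm.jet1_image _).trans (congrArg prE1 h1)

/-- `prE1` maps the prolongation of the representing germ into that of its image. The tangent space
of the latter is horizontal because the image is totally geodesic at the point. -/
theorem mfderiv_prE1_mem_rPlane {G : J1 n m E → J2 n m E} {G' : ImmJ1 n m M E → ImmJ2 n m M E}
    (hG : IsGrassmannianStructure Γ G) (hG' : IsParamStructure Γ Θ G') (θ : ImmJ1 n m M E)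
    {ζ : TangentSpace 𝓘(ℝ, ImmJ1Model n m) θ} (hζ : ζ ∈ (G' θ).rPlane θ) :
    mfderiv 𝓘(ℝ, ImmJ1Model n m) 𝓘(ℝ, J1Model n m) prE1 θ ζ ∈ (G (prE1 θ)).rPlane (prE1 θ) := by
  obtain ⟨h1, h2⟩ := isParamStructure_iff.1 hG' θ
  change ζ ∈ tangentSpaceOf (V := ImmJ1Model n m)
    (Quot.out (G' θ) : ImmersionGerm n m M E).prolong θ at hζ
  -- The representative depends on `θ`; making it a variable allows `θ` to be replaced by `f.jet1`.
  generalize (Quot.out (G' θ) : ImmersionGerm n m M E) = f at h1 h2 hζ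
  subst h1
  have h3 := mfderiv_mem_tangentSpaceOf ((contMDiff_prE1 f.jet1).mdifferentiableAt (by simp))
    f.eventually_prE1_mem_prolong hζ
  have hc := (prE1 f.jet1).mem_dividedChartAt_source
  exact (hG.mem_rPlane_iff_chart hc _).2
    (((prolong_horizontal_iff Γ f.jet1_image hc).2 h2.image _).1 h3)

/-- Both `R`-planes are compared with their projections to `E`. The one at `θ` projects bijectively
onto the plane `prE1 θ`, the one at `prE1 θ` projects injectively into it, and the projections
commute with `prE1`. -/
theorem bijOn_mfderiv_prE1 {G : J1 n m E → J2 n m E} {G' : ImmJ1 n m M E → ImmJ2 n m M E}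
    (hG : IsGrassmannianStructure Γ G) (hG' : IsParamStructure Γ Θ G') (θ : ImmJ1 n m M E) :
    BijOn (mfderiv 𝓘(ℝ, ImmJ1Model n m) 𝓘(ℝ, J1Model n m) prE1 θ) ((G' θ).rPlane θ)
      ((G (prE1 θ)).rPlane (prE1 θ)) := by
  have hmaps : MapsTo (mfderiv 𝓘(ℝ, ImmJ1Model n m) 𝓘(ℝ, J1Model n m) prE1 θ)
      ((G' θ).rPlane θ) ((G (prE1 θ)).rPlane (prE1 θ)) :=
    fun ζ hζ => mfderiv_prE1_mem_rPlane hG hG' θ hζ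
  have hval := hG'.bijOn_mfderiv_val θ
  have hcomp : ∀ ζ : TangentSpace 𝓘(ℝ, ImmJ1Model n m) θ,
      (mfderiv 𝓘(ℝ, ImmJ1Model n m) 𝓘(ℝ, Rn (n + m)) ImmJ1.val θ ζ : Rn (n + m)) =
      mfderiv 𝓘(ℝ, J1Model n m) 𝓘(ℝ, Rn (n + m)) J1.pt (prE1 θ)
        (mfderiv 𝓘(ℝ, ImmJ1Model n m) 𝓘(ℝ, J1Model n m) prE1 θ ζ) := by
    intro ζ
    have h1 := mfderiv_comp θ ((J1.contMDiff_pt (prE1 θ)).mdifferentiableAt (by simp))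
      ((contMDiff_prE1 (M := M) θ).mdifferentiableAt (by simp))
    exact DFunLike.congr_fun h1 ζ
  refine ⟨hmaps, fun ζ hζ ζ' hζ' h => hval.injOn hζ hζ' ?_, fun w hw => ?_⟩
  · exact (hcomp ζ).trans ((congrArg _ h).trans (hcomp ζ').symm)
  · obtain ⟨ζ, hζ, hζw⟩ := hval.surjOn ((hG.mem_rPlane_iff _ w).1 hw).1
    exact ⟨ζ, hζ, hG.injOn_mfderiv_pt (prE1 θ) (hmaps hζ) hw ((hcomp ζ).symm.trans hζw)⟩

end Structures

end TotGeod

end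

/-! ### The covering theorem -/

theorem mainTheorem10 (n m : ℕ)
    {M : Type*} [TopologicalSpace M] [ChartedSpace (TotGeod.Rn n) M]
    [IsManifold 𝓘(ℝ, TotGeod.Rn n) ∞ M] [T2Space M] [Nonempty M]
    {E : Type*} [TopologicalSpace E] [ChartedSpace (TotGeod.Rn (n + m)) E]
    [IsManifold 𝓘(ℝ, TotGeod.Rn (n + m)) ∞ E] [T2Space E]
    (Γ : TotGeod.Connection (n + m) E) (hΓ : Γ.ContMDiffCovariantDerivative ∞)
    (hΓ_torsion : Γ.torsion = 0)
    (Θ : TotGeod.Connection n M) (hΘ : Θ.ContMDiffCovariantDerivative ∞)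
    (hΘ_torsion : Θ.torsion = 0) :
    (∃! G : TotGeod.J1 n m E → TotGeod.J2 n m E, TotGeod.IsGrassmannianStructure Γ G) ∧
    (∃! G' : TotGeod.ImmJ1 n m M E → TotGeod.ImmJ2 n m M E, TotGeod.IsParamStructure Γ Θ G') ∧
    ∀ (G : TotGeod.J1 n m E → TotGeod.J2 n m E)
      (G' : TotGeod.ImmJ1 n m M E → TotGeod.ImmJ2 n m M E),
      TotGeod.IsGrassmannianStructure Γ G → TotGeod.IsParamStructure Γ Θ G' →
        Set.range G = TotGeod.unparamEquation Γ ∧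
        Set.range G' = TotGeod.paramEquation Γ Θ ∧
        (∀ θ, TotGeod.prE2 (G' θ) = G (TotGeod.prE1 θ)) ∧
        TotGeod.IsCovering n (TotGeod.prE1 : TotGeod.ImmJ1 n m M E → TotGeod.J1 n m E)
          (fun θ => (G' θ).rPlane θ) (fun θ => (G θ).rPlane θ) := by
  refine ⟨TotGeod.existsUnique_isGrassmannianStructure hΓ_torsion,
    TotGeod.existsUnique_isParamStructure hΓ_torsion hΘ_torsion, fun G G' hG hG' =>
      ⟨hG.range_eq, hG'.range_eq, TotGeod.prE2_eq hG hG', ?_⟩⟩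
  exact ⟨hG'.isSmoothDistribution hΓ hΘ, hG.isSmoothDistribution hΓ, TotGeod.contMDiff_prE1,
    TotGeod.prE1_surjective, TotGeod.bijOn_mfderiv_prE1 hG hG'⟩
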